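/- **Setting.** Let $d\ge 1$, and let $\mathbb B$ be the set of positively oriented nearest-neighbour edges $(x,x+\hat e_i)$ of $\mathbb Z^d$. Let $\varrho$ be a nonzero finite measure on $\mathbb R$ with compact support in $(0,\infty)$ and $V(\eta)=-\log\int\varrho(d\kappa)\,e^{-\kappa\eta^2/2}$. Translations act on $\mathbb R^{\mathbb B}$ by $(\tau_x\eta)_{yz}=\eta_{y+x,z+x}$. If the oriented sum of $\eta\in\mathbb R^{\mathbb B}$ around every lattice 4-cycle vanishes (loop condition), then $\eta_{xy}=\phi_y-\phi_x$ for a height function $\phi:\mathbb Z^d\to\mathbb R$ that is unique up to an additive constant. A probability measure $\mu$ on $\mathbb R^{\mathbb B}$ is a *gradient Gibbs measure* for $V$ if $\mu$-a.e. $\eta$ satisfies the loop condition and, for every finite $\Lambda\subset\mathbb Z^d$, the regular conditional law of $\eta$ given the height differences $\phi_y-\phi_x$, $x,y\notin\Lambda$, is a.s. the law of the gradient of the following random height function: it equals $\phi$ outside $\Lambda$, and its values $(\phi'_x)_{x\in\Lambda}$ have Lebesgue density proportional to $\exp\{-\sum V(\phi'_y-\phi'_x)\}$, the sum being over all edges with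 at least one endpoint in $\Lambda$. It is *ergodic* if translation-invariant events have probability $0$ or $1$, and has *tilt* $t\in\mathbb R^d$ if every $\eta_b$ is integrable and $E_\mu(\eta_b)=t\cdot b$ for every edge $b$ (regarded as a vector). The *extension* $\tilde\mu$ of $\mu$ is the unique probability measure on pairs $(\eta,\kappa)\in\mathbb R^{\mathbb B}\times\mathbb R^{\mathbb B}$ such that, for all finite $\Lambda\subset\mathbb B$ and Borel sets $A\subset\mathbb R^{\mathbb B}$, $B\subset\mathbb R^\Lambda$, $$\tilde\mu\bigl(\eta\in A,\ \kappa_\Lambda\in B\bigr)=\int_B\prod_{b\in\Lambda}\varrho(d\kappa_b)\;E_\mu\Bigl(\mathbf 1_A\prod_{b\in\Lambda}e^{V(\eta_b)-\frac12\kappa_b\eta_b^2}\Bigr).$$ Let $\nu$ be the law of $\kappa$ under $\tilde\mu$. On vector fields $u:\mathbb R^{\mathbb B}\times\{\hat e_1,\dots,\hat e_d\}\to\mathbb R^d$ consider the inner product $(u,v)=E_\nu\bigl(\sum_{j}\kappa_{0,\hat e_j}\,u(\kappa,\hat e_j)\cdot v(\kappa,\hat e_j)\bigr)$, and let $L^2_\nabla(\nu)$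 be the closure of the set of gradients $(\kappa,\hat e_j)\mapsto h(\tau_{\hat e_j}\kappa)-h(\kappa)$ of square integrable functions $h$ that depend on finitely many $\kappa_b$. Let $\chi$ be minus the orthogonal projection onto $L^2_\nabla(\nu)$ of the field $(\kappa,\hat e_j)\mapsto\hat e_j$. The *corrector* $\bar\chi(\kappa,x)$ is the signed sum of $\chi(\tau_y\kappa,\hat e_j)$ over the edges $(y,y+\hat e_j)$ of a lattice path from $0$ to $x$ (edges traversed backwards counting negatively). Finally, $(L_\kappa f)(x)=\sum_{y:|y-x|=1}\kappa_{xy}[f(y)-f(x)]$ with $\kappa_{yx}=\kappa_{xy}$, and for $f:\mathbb Z^d\to\mathbb R$ with finite support and $\sum_xf(x)=0$, $g=(-L_\kappa)^{-1}f$ denotes the solution, unique up to an additive constant, of $-L_\kappa g=f$ that is a limit of finitely supported functions in the Dirichlet energy $\sum_{b}\kappa_b(\nabla g)_b^2$. **Statement.** Let $\mu$ be a translation-invariant, ergodic gradient Gibbs measure for $V$ with tilt $t$, let $\tilde\mu$ be its extension, and let $\mathscr F=\sigma(\kappa_b: b\in\mathbb B)$. Then for $\tilde\mu$-a.e. $\kappa$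 the following holds for the regular conditional law $\tilde\mu(\,\cdot\,|\mathscr F)(\kappa)$. It is carried by configurations $\eta$ with the loop condition, and under it the field $(\phi_x-\phi_0)_{x\in\mathbb Z^d}$ defined from $\eta$ is Gaussian with mean $$E_{\tilde\mu}(\phi_x-\phi_0\,|\,\mathscr F)(\kappa)=t\cdot[x+\bar\chi(\kappa,x)],\qquad x\in\mathbb Z^d,$$ and covariance $(-L_\kappa)^{-1}$; that is, for every $f:\mathbb Z^d\to\mathbb R$ with finite support and $\sum_xf(x)=0$, the function $(-L_\kappa)^{-1}f$ exists and $$\operatorname{Var}_{\tilde\mu}\Bigl(\sum_xf(x)\phi_x\,\Big|\,\mathscr F\Bigr)(\kappa)=\sum_xf(x)\,\bigl((-L_\kappa)^{-1}f\bigr)(x).$$ -/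

import Mathlib

open MeasureTheory ProbabilityTheory Filter Topology
open scoped ENNReal RealInnerProductSpace

noncomputable section

namespace GradientGibbs

/-! ### The lattice, its edges, gradients and heights -/

/-- The vertices of `ℤ^d`. -/
abbrev Site (d : ℕ) : Type := Fin d → ℤ

/-- The positively oriented nearest-neighbour edges of `ℤ^d`: the pair `(x, i)` stands for the
edge from `x` to `x + e_i`. -/
abbrev Edge (d : ℕ) : Type := Site d × Fin d

/-- The space `ℝ^{𝔹(ℤ^d)}` of edge configurations, used for gradients and for conductances. -/
abbrev EdgeConfig (d : ℕ) : Type := Edge d → ℝ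

/-- The `d`-dimensional Euclidean space. -/
abbrev Vec (d : ℕ) : Type := EuclideanSpace ℝ (Fin d)

variable {d : ℕ}

/-- The coordinate unit vector `e_i` of `ℤ^d`. -/
def unit (i : Fin d) : Site d := Pi.single i 1

/-- A lattice point seen as a vector of `ℝ^d`. -/
def toVec (x : Site d) : Vec d := WithLp.toLp 2 fun i => (x i : ℝ)

/-- The gradient `η_{xy} = φ_y - φ_x` of a height function. -/
def grad (φ : Site d → ℝ) : EdgeConfig d := fun e => φ (e.1 + unit e.2) - φ e.1

/-- The loop condition: the oriented sum of `η` around every lattice cycle of length four,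
`x, x + e_i, x + e_i + e_j, x + e_j`, vanishes. -/
def LoopCondition (η : EdgeConfig d) : Prop :=
  ∀ (x : Site d) (i j : Fin d),
    η (x, i) + η (x + unit i, j) - η (x + unit j, i) - η (x, j) = 0

/-- The point `(x_0, …, x_{n-1}, 0, …, 0)`. -/
def corner (x : Site d) (n : ℕ) : Site d := fun j => if j.val < n then x j else 0

/-- The oriented sum of an edge field `u` along the lattice path from `0` to `x` which runs through
the coordinate directions one after the other; edges which are traversed backwards count with a
negative sign. -/
def pathSum {M : Type*} [AddCommGroup M] (u : Edge d → M) (x : Site d) : M :=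
  ∑ i : Fin d,
    (∑ k ∈ Finset.Ico 0 (x i), u (corner x i.val + Pi.single i k, i)
      - ∑ k ∈ Finset.Ico (x i) 0, u (corner x i.val + Pi.single i k, i))

/-- The height function `φ_x = φ_x - φ_0` of a gradient configuration `η`, normalized by
`φ_0 = 0`. -/
def height (η : EdgeConfig d) : Site d → ℝ := pathSum η

theorem sum_Ico_sub_telescope (F : ℤ → ℝ) (n : ℤ) :
    ∑ k ∈ Finset.Ico 0 n, (F (k + 1) - F k) - ∑ k ∈ Finset.Ico n 0, (F (k + 1) - F k) =
      F n - F 0 := by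
  have up : ∀ (a : ℤ) (m : ℕ), ∑ k ∈ Finset.Ico a (a + m), (F (k + 1) - F k) = F (a + m) - F a := by
    intro a m
    induction m with
    | zero => simp
    | succ m ih =>
      have : Finset.Ico a (a + (m + 1 : ℕ)) = insert (a + (m : ℤ)) (Finset.Ico a (a + m)) := by
        ext k; simp; omega
      rw [this, Finset.sum_insert (by simp), ih]
      push_cast
      rw [← add_assoc]; ring
  rcases le_total 0 n with h | h
  · obtain ⟨m, rfl⟩ := Int.eq_ofNat_of_zero_le h
    have := up 0 m
    simp at this ⊢
    exact this
  · obtain ⟨m, hm⟩ := Int.eq_ofNat_of_zero_le (show 0 ≤ -n by omega)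
    have := up n m
    rw [← hm] at this
    simp at this ⊢
    rw [Finset.Ico_eq_empty (by omega)]
    simp [this]

/-- A configuration with the loop condition is the gradient of its height function. -/
theorem height_add_unit {η : EdgeConfig d} (hη : LoopCondition η) (x : Site d) (j : Fin d) :
    height η (x + unit j) - height η x = η (x, j) := by
  -- value of the `j`-edge at the corner of index `n`
  let c : ℕ → ℝ := fun n => if j.val < n then η (corner x n, j) else 0
  have key : ∀ i : Fin d,
      (∑ k ∈ Finset.Ico 0 ((x + unit j) i), η (corner (x + unit j) i.val + Pi.single i k, i)
        - ∑ k ∈ Finset.Ico ((x + unit j) i) 0, η (corner (x + unit j) i.val + Pi.single i k, i))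
      - (∑ k ∈ Finset.Ico 0 (x i), η (corner x i.val + Pi.single i k, i)
        - ∑ k ∈ Finset.Ico (x i) 0, η (corner x i.val + Pi.single i k, i))
      = c (i.val + 1) - c i.val := by
    intro i
    have hcs : corner x (i.val + 1) = corner x i.val + Pi.single i (x i) := by
      ext k
      rcases lt_trichotomy k i with h | h | h
      · have h' : k.val < i.val := h
        simp [corner, h.ne, h', Nat.lt_succ_of_lt h']
      · subst h; simp [corner]
      · have h' : i.val < k.val := h
        have h1 : ¬ k.val < i.val := by omega
        have h2 : ¬ k.val < i.val + 1 := by omega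
        simp [corner, h.ne', h1, h2]
    rcases lt_trichotomy i j with h | h | h
    · have h' : i.val < j.val := h
      have e1 : corner (x + unit j) i.val = corner x i.val := by
        ext k
        by_cases hk : k.val < i.val
        · have : k ≠ j := by rintro rfl; omega
          simp [corner, hk, unit, this]
        · simp [corner, hk]
      have e2 : (x + unit j) i = x i := by simp [unit, h.ne]
      have h1 : ¬ j.val < i.val := by omega
      have h2 : ¬ j.val < i.val + 1 := by omega
      simp only [e1, e2, c, h1, h2, if_false, sub_self]
    · subst h
      have e1 : corner (x + unit i) i.val = corner x i.val := by
        ext k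
        by_cases hk : k.val < i.val
        · have : k ≠ i := by rintro rfl; omega
          simp [corner, hk, unit, this]
        · simp [corner, hk]
      have e2 : (x + unit i) i = x i + 1 := by simp [unit]
      simp only [e1, e2, c, lt_irrefl, Nat.lt_succ_self, if_false, if_true, hcs]
      generalize hu : (fun k => η (corner x i.val + Pi.single i k, i)) = u
      have hu' : ∀ k, η (corner x i.val + Pi.single i k, i) = u k := fun k => by rw [← hu]
      simp only [hu']
      rcases le_or_gt 0 (x i) with hx | hx
      · rw [show Finset.Ico 0 (x i + 1) = insert (x i) (Finset.Ico 0 (x i)) by ext k; simp; omega,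
          Finset.sum_insert (by simp), Finset.Ico_eq_empty (a := x i) (by omega),
          Finset.Ico_eq_empty (a := x i + 1) (by omega)]
        simp
      · rw [show Finset.Ico (x i) 0 = insert (x i) (Finset.Ico (x i + 1) 0) by ext k; simp; omega,
          Finset.sum_insert (by simp), Finset.Ico_eq_empty (b := x i) (by omega),
          Finset.Ico_eq_empty (b := x i + 1) (by omega)]
        simp
    · have h' : j.val < i.val := h
      have e1 : corner (x + unit j) i.val = corner x i.val + unit j := by
        ext k
        by_cases hk : k.val < i.val
        · simp [corner, hk]
        · have : k ≠ j := by rintro rfl; omega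
          simp [corner, hk, unit, this]
      have e2 : (x + unit j) i = x i := by simp [unit, h.ne']
      have h2 : j.val < i.val + 1 := by omega
      simp only [e1, e2, c, h', h2, if_true, hcs]
      have := sum_Ico_sub_telescope (fun k => η (corner x i.val + Pi.single i k, j)) (x i)
      simp only [Pi.single_zero, add_zero] at this
      rw [← this]
      have hl : ∀ k : ℤ, η (corner x i.val + Pi.single i (k + 1), j)
          - η (corner x i.val + Pi.single i k, j) =
          η (corner x i.val + unit j + Pi.single i k, i)
          - η (corner x i.val + Pi.single i k, i) := by
        intro k
        have := hη (corner x i.val + Pi.single i k) i j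
        have e3 : corner x i.val + Pi.single i k + unit i =
            corner x i.val + Pi.single i (k + 1) := by
          rw [unit, Pi.single_add, add_assoc]
        rw [e3, add_right_comm _ _ (unit j)] at this
        linarith
      simp only [hl, Finset.sum_sub_distrib]
      ring
  rw [height, pathSum, pathSum, ← Finset.sum_sub_distrib, Finset.sum_congr rfl fun i _ => key i,
    Fin.sum_univ_eq_sum_range (fun n => c (n + 1) - c n), Finset.sum_range_sub]
  have : corner x d = x := by ext k; simp [corner]
  simp [c, this]

/-- The translation `(τ_x η)_{yz} = η_{y+x,z+x}`. -/
def shift (x : Site d) (η : EdgeConfig d) : EdgeConfig d := fun e => η (e.1 + x, e.2)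

/-! ### Gradient Gibbs measures -/

/-- The potential `V(η) = - log ∫ ϱ(dκ) exp(-κ η² / 2)`. -/
def potential (ρ : Measure ℝ) (s : ℝ) : ℝ := -Real.log (∫ k, Real.exp (-(1 / 2) * k * s ^ 2) ∂ρ)

/-- The edges with at least one endpoint in `Λ`. -/
def edgesTouching (Λ : Finset (Site d)) : Finset (Edge d) :=
  Λ ×ˢ Finset.univ ∪ (Λ ×ˢ Finset.univ).image fun e => (e.1 - unit e.2, e.2)

/-- The height function that equals `ψ` in `Λ` and `φ` outside `Λ`. -/
def glue (Λ : Finset (Site d)) (φ : Site d → ℝ) (ψ : Λ → ℝ) : Site d → ℝ :=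
  fun x => if h : x ∈ Λ then ψ ⟨x, h⟩ else φ x

/-- The Boltzmann factor `exp(-∑ V(φ_y - φ_x))`, the sum running over the edges that touch `Λ`. -/
def boltzmann (V : ℝ → ℝ) (Λ : Finset (Site d)) (φ : Site d → ℝ) : ℝ≥0∞ :=
  ENNReal.ofReal (Real.exp (-∑ e ∈ edgesTouching Λ, V (grad φ e)))

/-- The specification `γ_Λ(· | η)`: the heights in `Λ` are distributed with density proportional
to the Boltzmann factor with respect to Lebesgue measure, the heights outside `Λ` are those of
`η`, and the result is projected to the gradient variables. -/
def specification (V : ℝ → ℝ) (Λ : Finset (Site d)) (η : EdgeConfig d) :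
    Measure (EdgeConfig d) :=
  (∫⁻ ψ : Λ → ℝ, boltzmann V Λ (glue Λ (height η) ψ))⁻¹ •
    ((volume : Measure (Λ → ℝ)).withDensity
      fun ψ => boltzmann V Λ (glue Λ (height η) ψ)).map fun ψ => grad (glue Λ (height η) ψ)

/-- The `σ`-algebra generated by the gradients (height differences) outside `Λ`. -/
abbrev exterior (Λ : Finset (Site d)) : MeasurableSpace (EdgeConfig d) :=
  MeasurableSpace.comap
    (fun (η : EdgeConfig d) (p : {x : Site d // x ∉ Λ} × {x : Site d // x ∉ Λ}) =>
      height η p.2 - height η p.1) inferInstance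

/-- Gradient Gibbs measures for the potential `V`: probability measures that live on
configurations with the loop condition and whose regular conditional probabilities given the
gradients outside any finite `Λ` are given by the specification. -/
structure IsGradientGibbs (V : ℝ → ℝ) (μ : Measure (EdgeConfig d)) [IsProbabilityMeasure μ] :
    Prop where
  loop : ∀ᵐ η ∂μ, LoopCondition η
  dlr : ∀ Λ : Finset (Site d), ∀ᵐ η ∂μ, condExpKernel μ (exterior Λ) η = specification V Λ η

/-- Translation invariance. -/
def IsTranslationInvariant (μ : Measure (EdgeConfig d)) : Prop :=
  ∀ x : Site d, μ.map (shift x) = μ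

/-- Ergodicity: events invariant under all translations have probability `0` or `1`. -/
def IsErgodic (μ : Measure (EdgeConfig d)) : Prop :=
  ∀ A : Set (EdgeConfig d), MeasurableSet A → (∀ x : Site d, shift x ⁻¹' A = A) →
    μ A = 0 ∨ μ A = 1

/-- `μ` has tilt `t`: `E_μ(η_b) = t · b` for every edge `b`. -/
def HasTilt (μ : Measure (EdgeConfig d)) (t : Vec d) : Prop :=
  ∀ e : Edge d, Integrable (fun η : EdgeConfig d => η e) μ ∧
    ∫ η, η e ∂μ = ⟪t, toVec (unit e.2)⟫

/-! ### The extension to gradients and conductances -/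

/-- `μ'` is the extension of `μ` to a measure on pairs `(η, κ)`: for every finite set `Λ` of
edges, its projection to `(η, κ_Λ)` is
`∏_{b ∈ Λ} ϱ(dκ_b) exp(V(η_b) - κ_b η_b² / 2) μ(dη)`. -/
def IsExtension (ρ : Measure ℝ) (μ : Measure (EdgeConfig d))
    (μ' : Measure (EdgeConfig d × EdgeConfig d)) : Prop :=
  ∀ (Λ : Finset (Edge d)) (A : Set (EdgeConfig d)) (B : Set (Λ → ℝ)),
    MeasurableSet A → MeasurableSet B →
      μ' {p | p.1 ∈ A ∧ Λ.restrict p.2 ∈ B} =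
        ∫⁻ k in B, (∫⁻ η in A, ∏ b : Λ, ENNReal.ofReal
          (Real.exp (potential ρ (η b) - 1 / 2 * k b * η b ^ 2)) ∂μ) ∂(Measure.pi fun _ => ρ)

section

variable {ρ : Measure ℝ} [IsFiniteMeasure ρ]

theorem integrable_gaussianWeight (hρ : ∃ K : Set ℝ, IsCompact K ∧ K ⊆ Set.Ioi 0 ∧ ρ Kᶜ = 0)
    (s : ℝ) : Integrable (fun k => Real.exp (-(1 / 2) * k * s ^ 2)) ρ := by
  obtain ⟨K, -, hK, h0⟩ := hρ
  refine Integrable.of_bound (C := 1) (by fun_prop) ?_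
  have : ∀ᵐ k ∂ρ, k ∈ K := by rw [ae_iff]; exact h0
  filter_upwards [this] with k hk
  have : 0 < k := hK hk
  rw [Real.norm_eq_abs, abs_of_pos (Real.exp_pos _), Real.exp_le_one_iff]
  have := mul_nonneg this.le (sq_nonneg s)
  linarith

/-- The conditional law of a conductance given the gradient on its edge. -/
def conductanceLaw (ρ : Measure ℝ) (s : ℝ) : Measure ℝ :=
  ρ.withDensity fun k => ENNReal.ofReal (Real.exp (potential ρ s - 1 / 2 * k * s ^ 2))

theorem integrable_weight (hρ : ∃ K : Set ℝ, IsCompact K ∧ K ⊆ Set.Ioi 0 ∧ ρ Kᶜ = 0)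
    (s : ℝ) : Integrable (fun k => Real.exp (potential ρ s - 1 / 2 * k * s ^ 2)) ρ := by
  refine ((integrable_gaussianWeight hρ s).const_mul (Real.exp (potential ρ s))).congr
    (.of_forall fun k => ?_)
  simp only [← Real.exp_add]; congr 1; ring

theorem isProb_conductanceLaw (hρ0 : ρ ≠ 0)
    (hρ : ∃ K : Set ℝ, IsCompact K ∧ K ⊆ Set.Ioi 0 ∧ ρ Kᶜ = 0) (s : ℝ) :
    IsProbabilityMeasure (conductanceLaw ρ s) := by
  constructor
  rw [conductanceLaw, withDensity_apply _ .univ, Measure.restrict_univ,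
    ← ofReal_integral_eq_lintegral_ofReal (integrable_weight hρ s)
      (.of_forall fun _ => (Real.exp_pos _).le)]
  have h : ∀ k, Real.exp (potential ρ s - 1 / 2 * k * s ^ 2) =
      Real.exp (potential ρ s) * Real.exp (-(1 / 2) * k * s ^ 2) := fun k => by
    rw [← Real.exp_add]; congr 1; ring
  simp only [h]
  have : NeZero ρ := ⟨hρ0⟩
  have hpos : 0 < ∫ k, Real.exp (-(1 / 2) * k * s ^ 2) ∂ρ :=
    integral_exp_pos (integrable_gaussianWeight hρ s)
  rw [integral_const_mul, potential, Real.exp_neg, Real.exp_log hpos, inv_mul_cancel₀ hpos.ne',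
    ENNReal.ofReal_one]

theorem pi_conductanceLaw (hρ0 : ρ ≠ 0)
    (hρ : ∃ K : Set ℝ, IsCompact K ∧ K ⊆ Set.Ioi 0 ∧ ρ Kᶜ = 0)
    {ι : Type*} [Fintype ι] (s : ι → ℝ) :
    Measure.pi (fun i => conductanceLaw ρ (s i)) =
      (Measure.pi fun _ : ι => ρ).withDensity fun k =>
        ∏ i, ENNReal.ofReal (Real.exp (potential ρ (s i) - 1 / 2 * k i * s i ^ 2)) := by
  have := fun i => isProb_conductanceLaw hρ0 hρ (s i)
  refine Measure.pi_eq fun B hB => ?_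
  rw [withDensity_apply _ (.univ_pi hB), Measure.restrict_pi_pi]
  have e : ∀ k : ι → ℝ,
      ∏ i, ENNReal.ofReal (Real.exp (potential ρ (s i) - 1 / 2 * k i * s i ^ 2)) =
      ENNReal.ofReal (∏ i, Real.exp (potential ρ (s i) - 1 / 2 * k i * s i ^ 2)) := fun k =>
    (ENNReal.ofReal_prod_of_nonneg fun i _ => (Real.exp_pos _).le).symm
  simp only [e]
  rw [← ofReal_integral_eq_lintegral_ofReal]
  · rw [integral_fintype_prod_eq_prod
      (f := fun i k => Real.exp (potential ρ (s i) - 1 / 2 * k * s i ^ 2)),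
      ENNReal.ofReal_prod_of_nonneg]
    · refine Finset.prod_congr rfl fun i _ => ?_
      rw [conductanceLaw, withDensity_apply _ (hB i), ofReal_integral_eq_lintegral_ofReal
        (integrable_weight hρ _).integrableOn (.of_forall fun _ => (Real.exp_pos _).le)]
    · exact fun i _ => integral_nonneg fun _ => (Real.exp_pos _).le
  · exact Integrable.fintype_prod
      (f := fun i k => Real.exp (potential ρ (s i) - 1 / 2 * k * s i ^ 2))
      fun i => (integrable_weight hρ _).integrableOn
  · exact .of_forall fun _ => Finset.prod_nonneg fun i _ => (Real.exp_pos _).le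

theorem measurable_potential : Measurable (potential ρ) := by
  unfold potential
  refine (Real.measurable_log.comp ?_).neg
  exact (StronglyMeasurable.integral_prod_right (f := fun s k => Real.exp (-(1 / 2) * k * s ^ 2))
    (Measurable.stronglyMeasurable (by unfold Function.uncurry; fun_prop))).measurable

/-- The extension exists. -/
theorem exists_isExtension (hρ0 : ρ ≠ 0)
    (hρ : ∃ K : Set ℝ, IsCompact K ∧ K ⊆ Set.Ioi 0 ∧ ρ Kᶜ = 0)
    (μ : Measure (EdgeConfig d)) [IsProbabilityMeasure μ] :
    ∃ μ' : Measure (EdgeConfig d × EdgeConfig d), IsProbabilityMeasure μ' ∧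
      IsExtension ρ μ μ' := by
  have hp := fun s => isProb_conductanceLaw hρ0 hρ s
  have hVm := measurable_potential (ρ := ρ)
  have hq : Measurable (conductanceLaw ρ) := by
    refine Measure.measurable_of_measurable_coe _ fun A hA => ?_
    simp only [conductanceLaw, withDensity_apply _ hA]
    exact Measurable.lintegral_prod_right' (f := fun p : ℝ × ℝ => ENNReal.ofReal
      (Real.exp (potential ρ p.1 - 1 / 2 * p.2 * p.1 ^ 2))) (by fun_prop)
  have hK : Measurable fun η : EdgeConfig d =>
      Measure.infinitePi fun b => conductanceLaw ρ (η b) := by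
    refine .measure_of_isPiSystem_of_isProbabilityMeasure generateFrom_squareCylinders.symm
      (isPiSystem_squareCylinders (fun _ => MeasurableSpace.isPiSystem_measurableSet) (by simp)) ?_
    rintro _ ⟨S, B, hB, rfl⟩
    simp only [Set.mem_pi, Set.mem_univ, true_implies, Set.mem_ofPred_eq] at hB
    simp only [Measure.infinitePi_pi _ fun i _ => hB i]
    exact Finset.measurable_prod _ fun i _ =>
      (Measure.measurable_coe (hB i)).comp (hq.comp (measurable_pi_apply i))
  let Q : Kernel (EdgeConfig d) (EdgeConfig d) := ⟨_, hK⟩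
  have : IsMarkovKernel Q := ⟨fun η => by change IsProbabilityMeasure (Measure.infinitePi _); infer_instance⟩
  refine ⟨μ ⊗ₘ Q, inferInstance, fun Λ A B hA hB => ?_⟩
  have hset : {p : EdgeConfig d × EdgeConfig d | p.1 ∈ A ∧ Λ.restrict p.2 ∈ B} =
      A ×ˢ (Λ.restrict ⁻¹' B) := rfl
  rw [hset, Measure.compProd_apply_prod hA (Finset.measurable_restrict Λ hB)]
  rw [lintegral_lintegral_swap]
  · refine lintegral_congr fun η => ?_
    change Measure.infinitePi _ _ = _
    rw [← Measure.map_apply (Finset.measurable_restrict Λ) hB, Measure.infinitePi_map_restrict,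
      pi_conductanceLaw hρ0 hρ, withDensity_apply _ hB]
  · apply Measurable.aemeasurable
    unfold Function.uncurry
    fun_prop

end

/-- The extension is unique. -/
theorem IsExtension.unique {ρ : Measure ℝ} {μ : Measure (EdgeConfig d)}
    {μ₁ μ₂ : Measure (EdgeConfig d × EdgeConfig d)} [IsProbabilityMeasure μ₁]
    [IsProbabilityMeasure μ₂] (h₁ : IsExtension ρ μ μ₁) (h₂ : IsExtension ρ μ μ₂) : μ₁ = μ₂ := by
  refine MeasureTheory.ext_of_generate_finite _ (generateFrom_eq_prod (C := {A | MeasurableSet A})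
    (D := measurableCylinders fun _ : Edge d => ℝ) MeasurableSpace.generateFrom_measurableSet
    generateFrom_measurableCylinders (isCountablySpanning_measurableSet) ⟨fun _ => Set.univ,
      fun _ => (mem_measurableCylinders _).2 ⟨∅, Set.univ, .univ, by simp⟩, Set.iUnion_const _⟩).symm
    (IsPiSystem.prod MeasurableSpace.isPiSystem_measurableSet isPiSystem_measurableCylinders) ?_ (by simp)
  rintro _ ⟨A, hA, B, hB, rfl⟩
  obtain ⟨Λ, S, hS, rfl⟩ := (mem_measurableCylinders _).1 hB
  exact (h₁ Λ A S hA hS).trans (h₂ Λ A S hA hS).symm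

/-! ### The generator and its inverse -/

/-- The generator `(L_κ f)(x) = ∑_{y ∼ x} κ_{xy} (f(y) - f(x))`. -/
def generator (κ : EdgeConfig d) (f : Site d → ℝ) (x : Site d) : ℝ :=
  ∑ i : Fin d, (κ (x, i) * (f (x + unit i) - f x) +
    κ (x - unit i, i) * (f (x - unit i) - f x))

/-- The Dirichlet energy `∑_b κ_b (∇g)_b²`, which equals `(g, -L_κ g)` for finitely supported
`g`. -/
def energy (κ : EdgeConfig d) (g : Site d → ℝ) : ℝ≥0∞ :=
  ∑' e : Edge d, ENNReal.ofReal (κ e * grad g e ^ 2)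

/-- `g = (-L_κ)⁻¹ f`: the function `g` solves `-L_κ g = f` and is a limit of finitely supported
functions in the Dirichlet energy. For finitely supported `f` of zero sum such a `g` is unique
up to an additive constant. -/
def IsNegGeneratorInverse (κ : EdgeConfig d) (f g : Site d → ℝ) : Prop :=
  (∀ x, -generator κ g x = f x) ∧
    ∃ u : ℕ → (Site d →₀ ℝ), Tendsto (fun n => energy κ (g - ⇑(u n))) atTop (𝓝 0)

/-! ### The corrector -/

/-- The measure on `Ω × B` for which `∫ u · v` is the inner product
`(u, v) = E_ν(∑_{b ∈ B} κ_b u(κ, b) · v(κ, b))` of vector fields; the coordinate vectors `B` are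
indexed by `Fin d`. -/
def fieldMeasure (ν : Measure (EdgeConfig d)) : Measure (EdgeConfig d × Fin d) :=
  (ν.prod Measure.count).withDensity fun p => ENNReal.ofReal (p.1 (0, p.2))

/-- The Hilbert space of square integrable `ℝ^d`-valued vector fields. -/
abbrev VectorFields (ν : Measure (EdgeConfig d)) : Type := Lp (Vec d) 2 (fieldMeasure ν)

/-- Square integrable local functions: they depend on finitely many conductances. -/
def IsLocal (ν : Measure (EdgeConfig d)) (h : EdgeConfig d → Vec d) : Prop :=
  Measurable h ∧ (∃ S : Finset (Edge d), DependsOn h (S : Set (Edge d))) ∧ MemLp h 2 ν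

/-- The space `L²_∇(ν)`: the closure of the set of gradients `h ∘ τ_{e_j} - h` of local
functions. -/
abbrev gradientFields (ν : Measure (EdgeConfig d)) : Submodule ℝ (VectorFields ν) :=
  (Submodule.span ℝ {u : VectorFields ν | ∃ h, IsLocal ν h ∧
    u =ᵐ[fieldMeasure ν] fun p => h (shift (unit p.2) p.1) - h p.1}).topologicalClosure

open Classical in
/-- The position vector field `x(κ, b) = b` (with value `0` if it fails to be square integrable,
which does not happen if the conductances are bounded). -/
def positionField (ν : Measure (EdgeConfig d)) : VectorFields ν :=
  if h : MemLp (fun p : EdgeConfig d × Fin d => toVec (unit p.2)) 2 (fieldMeasure ν) then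
    h.toLp _ else 0

/-- The vector field `χ = - proj_{L²_∇(ν)} x`. -/
def correctorField (ν : Measure (EdgeConfig d)) : VectorFields ν :=
  -(gradientFields ν).starProjection (positionField ν)

/-- The corrector `χ̄(κ, x)`: the extension of `χ` by summing `χ(τ_y κ, b)` over the edges
`(y, y + b)` of a path from `0` to `x`. -/
def corrector (ν : Measure (EdgeConfig d)) (κ : EdgeConfig d) (x : Site d) : Vec d :=
  pathSum (fun e : Edge d => correctorField ν (shift e.1 κ, e.2)) x

end GradientGibbs

end

open MeasureTheory ProbabilityTheory Filter Topology
open scoped ENNReal RealInnerProductSpace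

noncomputable section

namespace GradientGibbs

variable {d : ℕ}

/-! ### Summation by parts and the Dirichlet problem -/

/-! Conditioning on the conductances turns the model into a Gaussian one. In the extension the
factor exp(V(η_b) - κ_b η_b²/2) cancels the Boltzmann factor on every edge that touches Λ
(`gibbsWeight_mul_conductanceDensity`). So, given κ and the heights off Λ, the heights in Λ are the
κ-harmonic extension h_Λ of the boundary heights plus an independent centred Gaussian field whose
covariance inverts -L_κ with zero boundary values (`gaussAverage_eq`, `IsExtension.map_resample`).
For f of zero sum and bounded G this gives E[G(κ) exp(i f·φ)] = E[G(κ) exp(i f·h_Λ) exp(-f·u_Λ /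
2)], where u_Λ solves -L_κ u = f in Λ and vanishes outside (`integral_mul_exp_pairing`). It remains
to let Λ exhaust the lattice in the two factors on the right.

Variance: u_Λ is the best approximation of (-L_κ)⁻¹ f in Dirichlet energy among functions supported
in Λ, so f·u_Λ converges (`energy_sub_dirichletSolve_le`, `tendsto_sum_dirichletSolve`).

Mean: h_Λ is compared with m(x) = t·(x + χ̄(κ,x)), which is κ-harmonic because x + χ is orthogonal
to gradients (`ae_generator_height_meanIncrement`). Both φ - t·x and t·χ̄ grow sublinearly in mean:
the former by the L¹ ergodic theorem, the loop condition and ergodicity (`lintegral_height_sub_le`),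
the latter because the corrector is an L¹ limit of gradients of stationary functions
(`lintegral_pathSum_correctorIncrement_le`). As h_Λ is an average of φ over the resampled field, the
bound passes to v = h_Λ - m, which is harmonic in Λ (`lintegral_deviation_sub_le`).

The tilt provides first moments only, so the Caccioppoli inequality is tested with v truncated at
height K; it bounds the energy of the truncation in a box of size n by K/n times the ℓ¹ norm of ∇v
on the doubled box (`sum_sq_grad_truncate_le`). With K = εn the spatial average of min(1,|∇v|)²
becomes small. Translation invariance allows the box to be moved so that this average controls any
prescribed finite set of edges, and summability along a sequence of shifted boxes gives ∇v → 0
almost surely (`exists_sum_lintegral_le`, `exists_tendsto_grad_deviation`).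

In the limit the conditional characteristic function of f·φ is exp(i f·m - f·(-L_κ)⁻¹f / 2) for each
f off a null set; rational coefficients and continuity produce one null set for all f
(`ae_map_condDistrib`). -/

theorem mem_edgesTouching {Λ : Finset (Site d)} {e : Edge d} :
    e ∈ edgesTouching Λ ↔ e.1 ∈ Λ ∨ e.1 + unit e.2 ∈ Λ := by
  obtain ⟨x, i⟩ := e
  simp only [edgesTouching, Finset.mem_union, Finset.mem_product, Finset.mem_univ, and_true,
    Finset.mem_image, Prod.exists, Prod.mk.injEq]
  refine or_congr_right ⟨?_, fun h => ⟨x + unit i, i, h, by simp, rfl⟩⟩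
  rintro ⟨y, j, hy, rfl, rfl⟩
  simpa using hy

/-- The edges touching Λ are the edges starting in Λ together with those ending in Λ. The two halves
of the gradient are summed separately, each over the family matching its endpoint; edges outside
that family contribute nothing because u vanishes off Λ. -/
theorem sum_edgesTouching_grad_mul {Λ : Finset (Site d)} (F : Edge d → ℝ) {u : Site d → ℝ}
    (hu : ∀ x ∉ Λ, u x = 0) :
    ∑ e ∈ edgesTouching Λ, F e * grad u e =
      ∑ x ∈ Λ, u x * ∑ i : Fin d, (F (x - unit i, i) - F (x, i)) := by
  have h1 : ∑ e ∈ edgesTouching Λ, F e * u e.1 = ∑ x ∈ Λ, ∑ i : Fin d, F (x, i) * u x := by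
    rw [← Finset.sum_product']
    refine (Finset.sum_subset Finset.subset_union_left fun e _ he => ?_).symm
    rw [hu, mul_zero]
    simpa using he
  have h2 : ∑ e ∈ edgesTouching Λ, F e * u (e.1 + unit e.2) =
      ∑ x ∈ Λ, ∑ i : Fin d, F (x - unit i, i) * u x := by
    rw [← Finset.sum_product', edgesTouching, ← Finset.sum_subset Finset.subset_union_right,
      Finset.sum_image]
    · simp
    · rintro ⟨x, i⟩ - ⟨y, j⟩ - h
      simp only [Prod.mk.injEq] at h
      obtain ⟨h, rfl⟩ := h
      simpa using h
    · intro e _ he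
      rw [hu, mul_zero]
      intro h
      exact he (Finset.mem_image.2 ⟨(e.1 + unit e.2, e.2), by simpa using h, by simp⟩)
  simp only [grad, mul_sub, Finset.sum_sub_distrib, h1, h2]
  rw [← Finset.sum_sub_distrib, ← Finset.sum_sub_distrib]
  refine Finset.sum_congr rfl fun x _ => ?_
  rw [← Finset.sum_mul, ← Finset.sum_mul]
  ring

theorem generator_eq_sum (κ : EdgeConfig d) (f : Site d → ℝ) (x : Site d) :
    generator κ f x = ∑ i : Fin d, (κ (x, i) * grad f (x, i) -
      κ (x - unit i, i) * grad f (x - unit i, i)) := by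
  refine Finset.sum_congr rfl fun i _ => ?_
  simp only [grad, sub_add_cancel]
  ring

/-- Summation by parts: `∑_b κ_b (∇φ)_b (∇u)_b = (u, -L_κ φ)` if `u` is supported in `Λ`. -/
theorem sum_grad_mul_grad {Λ : Finset (Site d)} (κ : EdgeConfig d) (φ : Site d → ℝ)
    {u : Site d → ℝ} (hu : ∀ x ∉ Λ, u x = 0) :
    ∑ e ∈ edgesTouching Λ, κ e * grad φ e * grad u e = ∑ x ∈ Λ, u x * -generator κ φ x := by
  rw [sum_edgesTouching_grad_mul (fun e => κ e * grad φ e) hu]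
  refine Finset.sum_congr rfl fun x _ => ?_
  rw [generator_eq_sum, ← Finset.sum_neg_distrib]
  simp

theorem grad_add (φ ψ : Site d → ℝ) (e : Edge d) : grad (φ + ψ) e = grad φ e + grad ψ e := by
  simp [grad]; ring

theorem grad_sub (φ ψ : Site d → ℝ) (e : Edge d) : grad (φ - ψ) e = grad φ e - grad ψ e := by
  simp [grad]; ring

theorem generator_add (κ : EdgeConfig d) (φ ψ : Site d → ℝ) (x : Site d) :
    generator κ (φ + ψ) x = generator κ φ x + generator κ ψ x := by
  simp only [generator_eq_sum, ← Finset.sum_add_distrib, grad_add]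
  exact Finset.sum_congr rfl fun _ _ => by ring

theorem generator_sub (κ : EdgeConfig d) (φ ψ : Site d → ℝ) (x : Site d) :
    generator κ (φ - ψ) x = generator κ φ x - generator κ ψ x := by
  simp only [generator_eq_sum, ← Finset.sum_sub_distrib, grad_sub]
  exact Finset.sum_congr rfl fun _ _ => by ring

theorem generator_add_const (κ : EdgeConfig d) (φ : Site d → ℝ) (c : ℝ) (x : Site d) :
    generator κ (fun y => φ y + c) x = generator κ φ x := by
  simp [generator]

/-- Extension of a function on `Λ` by zero. -/
abbrev extend (Λ : Finset (Site d)) (u : Λ → ℝ) : Site d → ℝ := glue Λ 0 u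

theorem extend_of_mem {Λ : Finset (Site d)} (u : Λ → ℝ) {x : Site d} (hx : x ∈ Λ) :
    extend Λ u x = u ⟨x, hx⟩ := by simp [extend, glue, hx]

theorem extend_of_notMem {Λ : Finset (Site d)} (u : Λ → ℝ) {x : Site d} (hx : x ∉ Λ) :
    extend Λ u x = 0 := by simp [extend, glue, hx]

theorem extend_add {Λ : Finset (Site d)} (u v : Λ → ℝ) :
    extend Λ (u + v) = extend Λ u + extend Λ v := by
  ext x; by_cases hx : x ∈ Λ <;> simp [extend, glue, hx]

theorem extend_smul {Λ : Finset (Site d)} (c : ℝ) (u : Λ → ℝ) :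
    extend Λ (c • u) = c • extend Λ u := by
  ext x; by_cases hx : x ∈ Λ <;> simp [extend, glue, hx]

theorem extend_neg {Λ : Finset (Site d)} (u : Λ → ℝ) : extend Λ (-u) = -extend Λ u := by
  ext x; by_cases hx : x ∈ Λ <;> simp [extend, glue, hx]

/-- The matrix of `-L_κ` on `Λ` with zero boundary conditions. -/
def dirichletMatrix (κ : EdgeConfig d) (Λ : Finset (Site d)) : Matrix Λ Λ ℝ :=
  fun x y => -generator κ (Pi.single (y : Site d) 1) x

theorem dirichletMatrix_mulVec (κ : EdgeConfig d) (Λ : Finset (Site d)) (u : Λ → ℝ) (x : Λ) :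
    (dirichletMatrix κ Λ).mulVec u x = -generator κ (extend Λ u) x := by
  have hu : ∀ z, extend Λ u z = ∑ y : Λ, (Pi.single (y : Site d) (1 : ℝ) : Site d → ℝ) z * u y := by
    intro z
    by_cases hz : z ∈ Λ
    · rw [extend_of_mem u hz, Finset.sum_eq_single ⟨z, hz⟩]
      · simp
      · intro b _ hb
        rw [Pi.single_eq_of_ne, zero_mul]
        rintro rfl
        exact hb rfl
      · simp
    · rw [extend_of_notMem u hz, Finset.sum_eq_zero]
      intro b _
      rw [Pi.single_eq_of_ne, zero_mul]
      rintro rfl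
      exact hz b.2
  simp only [Matrix.mulVec, dotProduct, dirichletMatrix, generator, hu, ← Finset.sum_sub_distrib,
    Finset.mul_sum, ← Finset.sum_add_distrib, ← Finset.sum_neg_distrib, Finset.sum_mul]
  rw [Finset.sum_comm]
  exact Finset.sum_congr rfl fun i _ => Finset.sum_congr rfl fun j _ => by ring

/-- Take a site of the support with the largest first coordinate: a vanishing gradient on the next
edge carries the nonzero value one step further, a contradiction. This needs at least one direction.
-/
theorem extend_eq_zero_of_grad (hd : 0 < d) {Λ : Finset (Site d)} {u : Site d → ℝ}
    (hu : ∀ x ∉ Λ, u x = 0) (h : ∀ e ∈ edgesTouching Λ, grad u e = 0) : u = 0 := by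
  by_contra hne
  obtain ⟨x₀, hx₀⟩ := Function.ne_iff.1 hne
  let i : Fin d := ⟨0, hd⟩
  have hS : (Λ.filter fun x => u x ≠ 0).Nonempty :=
    ⟨x₀, Finset.mem_filter.2 ⟨by_contra fun h => hx₀ (hu _ h), hx₀⟩⟩
  obtain ⟨x, hx, hmax⟩ := Finset.exists_max_image _ (fun x : Site d => x i) hS
  rw [Finset.mem_filter] at hx
  have h1 := h (x, i) (mem_edgesTouching.2 (.inl hx.1))
  simp only [grad] at h1
  have h2 : u (x + unit i) ≠ 0 := by rw [sub_eq_zero.1 h1]; exact hx.2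
  have h3 := hmax _ (Finset.mem_filter.2 ⟨by_contra fun h => h2 (hu _ h), h2⟩)
  simp [unit] at h3

theorem isUnit_dirichletMatrix (hd : 0 < d) {κ : EdgeConfig d} (hκ : ∀ e, 0 < κ e)
    (Λ : Finset (Site d)) : IsUnit (dirichletMatrix κ Λ) := by
  rw [← Matrix.mulVec_injective_iff_isUnit]
  intro u v huv
  rw [← sub_eq_zero, ← Matrix.mulVec_sub] at huv
  have h0 : ∑ e ∈ edgesTouching Λ, κ e * grad (extend Λ (u - v)) e * grad (extend Λ (u - v)) e
      = 0 := by
    rw [sum_grad_mul_grad κ _ fun x hx => extend_of_notMem _ hx]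
    refine Finset.sum_eq_zero fun x hx => ?_
    rw [← dirichletMatrix_mulVec κ Λ _ ⟨x, hx⟩, huv]
    simp
  rw [Finset.sum_eq_zero_iff_of_nonneg fun e _ => by
    rw [mul_assoc]; exact mul_nonneg (hκ e).le (mul_self_nonneg _)] at h0
  have := extend_eq_zero_of_grad hd (fun x hx => extend_of_notMem (u - v) hx) fun e he => by
    have := h0 e he
    simpa [mul_assoc, (hκ e).ne'] using this
  ext x
  have h := congrFun this x
  rw [extend_of_mem _ x.2] at h
  simpa [sub_eq_zero] using h

/-- The solution of the Dirichlet problem `-L_κ u = r` in `Λ`, `u = 0` outside `Λ`. -/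
def dirichletSolve (κ : EdgeConfig d) (Λ : Finset (Site d)) (r : Site d → ℝ) : Site d → ℝ :=
  extend Λ ((dirichletMatrix κ Λ)⁻¹.mulVec fun x => r x)

theorem dirichletSolve_of_notMem (κ : EdgeConfig d) {Λ : Finset (Site d)} (r : Site d → ℝ)
    {x : Site d} (hx : x ∉ Λ) : dirichletSolve κ Λ r x = 0 := extend_of_notMem _ hx

theorem neg_generator_dirichletSolve (hd : 0 < d) {κ : EdgeConfig d} (hκ : ∀ e, 0 < κ e)
    {Λ : Finset (Site d)} (r : Site d → ℝ) {x : Site d} (hx : x ∈ Λ) :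
    -generator κ (dirichletSolve κ Λ r) x = r x := by
  rw [dirichletSolve, ← dirichletMatrix_mulVec κ Λ _ ⟨x, hx⟩, Matrix.mulVec_mulVec,
    Matrix.mul_nonsing_inv _ ((Matrix.isUnit_iff_isUnit_det _).1 (isUnit_dirichletMatrix hd hκ Λ)),
    Matrix.one_mulVec]

theorem eq_zero_of_generator_eq_zero (hd : 0 < d) {κ : EdgeConfig d} (hκ : ∀ e, 0 < κ e)
    {Λ : Finset (Site d)} {u : Site d → ℝ} (hu : ∀ x ∉ Λ, u x = 0)
    (h : ∀ x ∈ Λ, generator κ u x = 0) : u = 0 := by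
  have h0 := sum_grad_mul_grad κ u hu
  rw [Finset.sum_eq_zero (s := Λ) fun x hx => by simp [h x hx],
    Finset.sum_eq_zero_iff_of_nonneg fun e _ => by
      rw [mul_assoc]; exact mul_nonneg (hκ e).le (mul_self_nonneg _)] at h0
  exact extend_eq_zero_of_grad hd hu fun e he => by
    simpa [mul_assoc, (hκ e).ne'] using h0 e he

/-- The harmonic extension to `Λ` of the values of `φ` outside `Λ`. -/
def harmonicExt (κ : EdgeConfig d) (Λ : Finset (Site d)) (φ : Site d → ℝ) : Site d → ℝ :=
  φ + dirichletSolve κ Λ (generator κ φ)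

theorem harmonicExt_of_notMem (κ : EdgeConfig d) {Λ : Finset (Site d)} (φ : Site d → ℝ)
    {x : Site d} (hx : x ∉ Λ) : harmonicExt κ Λ φ x = φ x := by
  simp [harmonicExt, dirichletSolve_of_notMem _ _ hx]

theorem generator_harmonicExt (hd : 0 < d) {κ : EdgeConfig d} (hκ : ∀ e, 0 < κ e)
    {Λ : Finset (Site d)} (φ : Site d → ℝ) {x : Site d} (hx : x ∈ Λ) :
    generator κ (harmonicExt κ Λ φ) x = 0 := by
  have := neg_generator_dirichletSolve hd hκ (generator κ φ) hx
  rw [harmonicExt, generator_add]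
  linarith

/-- This uniqueness lets harmonic extension commute with constants and translations without any
computation with the inverse matrix. -/
theorem harmonicExt_unique (hd : 0 < d) {κ : EdgeConfig d} (hκ : ∀ e, 0 < κ e)
    {Λ : Finset (Site d)} {φ h : Site d → ℝ} (h1 : ∀ x ∉ Λ, h x = φ x)
    (h2 : ∀ x ∈ Λ, generator κ h x = 0) : harmonicExt κ Λ φ = h := by
  rw [← sub_eq_zero]
  refine eq_zero_of_generator_eq_zero hd hκ (Λ := Λ) (fun x hx => ?_) fun x hx => ?_
  · simp [harmonicExt_of_notMem κ φ hx, h1 x hx]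
  · rw [generator_sub, generator_harmonicExt hd hκ φ hx, h2 x hx, sub_zero]

theorem harmonicExt_sub_const (hd : 0 < d) {κ : EdgeConfig d} (hκ : ∀ e, 0 < κ e)
    (Λ : Finset (Site d)) (φ : Site d → ℝ) (c : ℝ) :
    harmonicExt κ Λ (fun x => φ x + c) = fun x => harmonicExt κ Λ φ x + c :=
  harmonicExt_unique hd hκ (fun x hx => by rw [harmonicExt_of_notMem κ φ hx])
    fun x hx => by rw [generator_add_const, generator_harmonicExt hd hκ φ hx]

theorem grad_shift (φ : Site d → ℝ) (x : Site d) :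
    grad (fun y => φ (y + x)) = shift x (grad φ) := by
  ext e
  simp only [grad, shift]
  rw [add_right_comm]

theorem generator_shift (κ : EdgeConfig d) (φ : Site d → ℝ) (x y : Site d) :
    generator (shift x κ) (fun z => φ (z + x)) y = generator κ φ (y + x) := by
  simp only [generator, shift]
  refine Finset.sum_congr rfl fun i _ => ?_
  rw [add_right_comm y, show y - unit i + x = y + x - unit i by abel]

theorem harmonicExt_shift (hd : 0 < d) {κ : EdgeConfig d} (hκ : ∀ e, 0 < κ e)
    {Λ Λ' : Finset (Site d)} (φ : Site d → ℝ) (x : Site d) (hΛ : ∀ y, y ∈ Λ' ↔ y + x ∈ Λ) :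
    harmonicExt (shift x κ) Λ' (fun y => φ (y + x)) = fun y => harmonicExt κ Λ φ (y + x) :=
  harmonicExt_unique hd (κ := shift x κ) (fun e => hκ _)
    (fun y hy => harmonicExt_of_notMem κ φ fun h => hy ((hΛ y).2 h))
    fun y hy => by rw [generator_shift, generator_harmonicExt hd hκ φ ((hΛ y).1 hy)]

/-- The Dirichlet energy of a function on `Λ`, extended by zero. -/
def dirichletEnergy (κ : EdgeConfig d) (Λ : Finset (Site d)) (φ : Site d → ℝ) : ℝ :=
  ∑ e ∈ edgesTouching Λ, κ e * grad φ e ^ 2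

theorem dirichletEnergy_add (κ : EdgeConfig d) {Λ : Finset (Site d)} (φ : Site d → ℝ)
    {u : Site d → ℝ} (hu : ∀ x ∉ Λ, u x = 0) :
    dirichletEnergy κ Λ (φ + u) =
      dirichletEnergy κ Λ φ + dirichletEnergy κ Λ u + 2 * ∑ x ∈ Λ, u x * -generator κ φ x := by
  rw [← sum_grad_mul_grad κ φ hu]
  simp only [dirichletEnergy, grad_add, Finset.mul_sum, ← Finset.sum_add_distrib]
  exact Finset.sum_congr rfl fun _ _ => by ring

/-- Pythagoras: the cross term is the pairing of u with L_κ φ. It underlies both the factorization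
of the Gaussian weight and the best-approximation property of Dirichlet solutions. -/
theorem dirichletEnergy_add_of_harmonic {κ : EdgeConfig d} {Λ : Finset (Site d)}
    {φ u : Site d → ℝ} (hφ : ∀ x ∈ Λ, generator κ φ x = 0) (hu : ∀ x ∉ Λ, u x = 0) :
    dirichletEnergy κ Λ (φ + u) = dirichletEnergy κ Λ φ + dirichletEnergy κ Λ u := by
  rw [dirichletEnergy_add κ φ hu, Finset.sum_eq_zero fun x hx => by simp [hφ x hx]]
  ring

theorem dirichletEnergy_eq_sum (κ : EdgeConfig d) {Λ : Finset (Site d)} {u : Site d → ℝ}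
    (hu : ∀ x ∉ Λ, u x = 0) : dirichletEnergy κ Λ u = ∑ x ∈ Λ, u x * -generator κ u x := by
  rw [← sum_grad_mul_grad κ u hu]
  exact Finset.sum_congr rfl fun _ _ => by ring

theorem dirichletEnergy_nonneg {κ : EdgeConfig d} (hκ : ∀ e, 0 < κ e) (Λ : Finset (Site d))
    (φ : Site d → ℝ) : 0 ≤ dirichletEnergy κ Λ φ :=
  Finset.sum_nonneg fun e _ => mul_nonneg (hκ e).le (sq_nonneg _)

/-! ### Heights -/

theorem loopCondition_grad (φ : Site d → ℝ) : LoopCondition (grad φ) := by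
  intro x i j
  simp only [grad, add_right_comm x (unit j) (unit i)]
  ring

theorem corner_succ (x : Site d) (i : Fin d) :
    corner x (i.val + 1) = corner x i.val + Pi.single i (x i) := by
  ext k
  rcases lt_trichotomy k i with h | h | h
  · have h' : k.val < i.val := h
    simp [corner, h.ne, h', Nat.lt_succ_of_lt h']
  · subst h; simp [corner]
  · have h' : i.val < k.val := h
    have h1 : ¬ k.val < i.val := by omega
    have h2 : ¬ k.val < i.val + 1 := by omega
    simp [corner, h.ne', h1, h2]

theorem height_grad (φ : Site d → ℝ) (x : Site d) : height (grad φ) x = φ x - φ 0 := by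
  have key : ∀ i : Fin d,
      ∑ k ∈ Finset.Ico 0 (x i), grad φ (corner x i.val + Pi.single i k, i)
        - ∑ k ∈ Finset.Ico (x i) 0, grad φ (corner x i.val + Pi.single i k, i) =
      φ (corner x (i.val + 1)) - φ (corner x i.val) := by
    intro i
    have h := sum_Ico_sub_telescope (fun k => φ (corner x i.val + Pi.single i k)) (x i)
    simp only [Pi.single_zero, add_zero, Pi.single_add] at h
    rw [corner_succ, ← h]
    simp only [grad, unit, add_assoc]
  rw [height, pathSum, Finset.sum_congr rfl fun i _ => key i,
    Fin.sum_univ_eq_sum_range (fun n => φ (corner x (n + 1)) - φ (corner x n)),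
    Finset.sum_range_sub (fun n => φ (corner x n))]
  congr 2
  ext k; simp [corner]

theorem grad_height {η : EdgeConfig d} (hη : LoopCondition η) : grad (height η) = η := by
  ext ⟨x, i⟩
  exact height_add_unit hη x i

theorem height_shift {η : EdgeConfig d} (hη : LoopCondition η) (x y : Site d) :
    height (shift x η) y = height η (y + x) - height η x := by
  conv_lhs => rw [← grad_height hη, ← grad_shift, height_grad]
  simp

/-! ### Boxes and the truncated energy estimate -/

/-- The box `[-n, n]^d`. -/
def box (d n : ℕ) : Finset (Site d) := Finset.Icc (fun _ => -(n : ℤ)) fun _ => (n : ℤ)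

theorem mem_box {n : ℕ} {x : Site d} : x ∈ box d n ↔ ‖x‖ ≤ n := by
  rw [box, Finset.mem_Icc, pi_norm_le_iff_of_nonneg (by positivity), Pi.le_def, Pi.le_def,
    ← forall_and]
  refine forall_congr' fun i => ?_
  rw [Int.norm_eq_abs, ← Int.cast_abs, ← abs_le]
  exact_mod_cast Iff.rfl

theorem card_box (d n : ℕ) : (box d n).card = (2 * n + 1) ^ d := by
  rw [box, Pi.card_Icc]
  simp only [Int.card_Icc, Finset.prod_const, Finset.card_univ, Fintype.card_fin]
  congr 1
  omega

theorem norm_unit_le (i : Fin d) : ‖(unit i : Site d)‖ ≤ 1 := by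
  rw [pi_norm_le_iff_of_nonneg zero_le_one]
  intro j
  by_cases h : j = i
  · subst h; simp [unit]
  · simp [unit, h]

theorem card_edgesTouching_le (Λ : Finset (Site d)) :
    (edgesTouching Λ).card ≤ 2 * d * Λ.card := by
  refine (Finset.card_union_le _ _).trans ?_
  have := Finset.card_image_le (s := Λ ×ˢ (Finset.univ : Finset (Fin d)))
    (f := fun e : Edge d => (e.1 - unit e.2, e.2))
  rw [Finset.card_product, Finset.card_univ, Fintype.card_fin] at *
  linarith [mul_comm d Λ.card]

/-- The truncation of a real number at the levels `±K`. -/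
def truncate (K s : ℝ) : ℝ := max (-K) (min K s)

theorem abs_truncate_le {K : ℝ} (hK : 0 ≤ K) (s : ℝ) : |truncate K s| ≤ K :=
  abs_le.2 ⟨le_max_left _ _, max_le (by linarith) (min_le_left _ _)⟩

theorem truncate_of_abs_le {K s : ℝ} (h : |s| ≤ K) : truncate K s = s := by
  rw [abs_le] at h
  rw [truncate, min_eq_right h.2, max_eq_right h.1]

theorem truncate_mono (K : ℝ) : Monotone (truncate K) := fun a b h => by
  unfold truncate; gcongr

theorem abs_truncate_sub_le (K a b : ℝ) : |truncate K a - truncate K b| ≤ |a - b| :=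
  (abs_max_sub_max_le_max _ _ _ _).trans (max_le (by simp)
    ((abs_min_sub_min_le_max _ _ _ _).trans (max_le (by simp) le_rfl)))

/-- Truncation is monotone and 1-Lipschitz, so its increment has the sign of the original one and is
no larger. This replaces the chain rule in the energy estimate. -/
theorem sq_truncate_sub_le (K a b : ℝ) :
    (truncate K a - truncate K b) ^ 2 ≤ (a - b) * (truncate K a - truncate K b) := by
  have h := abs_truncate_sub_le K a b
  rcases le_total b a with hab | hab
  · have h1 := truncate_mono K hab
    rw [abs_of_nonneg (by linarith), abs_of_nonneg (by linarith)] at h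
    nlinarith
  · have h1 := truncate_mono K hab
    rw [abs_of_nonpos (by linarith), abs_of_nonpos (by linarith)] at h
    nlinarith

/-- The energy of the truncation of a harmonic function is controlled by the `ℓ¹` norm of its
gradient. -/
theorem sum_sq_grad_truncate_le {κ : EdgeConfig d} {a b : ℝ} (ha : 0 < a)
    (hκ : ∀ e, κ e ∈ Set.Icc a b) {n : ℕ} (hn : 0 < n) {v : Site d → ℝ}
    (hv : ∀ x ∈ box d (2 * n), generator κ v x = 0) {K : ℝ} (hK : 0 ≤ K) :
    a * ∑ e ∈ box d n ×ˢ (Finset.univ : Finset (Fin d)), grad (fun x => truncate K (v x)) e ^ 2 ≤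
      b * K / n * ∑ e ∈ edgesTouching (box d (2 * n)), |grad v e| := by
  have hn' : (0 : ℝ) < n := by exact_mod_cast hn
  -- Cutoff equal to 1 on the box of size n, to 0 off the box of size 2n, with slope 1/n in between.
  let ζ : Site d → ℝ := fun x => max 0 (min 1 (2 - ‖x‖ / n))
  have hζ0 : ∀ x, 0 ≤ ζ x := fun x => le_max_left _ _
  have hζ1 : ∀ x ∈ box d n, ζ x = 1 := fun x hx => by
    have : ‖x‖ / n ≤ 1 := (div_le_one hn').2 (mem_box.1 hx)
    simp only [ζ]
    rw [min_eq_left (by linarith), max_eq_right zero_le_one]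
  have hζs : ∀ x ∉ box d (2 * n), ζ x = 0 := fun x hx => by
    rw [mem_box, not_le, Nat.cast_mul] at hx
    have : 2 < ‖x‖ / n := by rw [lt_div_iff₀ hn']; exact_mod_cast hx
    exact max_eq_left ((min_le_right _ _).trans (by linarith))
  have hζg : ∀ e : Edge d, |grad ζ e| ≤ 1 / n := fun e => by
    refine (abs_max_sub_max_le_max _ _ _ _).trans (max_le (by simp)
      ((abs_min_sub_min_le_max _ _ _ _).trans (max_le (by simp) ?_)))
    rw [sub_sub_sub_cancel_left, ← sub_div, abs_div, abs_of_pos hn']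
    gcongr
    refine (abs_norm_sub_norm_le _ _).trans ?_
    simpa using norm_unit_le e.2
  let T : Site d → ℝ := fun x => truncate K (v x)
  -- Harmonicity tested against ζ times the truncation of v. The truncation makes the test function
  -- bounded by K, so that only the first power of the gradient of v appears on the right-hand side.
  have key := sum_grad_mul_grad κ v (Λ := box d (2 * n)) (u := fun x => ζ x * T x)
    fun x hx => by simp [hζs x hx]
  rw [Finset.sum_eq_zero (s := box d (2 * n)) fun x hx => by simp [hv x hx]] at key
  -- Exact discrete product rule: the cutoff is evaluated at the start of the edge, the truncation
  -- at its end.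
  have hsplit : ∀ e : Edge d, κ e * grad v e * grad (fun x => ζ x * T x) e =
      κ e * ζ e.1 * (grad v e * grad T e) + κ e * grad v e * (T (e.1 + unit e.2) * grad ζ e) :=
    fun e => by simp only [grad]; ring
  simp only [hsplit, Finset.sum_add_distrib] at key
  have hT : ∀ e : Edge d, grad T e ^ 2 ≤ grad v e * grad T e := fun e => sq_truncate_sub_le _ _ _
  have hpos : ∀ e, 0 ≤ κ e := fun e => ha.le.trans (hκ e).1
  calc a * ∑ e ∈ box d n ×ˢ (Finset.univ : Finset (Fin d)), grad T e ^ 2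
      = ∑ e ∈ box d n ×ˢ (Finset.univ : Finset (Fin d)), a * grad T e ^ 2 := Finset.mul_sum _ _ _
    _ ≤ ∑ e ∈ box d n ×ˢ (Finset.univ : Finset (Fin d)), κ e * ζ e.1 * (grad v e * grad T e) := by
        refine Finset.sum_le_sum fun e he => ?_
        rw [hζ1 _ (Finset.mem_product.1 he).1, mul_one]
        exact mul_le_mul (hκ e).1 (hT e) (sq_nonneg _) (hpos e)
    _ ≤ ∑ e ∈ edgesTouching (box d (2 * n)), κ e * ζ e.1 * (grad v e * grad T e) := by
        refine Finset.sum_le_sum_of_subset_of_nonneg (fun e he => ?_) fun e _ _ =>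
          mul_nonneg (mul_nonneg (hpos e) (hζ0 _)) ((sq_nonneg _).trans (hT e))
        refine mem_edgesTouching.2 (.inl (mem_box.2 ?_))
        refine (mem_box.1 (Finset.mem_product.1 he).1).trans ?_
        push_cast; linarith
    _ = -∑ e ∈ edgesTouching (box d (2 * n)),
          κ e * grad v e * (T (e.1 + unit e.2) * grad ζ e) := by linarith
    _ ≤ ∑ e ∈ edgesTouching (box d (2 * n)), b * K / n * |grad v e| := by
        rw [← Finset.sum_neg_distrib]
        refine Finset.sum_le_sum fun e _ => (neg_le_abs _).trans ?_
        rw [abs_mul, abs_mul, abs_mul, abs_of_nonneg (hpos e)]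
        calc κ e * |grad v e| * (|T (e.1 + unit e.2)| * |grad ζ e|)
            ≤ b * |grad v e| * (K * (1 / n)) := by
              have := abs_truncate_le hK (v (e.1 + unit e.2))
              have hb := (hκ e).2
              have hb0 := (hpos e).trans hb
              gcongr
              exact hζg e
          _ = b * K / n * |grad v e| := by ring
    _ = b * K / n * ∑ e ∈ edgesTouching (box d (2 * n)), |grad v e| := (Finset.mul_sum _ _ _).symm

/-! ### The inverse of the generator -/

theorem abs_pathSum_le {v : EdgeConfig d} {s : ℝ} (h : ∀ e, |v e| ≤ s) (x : Site d) :
    |pathSum v x| ≤ (∑ i, |(x i : ℝ)|) * s := by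
  rw [pathSum, Finset.sum_mul]
  refine (Finset.abs_sum_le_sum_abs _ _).trans (Finset.sum_le_sum fun i _ => ?_)
  have hs : 0 ≤ s := (abs_nonneg _).trans (h (0, i))
  have hb : ∀ p q : ℤ, |∑ k ∈ Finset.Ico p q, v (corner x i.val + Pi.single i k, i)| ≤
      (q - p).toNat * s := fun p q => by
    refine (Finset.abs_sum_le_sum_abs _ _).trans ((Finset.sum_le_card_nsmul _ _ s
      fun k _ => h _).trans (by simp))
  rcases le_total 0 (x i) with hx | hx
  · have h1 := hb 0 (x i)
    rw [Finset.Ico_eq_empty (a := x i) (by omega), Finset.sum_empty, sub_zero]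
    have h2 : (((x i - 0).toNat : ℤ) : ℝ) = x i := by rw [Int.toNat_of_nonneg (by omega), sub_zero]
    rw [Int.cast_natCast] at h2
    rw [h2] at h1
    rwa [abs_of_nonneg (a := (x i : ℝ)) (by exact_mod_cast hx)]
  · have h1 := hb (x i) 0
    rw [Finset.Ico_eq_empty (b := x i) (by omega), Finset.sum_empty, zero_sub, abs_neg]
    have h2 : (((0 - x i).toNat : ℤ) : ℝ) = -x i := by
      rw [Int.toNat_of_nonneg (by omega)]; push_cast; ring
    rw [Int.cast_natCast] at h2
    rw [h2] at h1
    rwa [abs_of_nonpos (a := (x i : ℝ)) (by exact_mod_cast hx)]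

/-- A pairing with a function of zero sum ignores constants, hence is a finite combination of
gradients along lattice paths. Edgewise convergence of gradients thus suffices throughout. -/
theorem sum_mul_eq_sum_height {f : Site d →₀ ℝ} (hf : (f.sum fun _ a => a) = 0) (g : Site d → ℝ) :
    (f.sum fun x a => a * g x) = f.sum fun x a => a * height (grad g) x := by
  simp only [height_grad, mul_sub, Finsupp.sum, Finset.sum_sub_distrib, ← Finset.sum_mul]
  rw [Finsupp.sum] at hf
  rw [hf, zero_mul, sub_zero]

theorem energy_eq_add (κ : EdgeConfig d) (S : Finset (Edge d)) (g : Site d → ℝ) :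
    energy κ g = ∑ e ∈ S, ENNReal.ofReal (κ e * grad g e ^ 2) +
      ∑' e : ((S : Set (Edge d))ᶜ : Set (Edge d)), ENNReal.ofReal (κ e * grad g e ^ 2) := by
  rw [energy, ← Summable.tsum_add_tsum_compl (s := (S : Set (Edge d))) ENNReal.summable
    ENNReal.summable, Finset.tsum_subtype' S fun e => ENNReal.ofReal (κ e * grad g e ^ 2)]

/-- The Dirichlet solution in `Λ` is the best approximation of `(-L_κ)⁻¹ f` among the functions
supported in `Λ`. -/
theorem energy_sub_dirichletSolve_le (hd : 0 < d) {κ : EdgeConfig d} (hκ : ∀ e, 0 < κ e)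
    {Λ : Finset (Site d)} {f g v : Site d → ℝ} (hg : ∀ x, -generator κ g x = f x)
    (hv : ∀ x ∉ Λ, v x = 0) :
    energy κ (g - dirichletSolve κ Λ f) ≤ energy κ (g - v) := by
  set u := dirichletSolve κ Λ f with hu
  have hu0 : ∀ x ∉ Λ, u x = 0 := fun x hx => dirichletSolve_of_notMem κ f hx
  rw [energy_eq_add κ (edgesTouching Λ), energy_eq_add κ (edgesTouching Λ)]
  refine add_le_add ?_ (le_of_eq (tsum_congr fun e => ?_))
  · rw [← ENNReal.ofReal_sum_of_nonneg fun e _ => mul_nonneg (hκ e).le (sq_nonneg _),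
      ← ENNReal.ofReal_sum_of_nonneg fun e _ => mul_nonneg (hκ e).le (sq_nonneg _)]
    refine ENNReal.ofReal_le_ofReal ?_
    change dirichletEnergy κ Λ _ ≤ dirichletEnergy κ Λ _
    -- The difference g - u is harmonic in Λ and u - v vanishes outside, so the energies add. On
    -- edges not touching Λ both u and v are zero and the two sides agree.
    rw [show g - v = (g - u) + (u - v) by abel, dirichletEnergy_add_of_harmonic]
    · linarith [dirichletEnergy_nonneg hκ Λ (u - v)]
    · intro x hx
      have h1 := neg_generator_dirichletSolve hd hκ f hx
      rw [generator_sub]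
      linarith [hg x]
    · intro x hx
      simp [hu0 x hx, hv x hx]
  · have he : (e : Edge d) ∉ edgesTouching Λ := e.2
    rw [mem_edgesTouching, not_or] at he
    simp [grad, hu0 _ he.1, hu0 _ he.2, hv _ he.1, hv _ he.2]

theorem ofReal_mul_sq_grad_le_energy (κ : EdgeConfig d) (g : Site d → ℝ) (e : Edge d) :
    ENNReal.ofReal (κ e * grad g e ^ 2) ≤ energy κ g := ENNReal.le_tsum e

/-- The diagonal of `(-L_κ)⁻¹` is the limit of its finite volume versions. -/
theorem tendsto_sum_dirichletSolve (hd : 0 < d) {κ : EdgeConfig d} (hκ : ∀ e, 0 < κ e)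
    {c : Site d →₀ ℝ} (hc : (c.sum fun _ a => a) = 0) {f g : Site d → ℝ}
    (hg : IsNegGeneratorInverse κ f g) {Λ : ℕ → Finset (Site d)}
    (hΛ : ∀ S : Finset (Site d), ∀ᶠ n in atTop, S ⊆ Λ n) :
    Tendsto (fun n => c.sum fun x a => a * dirichletSolve κ (Λ n) f x) atTop
      (𝓝 (c.sum fun x a => a * g x)) := by
  obtain ⟨hg1, u, hu⟩ := hg
  have hE : Tendsto (fun n => energy κ (g - dirichletSolve κ (Λ n) f)) atTop (𝓝 0) := by
    rw [ENNReal.tendsto_nhds_zero] at hu ⊢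
    intro ε hε
    obtain ⟨m, hm⟩ := (hu ε hε).exists
    filter_upwards [hΛ (u m).support] with n hn
    -- The approximant `u m` is an admissible competitor as soon as its support lies in `Λ n`.
    refine (energy_sub_dirichletSolve_le hd hκ hg1 fun x hx => ?_).trans hm
    exact Finsupp.notMem_support_iff.1 fun h => hx (hn h)
  have hgrad : ∀ e, Tendsto (fun n => grad (dirichletSolve κ (Λ n) f) e) atTop (𝓝 (grad g e)) := by
    intro e
    have h1 : Tendsto (fun n => ENNReal.ofReal (κ e * grad (g - dirichletSolve κ (Λ n) f) e ^ 2))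
        atTop (𝓝 0) :=
      tendsto_of_tendsto_of_tendsto_of_le_of_le tendsto_const_nhds hE (fun _ => zero_le)
        fun n => ofReal_mul_sq_grad_le_energy κ _ e
    have h2 := (ENNReal.tendsto_toReal ENNReal.zero_ne_top).comp h1
    have h3 : Tendsto (fun n => grad (g - dirichletSolve κ (Λ n) f) e ^ 2) atTop (𝓝 0) := by
      have h4 := h2.const_mul (κ e)⁻¹
      rw [ENNReal.toReal_zero, mul_zero] at h4
      refine h4.congr fun n => ?_
      rw [Function.comp, ENNReal.toReal_ofReal (mul_nonneg (hκ e).le (sq_nonneg _)),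
        inv_mul_cancel_left₀ (hκ e).ne']
    have h5 := (h3.sqrt)
    simp only [Real.sqrt_sq_eq_abs, Real.sqrt_zero] at h5
    have h6 := (tendsto_zero_iff_abs_tendsto_zero _).2 h5
    have h7 := (tendsto_const_nhds (x := grad g e)).sub h6
    rw [sub_zero] at h7
    refine h7.congr fun n => ?_
    rw [grad_sub]; ring
  rw [sum_mul_eq_sum_height hc]
  simp_rw [fun n => sum_mul_eq_sum_height hc (dirichletSolve κ (Λ n) f)]
  refine tendsto_finsetSum _ fun x _ => Tendsto.const_mul _ ?_
  simp only [height, pathSum]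
  exact tendsto_finsetSum _ fun i _ => (tendsto_finsetSum _ fun k _ => hgrad _).sub
    (tendsto_finsetSum _ fun k _ => hgrad _)

theorem box_mono {m n : ℕ} (h : m ≤ n) : box d m ⊆ box d n := fun x hx =>
  mem_box.2 ((mem_box.1 hx).trans (by exact_mod_cast h))

theorem eventually_subset_box (S : Finset (Site d)) : ∀ᶠ n in atTop, S ⊆ box d n := by
  obtain ⟨N, hN⟩ := exists_nat_ge (∑ x ∈ S, ‖x‖)
  filter_upwards [eventually_ge_atTop N] with n hn x hx
  exact mem_box.2 ((Finset.single_le_sum (fun x _ => norm_nonneg x) hx).trans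
    (hN.trans (by exact_mod_cast hn)))

theorem finsupp_sum_eq_sum {f : Site d →₀ ℝ} {Λ : Finset (Site d)} (h : f.support ⊆ Λ)
    (u : Site d → ℝ) : (f.sum fun x a => a * u x) = ∑ x ∈ Λ, u x * f x := by
  rw [Finsupp.sum_of_support_subset f h _ (by simp)]
  exact Finset.sum_congr rfl fun _ _ => mul_comm _ _

/-- Let u_n be the Dirichlet solutions in growing boxes and c_n = f·u_n, which is also the energy of
u_n. The energy of u_m - u_n is c_m - c_n, so c_n is increasing; it is bounded because f has zero
sum and the conductances are bounded below. Hence the gradients converge on every edge, their limit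
keeps the loop condition, and its height function is the solution. -/
theorem exists_isNegGeneratorInverse (hd : 0 < d) {κ : EdgeConfig d} {a : ℝ} (ha : 0 < a)
    (hκ : ∀ e, a ≤ κ e) {f : Site d →₀ ℝ} (hf : (f.sum fun _ a => a) = 0) :
    ∃ g, IsNegGeneratorInverse κ f g := by
  have hκ0 : ∀ e, 0 < κ e := fun e => ha.trans_le (hκ e)
  obtain ⟨N, hN⟩ := (eventually_subset_box f.support).exists
  let u : ℕ → Site d → ℝ := fun n => dirichletSolve κ (box d (N + n)) f
  have hu0 : ∀ n, ∀ x ∉ box d (N + n), u n x = 0 := fun n x hx => dirichletSolve_of_notMem κ f hx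
  have huL : ∀ n, ∀ x ∈ box d (N + n), -generator κ (u n) x = f x := fun n x hx =>
    neg_generator_dirichletSolve hd hκ0 f hx
  have hsub : ∀ n, f.support ⊆ box d (N + n) := fun n => hN.trans (box_mono (by omega))
  let c : ℕ → ℝ := fun n => f.sum fun x a => a * u n x
  -- The cross term equals -2 c_n, since -L_κ `u m` = f on the larger box and the support of f lies
  -- in the smaller one; the energies themselves are c_m and c_n.
  have hdiff : ∀ m n, n ≤ m → dirichletEnergy κ (box d (N + m)) (u m - u n) = c m - c n := by
    intro m n hmn
    have hle := box_mono (d := d) (show N + n ≤ N + m by omega)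
    have hn0 : ∀ x ∉ box d (N + m), u n x = 0 := fun x hx => hu0 n x fun h => hx (hle h)
    have e1 : u m = u n + (u m - u n) := by abel
    have h1 := dirichletEnergy_eq_sum κ (hu0 m)
    have h2 := dirichletEnergy_eq_sum κ hn0
    have h3 := dirichletEnergy_add κ (Λ := box d (N + m)) (u m) (u := -u n)
      fun x hx => by simp [hn0 x hx]
    have h4 : dirichletEnergy κ (box d (N + m)) (-u n) = dirichletEnergy κ (box d (N + m)) (u n) :=
      Finset.sum_congr rfl fun e _ => by simp only [grad, Pi.neg_apply]; ring
    have h5 : ∑ x ∈ box d (N + m), u n x * -generator κ (u n) x = c n := by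
      rw [← Finset.sum_subset hle fun x _ hx => by rw [hu0 n x hx, zero_mul],
        Finset.sum_congr rfl fun x hx => by rw [huL n x hx]]
      exact (finsupp_sum_eq_sum (hsub n) _).symm
    have h6 : ∑ x ∈ box d (N + m), u m x * -generator κ (u m) x = c m := by
      rw [Finset.sum_congr rfl fun x hx => by rw [huL m x hx]]
      exact (finsupp_sum_eq_sum (hsub m) _).symm
    have h7 : ∑ x ∈ box d (N + m), (-u n) x * -generator κ (u m) x = -c n := by
      rw [Finset.sum_congr rfl fun x hx => by rw [huL m x hx]]
      simp only [Pi.neg_apply, neg_mul, Finset.sum_neg_distrib]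
      exact congrArg _ (finsupp_sum_eq_sum (hsub m) _).symm
    rw [sub_eq_add_neg, h3, h4, h7, h1, h2, h5, h6]
    ring
  have hgradle : ∀ m (v : Site d → ℝ), (∀ x ∉ box d (N + m), v x = 0) → ∀ e,
      grad v e ^ 2 ≤ dirichletEnergy κ (box d (N + m)) v / a := by
    intro m v hv e
    rw [le_div_iff₀ ha]
    by_cases he : e ∈ edgesTouching (box d (N + m))
    · refine le_trans ?_ (Finset.single_le_sum (f := fun e => κ e * grad v e ^ 2)
        (fun e _ => mul_nonneg (hκ0 e).le (sq_nonneg _)) he)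
      rw [mul_comm]
      exact mul_le_mul_of_nonneg_right (hκ e) (sq_nonneg _)
    · rw [mem_edgesTouching, not_or] at he
      simpa [grad, hv _ he.1, hv _ he.2] using dirichletEnergy_nonneg hκ0 _ v
  have hmono : Monotone c := fun n m h => by
    have := dirichletEnergy_nonneg hκ0 (box d (N + m)) (u m - u n)
    rw [hdiff m n h] at this
    linarith
  have hcE : ∀ n, dirichletEnergy κ (box d (N + n)) (u n) = c n := fun n => by
    rw [dirichletEnergy_eq_sum κ (hu0 n), Finset.sum_congr rfl fun x hx => by rw [huL n x hx]]
    exact (finsupp_sum_eq_sum (hsub n) _).symm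
  have hc0 : ∀ n, 0 ≤ c n := fun n => hcE n ▸ dirichletEnergy_nonneg hκ0 _ _
  -- Each site is weighted by the length of the lattice path joining it to the origin.
  set C : ℝ := ∑ x ∈ f.support, |f x| * ∑ i, |(x i : ℝ)| with hC
  have hbound : ∀ n, c n ≤ C ^ 2 / a := by
    intro n
    -- Every gradient of `u n` is at most the square root of c_n / a. The resulting inequality is
    -- linear in c_n on the left and of square-root order on the right, so it bounds c_n by C²/a.
    have h1 : c n ≤ C * √(c n / a) := by
      have e1 : c n = f.sum fun x a => a * height (grad (u n)) x := sum_mul_eq_sum_height hf _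
      refine e1.le.trans ?_
      rw [Finsupp.sum, hC, Finset.sum_mul]
      refine Finset.sum_le_sum fun x _ => (le_abs_self _).trans ?_
      rw [abs_mul, mul_assoc]
      refine mul_le_mul_of_nonneg_left (abs_pathSum_le (fun e => ?_) x) (abs_nonneg _)
      rw [← Real.sqrt_sq_eq_abs]
      exact Real.sqrt_le_sqrt (hcE n ▸ hgradle n (u n) (hu0 n) e)
    rw [Real.sqrt_div' _ ha.le] at h1
    have hs : 0 < √a := Real.sqrt_pos.2 ha
    have h2 := Real.sq_sqrt (hc0 n)
    have h3 := Real.sq_sqrt ha.le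
    have h4 : √(c n) * √a ≤ C := by
      rcases (Real.sqrt_nonneg (c n)).eq_or_lt with h | h
      · rw [← h, zero_mul]
        exact Finset.sum_nonneg fun x _ => mul_nonneg (abs_nonneg _)
          (Finset.sum_nonneg fun i _ => abs_nonneg _)
      · refine le_of_mul_le_mul_right (a := √(c n)) ?_ h
        rw [mul_div_assoc', le_div_iff₀ hs] at h1
        nlinarith
    rw [le_div_iff₀ ha, ← h2, ← h3, ← mul_pow]
    exact pow_le_pow_left₀ (by positivity) h4 2
  have hlim := tendsto_atTop_ciSup hmono ⟨C ^ 2 / a, by rintro _ ⟨n, rfl⟩; exact hbound n⟩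
  set c' := ⨆ n, c n
  have hcle : ∀ n, c n ≤ c' := fun n => hmono.ge_of_tendsto hlim n
  have hcauchy : ∀ e, CauchySeq fun n => grad (u n) e := by
    intro e
    have hz : Tendsto (fun n => √((c' - c n) / a)) atTop (𝓝 0) := by
      have := ((hlim.const_sub c').div_const a).sqrt
      simpa using this
    refine cauchySeq_of_le_tendsto_0 (fun n => 2 * √((c' - c n) / a)) ?_
      (by simpa using hz.const_mul 2)
    have h1 : ∀ k n, k ≤ n → dist (grad (u n) e) (grad (u k) e) ≤ √((c' - c k) / a) := by
      intro k n hkn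
      rw [Real.dist_eq, ← grad_sub, ← Real.sqrt_sq_eq_abs]
      refine Real.sqrt_le_sqrt ((hgradle n (u n - u k) (fun x hx => ?_) e).trans ?_)
      · have : x ∉ box d (N + k) := fun h => hx (box_mono (by omega) h)
        simp [hu0 n x hx, hu0 k x this]
      · rw [hdiff n k hkn]
        have := hcle n
        gcongr
    intro n m k hkn hkm
    refine (dist_triangle_right _ _ (grad (u k) e)).trans ?_
    linarith [h1 k n hkn, h1 k m hkm]
  choose D hD using fun e => cauchySeq_tendsto_of_complete (hcauchy e)
  let g : Site d → ℝ := height D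
  have hDl : LoopCondition D := by
    intro x i j
    refine tendsto_nhds_unique ((((hD (x, i)).add (hD (x + unit i, j))).sub
      (hD (x + unit j, i))).sub (hD (x, j))) ?_
    simp only [loopCondition_grad (u _) x i j]
    exact tendsto_const_nhds
  have hgD : grad g = D := grad_height hDl
  refine ⟨g, fun x => ?_, fun n => Finsupp.onFinset (box d (N + n)) (u n)
    fun x hx => by_contra fun h => hx (hu0 n x h), ?_⟩
  · have h1 : Tendsto (fun n => -generator κ (u n) x) atTop (𝓝 (-generator κ g x)) := by
      simp only [generator_eq_sum, hgD]
      exact (tendsto_finsetSum _ fun i _ => ((hD _).const_mul _).sub ((hD _).const_mul _)).neg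
    refine tendsto_nhds_unique h1 (tendsto_const_nhds.congr' ?_)
    filter_upwards [eventually_subset_box {x}] with n hn
    rw [huL n x (box_mono (by omega) (hn (Finset.mem_singleton_self x)))]
  · have hz : Tendsto (fun n => ENNReal.ofReal (c' - c n)) atTop (𝓝 0) := by
      have := ENNReal.tendsto_ofReal (hlim.const_sub c')
      simpa using this
    refine tendsto_of_tendsto_of_tendsto_of_le_of_le tendsto_const_nhds hz (fun _ => zero_le)
      fun n => ?_
    -- Lower semicontinuity of the energy: on a finite set of edges the energy of g - `u n` is a
    -- limit over m of quantities bounded by c_m - c_n.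
    rw [energy, ENNReal.tsum_eq_iSup_sum]
    refine iSup_le fun F => ?_
    rw [← ENNReal.ofReal_sum_of_nonneg fun e _ => mul_nonneg (hκ0 e).le (sq_nonneg _)]
    refine ENNReal.ofReal_le_ofReal ?_
    have h1 : Tendsto (fun m => ∑ e ∈ F, κ e * (grad (u m) e - grad (u n) e) ^ 2) atTop
        (𝓝 (∑ e ∈ F, κ e * grad (g - u n) e ^ 2)) := by
      simp only [grad_sub, hgD]
      exact tendsto_finsetSum _ fun e _ => (((hD e).sub_const _).pow 2).const_mul _
    refine le_of_tendsto h1 ?_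
    filter_upwards [eventually_ge_atTop n] with m hm
    have h2 : ∑ e ∈ F, κ e * (grad (u m) e - grad (u n) e) ^ 2 ≤
        dirichletEnergy κ (box d (N + m)) (u m - u n) := by
      simp only [dirichletEnergy, ← grad_sub]
      rw [← Finset.sum_inter_add_sum_sdiff F (edgesTouching (box d (N + m)))]
      rw [Finset.sum_eq_zero (s := F \ _), add_zero]
      · exact Finset.sum_le_sum_of_subset_of_nonneg Finset.inter_subset_right
          fun e _ _ => mul_nonneg (hκ0 e).le (sq_nonneg _)
      · intro e he
        have he := (Finset.mem_sdiff.1 he).2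
        rw [mem_edgesTouching, not_or] at he
        have hb := box_mono (d := d) (show N + n ≤ N + m by omega)
        simp [grad, hu0 m _ he.1, hu0 m _ he.2, hu0 n _ fun h => he.1 (hb h),
          hu0 n _ fun h => he.2 (hb h)]
    rw [hdiff m n hm] at h2
    linarith [hcle m]

/-! ### Measurability -/

theorem measurable_pathSum {M : Type*} [AddCommGroup M] [MeasurableSpace M] [MeasurableAdd₂ M]
    [MeasurableSub₂ M] {Ω : Type*} [MeasurableSpace Ω] {u : Ω → Edge d → M}
    (hu : ∀ e, Measurable fun ω => u ω e) (x : Site d) : Measurable fun ω => pathSum (u ω) x := by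
  unfold pathSum
  exact Finset.measurable_fun_sum _ fun i _ => (Finset.measurable_fun_sum _ fun k _ => hu _).sub
    (Finset.measurable_fun_sum _ fun k _ => hu _)

theorem measurable_height : Measurable (height (d := d)) :=
  measurable_pi_lambda _ fun x => measurable_pathSum (fun e => measurable_pi_apply e) x

theorem measurable_grad : Measurable (grad (d := d)) :=
  measurable_pi_lambda _ fun _ => (measurable_pi_apply _).sub (measurable_pi_apply _)

theorem measurable_glue {Ω : Type*} [MeasurableSpace Ω] {Λ : Finset (Site d)}
    {φ : Ω → Site d → ℝ} {ψ : Ω → Λ → ℝ} (hφ : Measurable φ) (hψ : Measurable ψ) :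
    Measurable fun ω => glue Λ (φ ω) (ψ ω) := by
  refine measurable_pi_lambda _ fun x => ?_
  by_cases hx : x ∈ Λ
  · simp only [glue, hx, dite_true]; fun_prop
  · simp only [glue, hx, dite_false]; fun_prop

theorem measurable_shift (x : Site d) : Measurable (shift (d := d) x) :=
  measurable_pi_lambda _ fun _ => measurable_pi_apply _

theorem exterior_le (Λ : Finset (Site d)) : exterior Λ ≤ MeasurableSpace.pi := by
  refine Measurable.comap_le (measurable_pi_lambda _ fun p => ?_)
  exact ((measurable_pi_apply _).comp measurable_height).sub
    ((measurable_pi_apply _).comp measurable_height)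

/-! ### Resampling the heights in a finite set -/

/-- The integral of `Ψ` over all configurations that agree with `η` up to the heights in `Λ`. -/
def fiberIntegral (Λ : Finset (Site d)) (Ψ : EdgeConfig d → ℝ≥0∞) (η : EdgeConfig d) : ℝ≥0∞ :=
  ∫⁻ ψ : Λ → ℝ, Ψ (grad (glue Λ (height η) ψ))

theorem measurable_fiberIntegral {Ω : Type*} [MeasurableSpace Ω] (Λ : Finset (Site d))
    {Ψ : Ω → EdgeConfig d → ℝ≥0∞} (hΨ : Measurable (Function.uncurry Ψ)) {η : Ω → EdgeConfig d}
    (hη : Measurable η) : Measurable fun ω => fiberIntegral Λ (Ψ ω) (η ω) := by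
  unfold fiberIntegral
  refine Measurable.lintegral_prod_right' (f := fun p : Ω × (Λ → ℝ) =>
    Ψ p.1 (grad (glue Λ (height (η p.1)) p.2))) ?_
  exact hΨ.comp (measurable_fst.prodMk (measurable_grad.comp
    (measurable_glue (measurable_height.comp (hη.comp measurable_fst)) measurable_snd)))

theorem glue_sub_const (Λ : Finset (Site d)) (φ : Site d → ℝ) (ψ : Λ → ℝ) (c : ℝ) :
    glue Λ (fun x => φ x - c) ψ = fun x => glue Λ φ (fun x => ψ x + c) x - c := by
  ext x; by_cases hx : x ∈ Λ <;> simp [glue, hx]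

theorem glue_glue (Λ : Finset (Site d)) (φ : Site d → ℝ) (ψ ψ' : Λ → ℝ) :
    glue Λ (glue Λ φ ψ) ψ' = glue Λ φ ψ' := by
  ext x; by_cases hx : x ∈ Λ <;> simp [glue, hx]

/-- Changing the heights in Λ may change the normalization at the origin, when the origin lies in Λ.
This only shifts the integration variable by a constant, which Lebesgue measure does not see. -/
theorem fiberIntegral_grad_glue (Λ : Finset (Site d)) (Ψ : EdgeConfig d → ℝ≥0∞)
    (η : EdgeConfig d) (ψ₀ : Λ → ℝ) :
    fiberIntegral Λ Ψ (grad (glue Λ (height η) ψ₀)) = fiberIntegral Λ Ψ η := by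
  unfold fiberIntegral
  set c := glue Λ (height η) ψ₀ 0
  have h1 : height (grad (glue Λ (height η) ψ₀)) = fun x => glue Λ (height η) ψ₀ x - c := by
    ext x; rw [height_grad]
  have h2 : ∀ ψ : Λ → ℝ, grad (glue Λ (height (grad (glue Λ (height η) ψ₀))) ψ) =
      grad (glue Λ (height η) (ψ + fun _ => c)) := fun ψ => by
    rw [h1, glue_sub_const, glue_glue]
    ext e
    simp only [grad]
    rw [sub_sub_sub_cancel_right]
    rfl
  simp only [h2]
  exact lintegral_add_right_eq_self (μ := (volume : Measure (Λ → ℝ)))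
    (fun ψ => Ψ (grad (glue Λ (height η) ψ))) fun _ => c

theorem fiberIntegral_mul {Λ : Finset (Site d)} {Ψ R : EdgeConfig d → ℝ≥0∞} (hΨ : Measurable Ψ)
    {η : EdgeConfig d} (hR : ∀ ψ, R (grad (glue Λ (height η) ψ)) = R η) :
    fiberIntegral Λ (fun η => Ψ η * R η) η = fiberIntegral Λ Ψ η * R η := by
  simp only [fiberIntegral, hR]
  exact lintegral_mul_const _ (hΨ.comp (measurable_grad.comp
    (measurable_glue measurable_const measurable_id)))

theorem grad_glue_height {Λ : Finset (Site d)} {η : EdgeConfig d} (hη : LoopCondition η)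
    (ψ : Λ → ℝ) {e : Edge d} (he : e ∉ edgesTouching Λ) :
    grad (glue Λ (height η) ψ) e = η e := by
  rw [mem_edgesTouching, not_or] at he
  conv_rhs => rw [← grad_height hη]
  simp [grad, glue, he.1, he.2]

/-- The Boltzmann factor as a function of the gradients. -/
def gibbsWeight (V : ℝ → ℝ) (Λ : Finset (Site d)) (η : EdgeConfig d) : ℝ≥0∞ :=
  ENNReal.ofReal (Real.exp (-∑ e ∈ edgesTouching Λ, V (η e)))

theorem measurable_gibbsWeight {V : ℝ → ℝ} (hV : Measurable V) (Λ : Finset (Site d)) :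
    Measurable (gibbsWeight V Λ) := by
  unfold gibbsWeight
  refine ENNReal.measurable_ofReal.comp (Real.measurable_exp.comp (Measurable.neg ?_))
  exact Finset.measurable_fun_sum _ fun e _ => hV.comp (measurable_pi_apply e)

theorem lintegral_specification {V : ℝ → ℝ} (hV : Measurable V) (Λ : Finset (Site d))
    (η : EdgeConfig d) {F : EdgeConfig d → ℝ≥0∞} (hF : Measurable F) :
    ∫⁻ η', F η' ∂specification V Λ η =
      (fiberIntegral Λ (gibbsWeight V Λ) η)⁻¹ *
        fiberIntegral Λ (fun η' => gibbsWeight V Λ η' * F η') η := by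
  have hm : Measurable fun ψ : Λ → ℝ => grad (glue Λ (height η) ψ) :=
    measurable_grad.comp (measurable_glue measurable_const measurable_id)
  rw [specification, lintegral_smul_measure, lintegral_map hF hm]
  exact congrArg _ (lintegral_withDensity_eq_lintegral_mul volume
    ((measurable_gibbsWeight hV Λ).comp hm) (hF.comp hm))

/-- The DLR equation integrated over the conditioning, in a form that only involves fibre integrals.
-/
theorem IsGradientGibbs.lintegral_eq {V : ℝ → ℝ} (hV : Measurable V)
    {μ : Measure (EdgeConfig d)} [IsProbabilityMeasure μ] (hμ : IsGradientGibbs V μ)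
    (Λ : Finset (Site d)) {F : EdgeConfig d → ℝ≥0∞} (hF : Measurable F) :
    ∫⁻ η, F η ∂μ = ∫⁻ η, (fiberIntegral Λ (gibbsWeight V Λ) η)⁻¹ *
      fiberIntegral Λ (fun η' => gibbsWeight V Λ η' * F η') η ∂μ := by
  have h1 : ∫⁻ η, F η ∂μ = ∫⁻ η, ∫⁻ η', F η' ∂condExpKernel μ (exterior Λ) η ∂μ := by
    conv_lhs => rw [← condExpKernel_comp_trim (μ := μ) (exterior_le Λ)]
    rw [Measure.lintegral_bind (Kernel.aemeasurable _) hF.aemeasurable, lintegral_trim]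
    exact hF.lintegral_kernel
  rw [h1]
  refine lintegral_congr_ae ?_
  filter_upwards [hμ.dlr Λ] with η hη
  rw [hη, lintegral_specification hV Λ η hF]

/-- The Gaussian weight with conductances `κ`. -/
def gaussWeight (κ : EdgeConfig d) (Λ : Finset (Site d)) (η : EdgeConfig d) : ℝ≥0∞ :=
  ENNReal.ofReal (Real.exp (-(1 / 2) * ∑ e ∈ edgesTouching Λ, κ e * η e ^ 2))

theorem measurable_gaussWeight {Ω : Type*} [MeasurableSpace Ω] (Λ : Finset (Site d))
    {κ η : Ω → EdgeConfig d} (hκ : Measurable κ) (hη : Measurable η) :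
    Measurable fun ω => gaussWeight (κ ω) Λ (η ω) := by
  have h1 := fun e => (measurable_pi_apply e).comp hκ
  have h2 := fun e => (measurable_pi_apply e).comp hη
  refine ENNReal.measurable_ofReal.comp (Real.measurable_exp.comp (Measurable.const_mul ?_ _))
  exact Finset.measurable_fun_sum _ fun e _ => (h1 e).mul ((h2 e).pow_const 2)

/-- The density of the conductances `k` on the edges in `S` given the gradients. -/
def conductanceDensity (ρ : Measure ℝ) (S : Finset (Edge d)) (k η : EdgeConfig d) : ℝ≥0∞ :=
  ∏ b ∈ S, ENNReal.ofReal (Real.exp (potential ρ (η b) - 1 / 2 * k b * η b ^ 2))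

theorem measurable_conductanceDensity {ρ : Measure ℝ} [IsFiniteMeasure ρ] {Ω : Type*}
    [MeasurableSpace Ω] (S : Finset (Edge d)) {k η : Ω → EdgeConfig d} (hk : Measurable k)
    (hη : Measurable η) : Measurable fun ω => conductanceDensity ρ S (k ω) (η ω) := by
  have h1 := fun e => (measurable_pi_apply e).comp hk
  have h2 := fun e => (measurable_pi_apply e).comp hη
  refine Finset.measurable_fun_prod _ fun b _ =>
    ENNReal.measurable_ofReal.comp (Real.measurable_exp.comp ?_)
  exact (measurable_potential.comp (h2 b)).sub (((h1 b).const_mul _).mul ((h2 b).pow_const 2))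

/-- The cancellation behind the whole argument: on edges touching Λ the potential disappears and a
Gaussian weight remains. The surviving conductance densities belong to edges that resampling in Λ
leaves untouched. -/
theorem gibbsWeight_mul_conductanceDensity (ρ : Measure ℝ) {Λ : Finset (Site d)}
    {S : Finset (Edge d)} (hS : edgesTouching Λ ⊆ S) (k η : EdgeConfig d) :
    gibbsWeight (potential ρ) Λ η * conductanceDensity ρ S k η =
      gaussWeight k Λ η * conductanceDensity ρ (S \ edgesTouching Λ) k η := by
  rw [conductanceDensity, ← Finset.prod_sdiff hS, mul_comm (∏ b ∈ S \ _, _), ← mul_assoc]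
  congr 1
  rw [← ENNReal.ofReal_prod_of_nonneg fun _ _ => (Real.exp_pos _).le, gibbsWeight, gaussWeight,
    ← ENNReal.ofReal_mul (Real.exp_pos _).le, ← Real.exp_sum, ← Real.exp_add]
  congr 2
  rw [Finset.sum_sub_distrib, Finset.mul_sum]
  rw [neg_add_eq_sub, sub_sub_cancel_left, ← Finset.sum_neg_distrib]
  exact Finset.sum_congr rfl fun _ _ => by ring

/-- The Gaussian specification with conductances `κ`. -/
def gaussAverage (κ : EdgeConfig d) (Λ : Finset (Site d)) (F : EdgeConfig d → ℝ≥0∞)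
    (η : EdgeConfig d) : ℝ≥0∞ :=
  (fiberIntegral Λ (gaussWeight κ Λ) η)⁻¹ * fiberIntegral Λ (fun η => gaussWeight κ Λ η * F η) η

theorem measurable_gaussAverage {Ω : Type*} [MeasurableSpace Ω] (Λ : Finset (Site d))
    {κ η : Ω → EdgeConfig d} (hκ : Measurable κ) (hη : Measurable η)
    {F : Ω → EdgeConfig d → ℝ≥0∞} (hF : Measurable (Function.uncurry F)) :
    Measurable fun ω => gaussAverage (κ ω) Λ (F ω) (η ω) := by
  have hw : Measurable (Function.uncurry fun (ω : Ω) η' => gaussWeight (κ ω) Λ η') :=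
    measurable_gaussWeight Λ (hκ.comp measurable_fst) measurable_snd
  exact (measurable_fiberIntegral Λ hw hη).inv.mul (measurable_fiberIntegral Λ
    (Ψ := fun ω η' => gaussWeight (κ ω) Λ η' * F ω η') (hw.mul hF) hη)

theorem IsGradientGibbs.lintegral_mul_conductanceDensity {ρ : Measure ℝ} [IsFiniteMeasure ρ]
    {μ : Measure (EdgeConfig d)} [IsProbabilityMeasure μ] (hμ : IsGradientGibbs (potential ρ) μ)
    {Λ : Finset (Site d)} {S : Finset (Edge d)} (hS : edgesTouching Λ ⊆ S) (k : EdgeConfig d)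
    {F : EdgeConfig d → ℝ≥0∞} (hF : Measurable F) :
    ∫⁻ η, F η * conductanceDensity ρ S k η ∂μ =
      ∫⁻ η, (fiberIntegral Λ (gibbsWeight (potential ρ) Λ) η)⁻¹ *
        (fiberIntegral Λ (fun η => gaussWeight k Λ η * F η) η *
          conductanceDensity ρ (S \ edgesTouching Λ) k η) ∂μ := by
  have hP : Measurable (conductanceDensity ρ S k) :=
    measurable_conductanceDensity S measurable_const measurable_id
  have hG : Measurable (gaussWeight k Λ) :=
    measurable_gaussWeight Λ measurable_const measurable_id
  rw [hμ.lintegral_eq measurable_potential Λ (F := fun η => F η * conductanceDensity ρ S k η)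
    (hF.mul hP)]
  refine lintegral_congr_ae ?_
  filter_upwards [hμ.loop] with η hη
  rw [← fiberIntegral_mul (Ψ := fun η => gaussWeight k Λ η * F η) (hG.mul hF) fun ψ => ?_]
  · congr 2
    ext η'
    rw [mul_left_comm, gibbsWeight_mul_conductanceDensity ρ hS]
    ring
  · refine Finset.prod_congr rfl fun b hb => ?_
    rw [grad_glue_height hη ψ (Finset.mem_sdiff.1 hb).2]

theorem gaussAverage_grad_glue (κ : EdgeConfig d) (Λ : Finset (Site d))
    (F : EdgeConfig d → ℝ≥0∞) (η : EdgeConfig d) (ψ : Λ → ℝ) :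
    gaussAverage κ Λ F (grad (glue Λ (height η) ψ)) = gaussAverage κ Λ F η := by
  rw [gaussAverage, fiberIntegral_grad_glue, fiberIntegral_grad_glue, gaussAverage]

/-- For frozen conductances k, μ weighted by the density of k is invariant under the Gaussian
specification. The average is constant on fibres, so it leaves the fibre integral, and its
denominator cancels against the integral of the Gaussian weight. -/
theorem IsGradientGibbs.lintegral_gaussAverage {ρ : Measure ℝ} [IsFiniteMeasure ρ]
    {μ : Measure (EdgeConfig d)} [IsProbabilityMeasure μ] (hμ : IsGradientGibbs (potential ρ) μ)
    {Λ : Finset (Site d)} {S : Finset (Edge d)} (hS : edgesTouching Λ ⊆ S) (k : EdgeConfig d)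
    (h0 : ∀ η, fiberIntegral Λ (gaussWeight k Λ) η ≠ 0)
    (h1 : ∀ η, fiberIntegral Λ (gaussWeight k Λ) η ≠ ∞)
    {F : EdgeConfig d → ℝ≥0∞} (hF : Measurable F) :
    ∫⁻ η, gaussAverage k Λ F η * conductanceDensity ρ S k η ∂μ =
      ∫⁻ η, F η * conductanceDensity ρ S k η ∂μ := by
  have hG : Measurable (gaussWeight k Λ) :=
    measurable_gaussWeight Λ measurable_const measurable_id
  have hm : Measurable (gaussAverage k Λ F) :=
    measurable_gaussAverage Λ measurable_const measurable_id (F := fun _ => F)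
      (hF.comp measurable_snd)
  rw [hμ.lintegral_mul_conductanceDensity hS k hF, hμ.lintegral_mul_conductanceDensity hS k hm]
  refine lintegral_congr fun η => ?_
  rw [fiberIntegral_mul hG fun ψ => gaussAverage_grad_glue k Λ F η ψ, gaussAverage,
    ENNReal.mul_inv_cancel_left (h0 η) (h1 η)]

/-! ### The Gaussian field with zero boundary conditions -/

/-- The unnormalized density of the Gaussian field in `Λ` with zero boundary conditions. -/
def fieldWeight (κ : EdgeConfig d) (Λ : Finset (Site d)) (ψ : Λ → ℝ) : ℝ :=
  Real.exp (-(1 / 2) * dirichletEnergy κ Λ (extend Λ ψ))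

theorem measurable_fieldWeight {Ω : Type*} [MeasurableSpace Ω] (Λ : Finset (Site d))
    {κ : Ω → EdgeConfig d} {ψ : Ω → Λ → ℝ} (hκ : Measurable κ) (hψ : Measurable ψ) :
    Measurable fun ω => fieldWeight (κ ω) Λ (ψ ω) := by
  have h1 := fun e => (measurable_pi_apply e).comp hκ
  have h2 := fun e => (measurable_pi_apply e).comp
    (measurable_grad.comp (measurable_glue (Λ := Λ) (measurable_const (a := (0 : Site d → ℝ))) hψ))
  refine Real.measurable_exp.comp (Measurable.const_mul ?_ _)
  exact Finset.measurable_fun_sum _ fun e _ => (h1 e).mul ((h2 e).pow_const 2)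

theorem measurable_ofReal_fieldWeight (κ : EdgeConfig d) (Λ : Finset (Site d)) :
    Measurable fun ψ : Λ → ℝ => ENNReal.ofReal (fieldWeight κ Λ ψ) :=
  (measurable_fieldWeight Λ measurable_const measurable_id).ennreal_ofReal

theorem continuous_dirichletEnergy_extend (κ : EdgeConfig d) (Λ : Finset (Site d)) :
    Continuous fun ψ : Λ → ℝ => dirichletEnergy κ Λ (extend Λ ψ) := by
  have h : ∀ x : Site d, Continuous fun ψ : Λ → ℝ => extend Λ ψ x := fun x => by
    by_cases hx : x ∈ Λ
    · simp only [extend_of_mem _ hx]; fun_prop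
    · simp only [extend_of_notMem _ hx]; fun_prop
  unfold dirichletEnergy grad
  exact continuous_finsetSum _ fun e _ => continuous_const.mul (((h _).sub (h _)).pow 2)

theorem dirichletEnergy_smul (κ : EdgeConfig d) (Λ : Finset (Site d)) (c : ℝ) (φ : Site d → ℝ) :
    dirichletEnergy κ Λ (c • φ) = c ^ 2 * dirichletEnergy κ Λ φ := by
  rw [dirichletEnergy, dirichletEnergy, Finset.mul_sum]
  refine Finset.sum_congr rfl fun e _ => ?_
  simp only [grad, Pi.smul_apply, smul_eq_mul]
  ring

theorem dirichletEnergy_extend_pos (hd : 0 < d) {κ : EdgeConfig d} (hκ : ∀ e, 0 < κ e)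
    {Λ : Finset (Site d)} {ψ : Λ → ℝ} (hψ : ψ ≠ 0) : 0 < dirichletEnergy κ Λ (extend Λ ψ) := by
  refine (dirichletEnergy_nonneg hκ Λ _).lt_of_ne' fun h => hψ ?_
  rw [dirichletEnergy, Finset.sum_eq_zero_iff_of_nonneg fun e _ =>
    mul_nonneg (hκ e).le (sq_nonneg _)] at h
  have h1 := extend_eq_zero_of_grad hd (fun x hx => extend_of_notMem ψ hx) fun e he => by
    simpa [(hκ e).ne'] using h e he
  ext x
  have h2 := congrFun h1 x
  rwa [extend_of_mem _ x.2] at h2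

/-- The energy is positive and continuous on the compact unit sphere and homogeneous of degree two.
The coercivity makes the Gaussian weight integrable. -/
theorem exists_le_dirichletEnergy (hd : 0 < d) {κ : EdgeConfig d} (hκ : ∀ e, 0 < κ e)
    (Λ : Finset (Site d)) :
    ∃ c > 0, ∀ ψ : Λ → ℝ, c * ‖ψ‖ ^ 2 ≤ dirichletEnergy κ Λ (extend Λ ψ) := by
  -- The sphere is empty when Λ is empty; zero is then the only vector and any constant works.
  obtain h | h := (Metric.sphere (0 : Λ → ℝ) 1).eq_empty_or_nonempty
  · refine ⟨1, one_pos, fun ψ => ?_⟩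
    have : ψ = 0 := by
      by_contra hψ
      have : (‖ψ‖⁻¹ • ψ) ∈ Metric.sphere (0 : Λ → ℝ) 1 := by
        simp [norm_smul, norm_ne_zero_iff.2 hψ]
      simp [h] at this
    subst this
    simpa using dirichletEnergy_nonneg hκ Λ _
  · obtain ⟨ψ₀, h0, hmin⟩ := (isCompact_sphere (0 : Λ → ℝ) 1).exists_isMinOn h
      (continuous_dirichletEnergy_extend κ Λ).continuousOn
    refine ⟨_, dirichletEnergy_extend_pos hd hκ (ψ := ψ₀) ?_, fun ψ => ?_⟩
    · rintro rfl
      simp at h0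
    by_cases hψ : ψ = 0
    · subst hψ
      simpa using dirichletEnergy_nonneg hκ Λ _
    have hn := norm_ne_zero_iff.2 hψ
    have h1 := hmin (show ‖ψ‖⁻¹ • ψ ∈ Metric.sphere (0 : Λ → ℝ) 1 by simp [norm_smul, hn])
    simp only [Set.mem_ofPred_eq, extend_smul, dirichletEnergy_smul] at h1
    rw [inv_pow, inv_mul_eq_div, le_div_iff₀ (by positivity)] at h1
    exact h1

theorem integrable_fieldWeight (hd : 0 < d) {κ : EdgeConfig d} (hκ : ∀ e, 0 < κ e)
    (Λ : Finset (Site d)) : Integrable (fieldWeight κ Λ) := by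
  obtain ⟨c, hc, h⟩ := exists_le_dirichletEnergy hd hκ Λ
  -- Compares the Euclidean with the supremum norm; the additional 1 keeps N positive for empty Λ.
  set N : ℝ := Λ.card + 1
  have hN : 0 < N := by positivity
  have hintg : Integrable fun ψ : Λ → ℝ => ∏ x : Λ, Real.exp (-(c / (2 * N)) * ψ x ^ 2) :=
    Integrable.fintype_prod fun _ => integrable_exp_neg_mul_sq (by positivity)
  refine hintg.mono' (measurable_fieldWeight Λ measurable_const
    measurable_id).aestronglyMeasurable (.of_forall fun ψ => ?_)
  rw [fieldWeight, Real.norm_eq_abs, abs_of_pos (Real.exp_pos _), ← Real.exp_sum,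
    Real.exp_le_exp, ← Finset.mul_sum]
  have h1 : ∑ x : Λ, ψ x ^ 2 ≤ N * ‖ψ‖ ^ 2 := by
    refine (Finset.sum_le_card_nsmul _ _ (‖ψ‖ ^ 2) fun x _ => ?_).trans ?_
    · rw [← sq_abs]
      exact pow_le_pow_left₀ (abs_nonneg _) (norm_le_pi_norm ψ x) 2
    · rw [nsmul_eq_mul]
      gcongr
      simp [N]
  have h2 : c / (2 * N) * ∑ x : Λ, ψ x ^ 2 ≤ 1 / 2 * dirichletEnergy κ Λ (extend Λ ψ) :=
    calc c / (2 * N) * ∑ x : Λ, ψ x ^ 2 ≤ c / (2 * N) * (N * ‖ψ‖ ^ 2) := by gcongr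
      _ = 1 / 2 * (c * ‖ψ‖ ^ 2) := by field_simp
      _ ≤ _ := by gcongr; exact h ψ
  linarith

/-- The normalizing constant of the Gaussian field. -/
def fieldPartition (κ : EdgeConfig d) (Λ : Finset (Site d)) : ℝ≥0∞ :=
  ∫⁻ ψ : Λ → ℝ, ENNReal.ofReal (fieldWeight κ Λ ψ)

theorem fieldPartition_ne_top (hd : 0 < d) {κ : EdgeConfig d} (hκ : ∀ e, 0 < κ e)
    (Λ : Finset (Site d)) : fieldPartition κ Λ ≠ ∞ := by
  have := (integrable_fieldWeight hd hκ Λ).lintegral_lt_top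
  exact this.ne

theorem fieldPartition_ne_zero (κ : EdgeConfig d) (Λ : Finset (Site d)) :
    fieldPartition κ Λ ≠ 0 := by
  rw [fieldPartition, Ne, lintegral_eq_zero_iff (measurable_ofReal_fieldWeight κ Λ)]
  intro h
  have : ∀ᵐ _ : Λ → ℝ, False := by
    filter_upwards [h] with ψ hψ
    exact (Real.exp_pos _).not_ge (ENNReal.ofReal_eq_zero.1 hψ)
  obtain ⟨_, h⟩ := this.exists
  exact h

/-- The density of the Gaussian field in `Λ` with zero boundary conditions. -/
def fieldDensity (κ : EdgeConfig d) (Λ : Finset (Site d)) (ψ : Λ → ℝ) : ℝ≥0∞ :=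
  (fieldPartition κ Λ)⁻¹ * ENNReal.ofReal (fieldWeight κ Λ ψ)

theorem measurable_fieldDensity {Ω : Type*} [MeasurableSpace Ω] (Λ : Finset (Site d))
    {κ : Ω → EdgeConfig d} {ψ : Ω → Λ → ℝ} (hκ : Measurable κ) (hψ : Measurable ψ) :
    Measurable fun ω => fieldDensity (κ ω) Λ (ψ ω) := by
  refine Measurable.mul (Measurable.inv ?_) (measurable_fieldWeight Λ hκ hψ).ennreal_ofReal
  exact Measurable.lintegral_prod_right' (f := fun p : Ω × (Λ → ℝ) =>
    ENNReal.ofReal (fieldWeight (κ p.1) Λ p.2))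
    (measurable_fieldWeight Λ (hκ.comp measurable_fst) measurable_snd).ennreal_ofReal

theorem lintegral_fieldDensity (hd : 0 < d) {κ : EdgeConfig d} (hκ : ∀ e, 0 < κ e)
    (Λ : Finset (Site d)) : ∫⁻ ψ, fieldDensity κ Λ ψ = 1 := by
  unfold fieldDensity
  rw [lintegral_const_mul _ (measurable_ofReal_fieldWeight κ Λ)]
  exact ENNReal.inv_mul_cancel (fieldPartition_ne_zero κ Λ) (fieldPartition_ne_top hd hκ Λ)

theorem fieldDensity_neg (κ : EdgeConfig d) (Λ : Finset (Site d)) (ψ : Λ → ℝ) :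
    fieldDensity κ Λ (-ψ) = fieldDensity κ Λ ψ := by
  rw [fieldDensity, fieldDensity, fieldWeight, fieldWeight, extend_neg,
    ← neg_one_smul ℝ (extend Λ ψ), dirichletEnergy_smul]
  norm_num

theorem glue_eq_harmonicExt_add (κ : EdgeConfig d) (Λ : Finset (Site d)) (φ : Site d → ℝ)
    (ψ : Λ → ℝ) :
    glue Λ φ (ψ + fun x : Λ => harmonicExt κ Λ φ x) = harmonicExt κ Λ φ + extend Λ ψ := by
  ext x
  by_cases hx : x ∈ Λ
  · simp [glue, hx, add_comm]
  · simp [glue, hx, harmonicExt_of_notMem κ φ hx]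

theorem gaussWeight_harmonicExt_add (hd : 0 < d) {κ : EdgeConfig d} (hκ : ∀ e, 0 < κ e)
    (Λ : Finset (Site d)) (φ : Site d → ℝ) (ψ : Λ → ℝ) :
    gaussWeight κ Λ (grad (harmonicExt κ Λ φ + extend Λ ψ)) =
      gaussWeight κ Λ (grad (harmonicExt κ Λ φ)) * ENNReal.ofReal (fieldWeight κ Λ ψ) := by
  have h := dirichletEnergy_add_of_harmonic (κ := κ) (Λ := Λ)
    (fun x hx => generator_harmonicExt hd hκ φ hx) fun x hx => extend_of_notMem ψ hx
  unfold dirichletEnergy at h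
  rw [gaussWeight, gaussWeight, h, fieldWeight, ← ENNReal.ofReal_mul (Real.exp_pos _).le,
    ← Real.exp_add, mul_add]
  rfl

theorem fiberIntegral_gaussWeight_mul (hd : 0 < d) {κ : EdgeConfig d} (hκ : ∀ e, 0 < κ e)
    (Λ : Finset (Site d)) {F : EdgeConfig d → ℝ≥0∞} (hF : Measurable F) (η : EdgeConfig d) :
    fiberIntegral Λ (fun η => gaussWeight κ Λ η * F η) η =
      gaussWeight κ Λ (grad (harmonicExt κ Λ (height η))) *
        ∫⁻ ψ, ENNReal.ofReal (fieldWeight κ Λ ψ) *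
          F (grad (harmonicExt κ Λ (height η) + extend Λ ψ)) := by
  rw [fiberIntegral, ← lintegral_add_right_eq_self _ fun x : Λ => harmonicExt κ Λ (height η) x]
  simp only [glue_eq_harmonicExt_add, gaussWeight_harmonicExt_add hd hκ, mul_assoc]
  refine lintegral_const_mul _ ((measurable_ofReal_fieldWeight κ Λ).mul (hF.comp (measurable_grad.comp (measurable_const.add
      (measurable_glue measurable_const measurable_id)))))

/-- After translating the integration variable by the harmonic extension, the weight splits into a
factor depending on the boundary, which cancels in the normalization, and the weight of the
zero-boundary field, whose law depends on κ alone. -/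
theorem gaussAverage_eq (hd : 0 < d) {κ : EdgeConfig d} (hκ : ∀ e, 0 < κ e)
    (Λ : Finset (Site d)) {F : EdgeConfig d → ℝ≥0∞} (hF : Measurable F) (η : EdgeConfig d) :
    gaussAverage κ Λ F η = ∫⁻ ψ, fieldDensity κ Λ ψ *
      F (grad (harmonicExt κ Λ (height η) + extend Λ ψ)) := by
  have h1 := fiberIntegral_gaussWeight_mul hd hκ Λ (F := fun _ => 1) measurable_const η
  simp only [mul_one] at h1
  have hw0 : gaussWeight κ Λ (grad (harmonicExt κ Λ (height η))) ≠ 0 := by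
    simp [gaussWeight, Real.exp_pos]
  have hwt : gaussWeight κ Λ (grad (harmonicExt κ Λ (height η))) ≠ ∞ := ENNReal.ofReal_ne_top
  rw [gaussAverage, h1, fiberIntegral_gaussWeight_mul hd hκ Λ hF,
    ENNReal.mul_inv (.inl hw0) (.inl hwt), mul_mul_mul_comm, ENNReal.inv_mul_cancel hw0 hwt,
    one_mul]
  simp only [fieldDensity, mul_assoc]
  rw [lintegral_const_mul]
  · rfl
  · exact (measurable_ofReal_fieldWeight κ Λ).mul (hF.comp (measurable_grad.comp (measurable_const.add
        (measurable_glue measurable_const measurable_id))))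

theorem fiberIntegral_gaussWeight_ne (hd : 0 < d) {κ : EdgeConfig d} (hκ : ∀ e, 0 < κ e)
    (Λ : Finset (Site d)) (η : EdgeConfig d) : fiberIntegral Λ (gaussWeight κ Λ) η ≠ 0 ∧
      fiberIntegral Λ (gaussWeight κ Λ) η ≠ ∞ := by
  have h1 := fiberIntegral_gaussWeight_mul hd hκ Λ (F := fun _ => 1) measurable_const η
  simp only [mul_one] at h1
  rw [h1]
  exact ⟨mul_ne_zero (by simp [gaussWeight, Real.exp_pos]) (fieldPartition_ne_zero κ Λ),
    ENNReal.mul_ne_top ENNReal.ofReal_ne_top (fieldPartition_ne_top hd hκ Λ)⟩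

/-- The law of the Gaussian field in `Λ` with zero boundary conditions. -/
def fieldLaw (κ : EdgeConfig d) (Λ : Finset (Site d)) : Measure (Λ → ℝ) :=
  volume.withDensity (fieldDensity κ Λ)

theorem isProbabilityMeasure_fieldLaw (hd : 0 < d) {κ : EdgeConfig d} (hκ : ∀ e, 0 < κ e)
    (Λ : Finset (Site d)) : IsProbabilityMeasure (fieldLaw κ Λ) := by
  constructor
  rw [fieldLaw, withDensity_apply _ .univ, Measure.restrict_univ, lintegral_fieldDensity hd hκ]

/-- The exponential moments of the Gaussian field. -/
theorem lintegral_exp_fieldLaw (hd : 0 < d) {κ : EdgeConfig d} (hκ : ∀ e, 0 < κ e)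
    {Λ : Finset (Site d)} (r : Site d → ℝ) :
    ∫⁻ ψ, ENNReal.ofReal (Real.exp (∑ x ∈ Λ, extend Λ ψ x * r x)) ∂fieldLaw κ Λ =
      ENNReal.ofReal (Real.exp ((1 / 2) * ∑ x ∈ Λ, dirichletSolve κ Λ r x * r x)) := by
  have hm : Measurable (fieldDensity κ Λ) :=
    measurable_fieldDensity Λ measurable_const measurable_id
  have hme : ∀ x, Measurable fun ψ : Λ → ℝ => extend Λ ψ x := fun x =>
    (measurable_pi_apply x).comp (measurable_glue measurable_const measurable_id)
  have hm2 : Measurable fun ψ : Λ → ℝ =>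
      ENNReal.ofReal (Real.exp (∑ x ∈ Λ, extend Λ ψ x * r x)) := by fun_prop
  rw [fieldLaw, lintegral_withDensity_eq_lintegral_mul _ hm hm2]
  set u : Λ → ℝ := (dirichletMatrix κ Λ)⁻¹.mulVec fun x => r x with hu
  have hsol : dirichletSolve κ Λ r = extend Λ u := rfl
  have hL : ∀ x ∈ Λ, -generator κ (extend Λ u) x = r x := fun x hx =>
    neg_generator_dirichletSolve hd hκ r hx
  -- Completing the square: the field is translated by the Dirichlet solution u for the right-hand
  -- side r, so the linear term cancels against the cross term of the energy.
  rw [← lintegral_add_right_eq_self _ u, ← mul_one (ENNReal.ofReal _), ← lintegral_fieldDensity hd hκ Λ,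
    ← lintegral_const_mul _ hm]
  refine lintegral_congr fun ψ => ?_
  simp only [Pi.mul_apply, fieldDensity]
  rw [mul_assoc, mul_left_comm (ENNReal.ofReal (Real.exp (1 / 2 * _)))]
  congr 1
  rw [fieldWeight, fieldWeight, ← ENNReal.ofReal_mul (Real.exp_pos _).le,
    ← ENNReal.ofReal_mul (Real.exp_pos _).le, ← Real.exp_add, ← Real.exp_add]
  congr 2
  have e1 := dirichletEnergy_add κ (extend Λ u) (fun x hx => extend_of_notMem ψ hx)
  have e2 := dirichletEnergy_eq_sum κ (fun x hx => extend_of_notMem u hx)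
  rw [Finset.sum_congr rfl fun x hx => by rw [hL x hx]] at e1 e2
  rw [extend_add, add_comm (extend Λ ψ), e1, e2, hsol]
  simp only [Pi.add_apply, add_mul, Finset.sum_add_distrib]
  ring

theorem sum_dirichletSolve_mul_nonneg (hd : 0 < d) {κ : EdgeConfig d} (hκ : ∀ e, 0 < κ e)
    (Λ : Finset (Site d)) (r : Site d → ℝ) : 0 ≤ ∑ x ∈ Λ, dirichletSolve κ Λ r x * r x := by
  have h1 := dirichletEnergy_eq_sum κ (fun x hx => dirichletSolve_of_notMem κ (Λ := Λ) r hx)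
  rw [Finset.sum_congr rfl fun x hx => by rw [neg_generator_dirichletSolve hd hκ r hx]] at h1
  rw [← h1]
  exact dirichletEnergy_nonneg hκ _ _

/-- A linear functional of the Gaussian field has a normal law. -/
theorem map_fieldLaw (hd : 0 < d) {κ : EdgeConfig d} (hκ : ∀ e, 0 < κ e)
    (Λ : Finset (Site d)) (r : Site d → ℝ) :
    (fieldLaw κ Λ).map (fun ψ => ∑ x ∈ Λ, extend Λ ψ x * r x) =
      gaussianReal 0 (∑ x ∈ Λ, dirichletSolve κ Λ r x * r x).toNNReal := by
  have := isProbabilityMeasure_fieldLaw hd hκ Λ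
  have hme : ∀ x, Measurable fun ψ : Λ → ℝ => extend Λ ψ x := fun x =>
    (measurable_pi_apply x).comp (measurable_glue measurable_const measurable_id)
  set X : (Λ → ℝ) → ℝ := fun ψ => ∑ x ∈ Λ, extend Λ ψ x * r x
  have hX : Measurable X := by fun_prop
  set s : ℝ := ∑ x ∈ Λ, dirichletSolve κ Λ r x * r x with hs
  have hs0 : 0 ≤ s := sum_dirichletSolve_mul_nonneg hd hκ Λ r
  have hl : ∀ t : ℝ, ∫⁻ ψ, ENNReal.ofReal (Real.exp (t * X ψ)) ∂fieldLaw κ Λ =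
      ENNReal.ofReal (Real.exp (t ^ 2 * s / 2)) := fun t => by
    have h1 := lintegral_exp_fieldLaw hd hκ (Λ := Λ) (t • r)
    have h2 : dirichletSolve κ Λ (t • r) = t • dirichletSolve κ Λ r := by
      rw [dirichletSolve, dirichletSolve, ← extend_smul, ← Matrix.mulVec_smul]
      rfl
    have e1 : ∀ ψ, ∑ x ∈ Λ, extend Λ ψ x * (t • r) x = t * X ψ := fun ψ => by
      simp only [X, Finset.mul_sum, Pi.smul_apply, smul_eq_mul]
      exact Finset.sum_congr rfl fun x _ => by ring
    have e2 : 1 / 2 * ∑ x ∈ Λ, dirichletSolve κ Λ (t • r) x * (t • r) x = t ^ 2 * s / 2 := by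
      simp only [h2, hs, Finset.mul_sum, Finset.sum_div, Pi.smul_apply, smul_eq_mul]
      exact Finset.sum_congr rfl fun x _ => by ring
    rw [e2] at h1
    simpa only [e1] using h1
  have hintg : ∀ t : ℝ, Integrable (fun ψ => Real.exp (t * X ψ)) (fieldLaw κ Λ) := fun t =>
    ⟨by fun_prop, by
      rw [hasFiniteIntegral_iff_ofReal (.of_forall fun _ => (Real.exp_pos _).le), hl]
      exact ENNReal.ofReal_lt_top⟩
  -- All exponential moments are finite, so equality of the real moment generating functions extends
  -- analytically to the complex plane and determines the law.
  have hmgf : mgf X (fieldLaw κ Λ) = mgf id (gaussianReal 0 s.toNNReal) := by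
    ext t
    rw [mgf_id_gaussianReal, mgf, integral_eq_lintegral_of_nonneg_ae
      (.of_forall fun _ => (Real.exp_pos _).le) (by fun_prop), hl,
      ENNReal.toReal_ofReal (Real.exp_pos _).le, Real.coe_toNNReal _ hs0]
    congr 1; ring
  have h := eqOn_complexMGF_of_mgf hmgf
  have hset : integrableExpSet X (fieldLaw κ Λ) = Set.univ :=
    Set.eq_univ_of_forall fun t => hintg t
  rw [hset, interior_univ] at h
  have := Measure.ext_of_complexMGF_eq hX.aemeasurable aemeasurable_id
    (funext fun z => h (Set.mem_univ _))
  simpa using this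

/-! ### The extension -/

/-- Extension of conductances on `S` to all edges. -/
def fill (S : Finset (Edge d)) (k : S → ℝ) : EdgeConfig d :=
  -- The default value 1 is positive, so a filled configuration has positive conductances everywhere
  -- and the Gaussian computations apply to it.
  fun e => if h : e ∈ S then k ⟨e, h⟩ else 1

theorem fill_of_mem {S : Finset (Edge d)} (k : S → ℝ) {e : Edge d} (he : e ∈ S) :
    fill S k e = k ⟨e, he⟩ := by simp [fill, he]

theorem measurable_fill (S : Finset (Edge d)) : Measurable (fill S) := by
  refine measurable_pi_lambda _ fun e => ?_
  by_cases he : e ∈ S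
  · simp only [fill, he, dite_true]; fun_prop
  · simp only [fill, he, dite_false]; fun_prop

theorem conductanceDensity_fill (ρ : Measure ℝ) (S : Finset (Edge d)) (k : S → ℝ)
    (η : EdgeConfig d) : conductanceDensity ρ S (fill S k) η =
      ∏ b : S, ENNReal.ofReal (Real.exp (potential ρ (η b) - 1 / 2 * k b * η b ^ 2)) := by
  rw [conductanceDensity, ← Finset.prod_coe_sort]
  exact Finset.prod_congr rfl fun b _ => by rw [fill_of_mem k b.2]

theorem ae_pi_mem {ρ : Measure ℝ} [IsFiniteMeasure ρ] {K : Set ℝ} (hK : ρ Kᶜ = 0) {ι : Type*}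
    [Fintype ι] : ∀ᵐ k ∂(Measure.pi fun _ : ι => ρ), ∀ b, k b ∈ K := by
  rw [ae_all_iff]
  exact fun b => (Measure.tendsto_eval_ae_ae (i := b) (μ := fun _ : ι => ρ)).eventually
    (p := fun x => x ∈ K) (by rw [ae_iff]; exact hK)

theorem IsExtension.ae_mem {ρ : Measure ℝ} [IsFiniteMeasure ρ] {μ : Measure (EdgeConfig d)}
    {μ' : Measure (EdgeConfig d × EdgeConfig d)} (h : IsExtension ρ μ μ') {K : Set ℝ} (hKm : MeasurableSet K)
    (hK : ρ Kᶜ = 0) : ∀ᵐ p ∂μ', ∀ b, p.2 b ∈ K := by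
  rw [ae_all_iff]
  intro b
  let B : Set (({b} : Finset (Edge d)) → ℝ) := {k | k ⟨b, Finset.mem_singleton_self b⟩ ∈ Kᶜ}
  have hB : MeasurableSet B := measurable_pi_apply _ hKm.compl
  have h1 := h {b} Set.univ B .univ hB
  have h2 : (Measure.pi fun _ : ({b} : Finset (Edge d)) => ρ) B = 0 := by
    have := ae_pi_mem hK (ι := ({b} : Finset (Edge d)))
    rw [ae_iff] at this
    refine measure_mono_null (fun k hk => ?_) this
    exact fun hall => hk (hall _)
  rw [Measure.restrict_eq_zero.2 h2, lintegral_zero_measure] at h1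
  rw [ae_iff]
  refine measure_mono_null (fun p hp => ?_) h1
  exact ⟨Set.mem_univ _, hp⟩

theorem IsExtension.map_fst {ρ : Measure ℝ} [IsFiniteMeasure ρ] {μ : Measure (EdgeConfig d)}
    {μ' : Measure (EdgeConfig d × EdgeConfig d)} (h : IsExtension ρ μ μ') : μ'.map Prod.fst = μ := by
  ext A hA
  rw [Measure.map_apply measurable_fst hA]
  have h1 := h ∅ A Set.univ hA .univ
  simp only [Set.mem_univ, and_true, Measure.restrict_univ, Finset.univ_eq_empty,
    Finset.prod_empty, lintegral_const, Measure.pi_univ, mul_one] at h1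
  rwa [one_mul, Measure.restrict_apply_univ] at h1

section

variable {ρ : Measure ℝ} [IsFiniteMeasure ρ] {μ : Measure (EdgeConfig d)} [IsProbabilityMeasure μ]
  {μ' : Measure (EdgeConfig d × EdgeConfig d)} [IsProbabilityMeasure μ']

theorem IsExtension.map_restrict (h : IsExtension ρ μ μ') (S : Finset (Edge d)) :
    μ'.map (fun p => (p.1, S.restrict p.2)) = (μ.prod (Measure.pi fun _ : S => ρ)).withDensity
      fun q => conductanceDensity ρ S (fill S q.2) q.1 := by
  have hm : Measurable fun p : EdgeConfig d × EdgeConfig d => (p.1, S.restrict p.2) :=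
    measurable_fst.prodMk ((Finset.measurable_restrict S).comp measurable_snd)
  have := Measure.isProbabilityMeasure_map (μ := μ') hm.aemeasurable
  have hD : Measurable fun q : EdgeConfig d × (S → ℝ) =>
      conductanceDensity ρ S (fill S q.2) q.1 :=
    measurable_conductanceDensity S ((measurable_fill S).comp measurable_snd) measurable_fst
  refine Measure.ext_prod fun {A B} hA hB => ?_
  rw [Measure.map_apply hm (hA.prod hB), withDensity_apply _ (hA.prod hB),
    ← Measure.prod_restrict, lintegral_prod_symm _ hD.aemeasurable]
  simp only [conductanceDensity_fill]
  exact h S A B hA hB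

theorem IsExtension.lintegral_restrict (h : IsExtension ρ μ μ') (S : Finset (Edge d))
    {Φ : EdgeConfig d → (S → ℝ) → ℝ≥0∞} (hΦ : Measurable (Function.uncurry Φ)) :
    ∫⁻ p, Φ p.1 (S.restrict p.2) ∂μ' =
      ∫⁻ k, ∫⁻ η, Φ η k * conductanceDensity ρ S (fill S k) η ∂μ ∂(Measure.pi fun _ : S => ρ) := by
  have hm : Measurable fun p : EdgeConfig d × EdgeConfig d => (p.1, S.restrict p.2) :=
    measurable_fst.prodMk ((Finset.measurable_restrict S).comp measurable_snd)
  have hD : Measurable fun q : EdgeConfig d × (S → ℝ) =>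
      conductanceDensity ρ S (fill S q.2) q.1 :=
    measurable_conductanceDensity S ((measurable_fill S).comp measurable_snd) measurable_fst
  have h1 := lintegral_map (μ := μ') hΦ hm
  rw [h.map_restrict S, lintegral_withDensity_eq_lintegral_mul _ hD hΦ,
    lintegral_prod_symm _ (hD.mul hΦ).aemeasurable] at h1
  refine h1.symm.trans (lintegral_congr fun k => lintegral_congr fun η => ?_)
  exact mul_comm _ _

/-- The extension of a translation invariant measure is translation invariant. -/
theorem IsExtension.map_shift (h : IsExtension ρ μ μ') (hinv : IsTranslationInvariant μ)
    (x : Site d) : μ'.map (Prod.map (shift x) (shift x)) = μ' := by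
  have hsm := measurable_shift (d := d) x
  have hm : Measurable (Prod.map (shift (d := d) x) (shift x)) := hsm.prodMap hsm
  have := Measure.isProbabilityMeasure_map (μ := μ') hm.aemeasurable
  -- By uniqueness it suffices that the shifted law is again an extension of μ. This follows by
  -- relabelling the edges of S as their translates and using invariance of μ and of the product of
  -- copies of ϱ.
  refine IsExtension.unique (ρ := ρ) (μ := μ) (fun S A B hA hB => ?_) h
  let e : Edge d ≃ Edge d := (Equiv.addRight x).prodCongr (Equiv.refl _)
  let S' : Finset (Edge d) := S.map e.toEmbedding
  let r : S ≃ S' := e.subtypeEquiv fun b => by simp [S']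
  let R : (S' → ℝ) → (S → ℝ) := fun k b => k (r b)
  have hR : Measurable R := measurable_pi_lambda _ fun b => measurable_pi_apply _
  have hRmap : (Measure.pi fun _ : S' => ρ).map R = Measure.pi fun _ : S => ρ := by
    refine (Measure.pi_eq fun s hs => ?_).symm
    rw [Measure.map_apply hR (.univ_pi hs)]
    have : R ⁻¹' Set.univ.pi s = Set.univ.pi fun b => s (r.symm b) := by
      ext k
      simp only [Set.mem_preimage, Set.mem_univ_pi, R]
      exact ⟨fun hk b => by simpa using hk (r.symm b), fun hk b => by simpa using hk (r b)⟩
    rw [this, Measure.pi_pi]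
    exact Fintype.prod_equiv r.symm _ _ fun _ => rfl
  have h1 := h S' (shift x ⁻¹' A) (R ⁻¹' B) (hsm hA) (hR hB)
  have hset : MeasurableSet {p : EdgeConfig d × EdgeConfig d | p.1 ∈ A ∧ S.restrict p.2 ∈ B} :=
    (measurable_fst hA).inter (((Finset.measurable_restrict S).comp measurable_snd) hB)
  rw [Measure.map_apply hm hset]
  refine Eq.trans h1 ?_
  have hD : ∀ k : S → ℝ, Measurable fun η : EdgeConfig d => ∏ b : S, ENNReal.ofReal
      (Real.exp (potential ρ (η b) - 1 / 2 * k b * η b ^ 2)) := fun k => by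
    have := measurable_potential (ρ := ρ)
    fun_prop
  have hD2 : Measurable fun k : S → ℝ => ∫⁻ η in A, ∏ b : S, ENNReal.ofReal
      (Real.exp (potential ρ (η b) - 1 / 2 * k b * η b ^ 2)) ∂μ := by
    have := measurable_potential (ρ := ρ)
    exact Measurable.lintegral_prod_right' (f := fun p : (S → ℝ) × EdgeConfig d =>
      ∏ b : S, ENNReal.ofReal (Real.exp (potential ρ (p.2 b) - 1 / 2 * p.1 b * p.2 b ^ 2)))
      (by fun_prop)
  rw [← hRmap, setLIntegral_map hB hD2 hR]
  refine setLIntegral_congr_fun (hR hB) fun k _ => ?_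
  conv_rhs => rw [← hinv x, setLIntegral_map hA (hD _) hsm]
  refine lintegral_congr fun η => ?_
  exact (Fintype.prod_equiv r _ _ fun b => rfl).symm

end

/-! ### Resampling under the extension -/

/-- Cramer's rule expresses the inverse through determinants, which are polynomials in the entries.
This gives joint measurability of harmonic extensions in conductances and heights. -/
theorem measurable_matrix_inv {Ω ι : Type*} [MeasurableSpace Ω] [Fintype ι] [DecidableEq ι]
    {A : Ω → Matrix ι ι ℝ} (hA : ∀ i j, Measurable fun ω => A ω i j) (i j : ι) :
    Measurable fun ω => (A ω)⁻¹ i j := by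
  have hdet : ∀ {B : Ω → Matrix ι ι ℝ}, (∀ i j, Measurable fun ω => B ω i j) →
      Measurable fun ω => (B ω).det := fun hB => by
    simp only [Matrix.det_apply']
    exact Finset.measurable_fun_sum _ fun σ _ =>
      (Finset.measurable_fun_prod _ fun k _ => hB _ _).const_mul _
  simp only [Matrix.inv_def, Ring.inverse_eq_inv', Matrix.smul_apply, smul_eq_mul,
    Matrix.adjugate_apply]
  refine (hdet hA).inv.mul (hdet fun k l => ?_)
  by_cases hk : k = j
  · subst hk
    simp only [Matrix.updateRow_self]
    exact measurable_const
  · simp only [Matrix.updateRow_ne hk]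
    exact hA k l

theorem measurable_generator {Ω : Type*} [MeasurableSpace Ω] {κ : Ω → EdgeConfig d}
    {φ : Ω → Site d → ℝ} (hκ : ∀ e, Measurable fun ω => κ ω e)
    (hφ : ∀ x, Measurable fun ω => φ ω x) (x : Site d) :
    Measurable fun ω => generator (κ ω) (φ ω) x := by
  unfold generator
  exact Finset.measurable_fun_sum _ fun i _ => ((hκ _).mul ((hφ _).sub (hφ _))).add
    ((hκ _).mul ((hφ _).sub (hφ _)))

theorem measurable_dirichletSolve {Ω : Type*} [MeasurableSpace Ω] (Λ : Finset (Site d))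
    {κ : Ω → EdgeConfig d} {r : Ω → Site d → ℝ} (hκ : ∀ e, Measurable fun ω => κ ω e)
    (hr : ∀ x, Measurable fun ω => r ω x) (x : Site d) :
    Measurable fun ω => dirichletSolve (κ ω) Λ (r ω) x := by
  unfold dirichletSolve
  have hA : ∀ i j, Measurable fun ω => dirichletMatrix (κ ω) Λ i j := fun i j =>
    (measurable_generator (φ := fun _ => Pi.single (j : Site d) 1) hκ
      (fun x => measurable_const) i).neg
  by_cases hx : x ∈ Λ
  · simp only [extend_of_mem _ hx, Matrix.mulVec, dotProduct]
    exact Finset.measurable_fun_sum _ fun y _ => (measurable_matrix_inv hA _ _).mul (hr _)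
  · simp only [extend_of_notMem _ hx]
    exact measurable_const

theorem measurable_harmonicExt {Ω : Type*} [MeasurableSpace Ω] (Λ : Finset (Site d))
    {κ : Ω → EdgeConfig d} {φ : Ω → Site d → ℝ} (hκ : ∀ e, Measurable fun ω => κ ω e)
    (hφ : ∀ x, Measurable fun ω => φ ω x) (x : Site d) :
    Measurable fun ω => harmonicExt (κ ω) Λ (φ ω) x :=
  (hφ x).add (measurable_dirichletSolve Λ hκ (measurable_generator hκ hφ) x)

/-- The joint law of gradients, conductances and an independent (given the conductances) Gaussian
field in `Λ`. -/
def resampleMeasure (μ' : Measure (EdgeConfig d × EdgeConfig d)) (Λ : Finset (Site d)) :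
    Measure ((EdgeConfig d × EdgeConfig d) × (Λ → ℝ)) :=
  (μ'.prod volume).withDensity fun q => fieldDensity q.1.2 Λ q.2

/-- The resampled gradients. -/
def resample (Λ : Finset (Site d)) (q : (EdgeConfig d × EdgeConfig d) × (Λ → ℝ)) : EdgeConfig d :=
  grad (harmonicExt q.1.2 Λ (height q.1.1) + extend Λ q.2)

theorem measurable_resample (Λ : Finset (Site d)) : Measurable (resample Λ) := by
  refine measurable_grad.comp (Measurable.add (measurable_pi_lambda _ fun x => ?_)
    (measurable_glue measurable_const measurable_snd))
  exact measurable_harmonicExt Λ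
    (fun e => (measurable_pi_apply e).comp (measurable_snd.comp measurable_fst))
    (fun x => (measurable_pi_apply x).comp
      (measurable_height.comp (measurable_fst.comp measurable_fst))) x

theorem measurable_uncurry_fieldDensity (Λ : Finset (Site d)) :
    Measurable fun q : (EdgeConfig d × EdgeConfig d) × (Λ → ℝ) => fieldDensity q.1.2 Λ q.2 :=
  measurable_fieldDensity Λ (measurable_snd.comp measurable_fst) measurable_snd

theorem lintegral_resampleMeasure (μ' : Measure (EdgeConfig d × EdgeConfig d)) [SFinite μ']
    (Λ : Finset (Site d)) {F : (EdgeConfig d × EdgeConfig d) × (Λ → ℝ) → ℝ≥0∞}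
    (hF : Measurable F) : ∫⁻ q, F q ∂resampleMeasure μ' Λ =
      ∫⁻ p, (∫⁻ ψ : Λ → ℝ, fieldDensity p.2 Λ ψ * F (p, ψ)) ∂μ' := by
  have hD := measurable_uncurry_fieldDensity Λ
  rw [resampleMeasure, lintegral_withDensity_eq_lintegral_mul _ hD hF,
    lintegral_prod _ (hD.mul hF).aemeasurable]
  rfl

theorem measurableSet_restrict_mem {S : Finset (Edge d)} {A : Set (EdgeConfig d)}
    {B : Set (S → ℝ)} (hA : MeasurableSet A) (hB : MeasurableSet B) :
    MeasurableSet {p : EdgeConfig d × EdgeConfig d | p.1 ∈ A ∧ S.restrict p.2 ∈ B} :=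
  (measurable_fst hA).inter (((Finset.measurable_restrict S).comp measurable_snd) hB)

theorem gaussAverage_congr {κ κ' : EdgeConfig d} {Λ : Finset (Site d)}
    (h : ∀ e ∈ edgesTouching Λ, κ e = κ' e) (F : EdgeConfig d → ℝ≥0∞) (η : EdgeConfig d) :
    gaussAverage κ Λ F η = gaussAverage κ' Λ F η := by
  have : gaussWeight κ Λ = gaussWeight κ' Λ := by
    ext η
    rw [gaussWeight, gaussWeight, Finset.sum_congr rfl fun e he => by rw [h e he]]
  rw [gaussAverage, gaussAverage, this]

section

variable {ρ : Measure ℝ} [IsFiniteMeasure ρ] {μ : Measure (EdgeConfig d)} [IsProbabilityMeasure μ]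
  {μ' : Measure (EdgeConfig d × EdgeConfig d)} [IsProbabilityMeasure μ']

theorem isProbabilityMeasure_resampleMeasure (hd : 0 < d)
    (hpos : ∀ᵐ p ∂μ', ∀ b, 0 < p.2 b) (Λ : Finset (Site d)) :
    IsProbabilityMeasure (resampleMeasure μ' Λ) := by
  constructor
  rw [← lintegral_one, lintegral_resampleMeasure μ' Λ measurable_const]
  simp only [mul_one]
  rw [lintegral_congr_ae (g := fun _ => 1)]
  · simp
  · filter_upwards [hpos] with p hp
    exact lintegral_fieldDensity hd hp Λ

/-- Only the conductances on S matter, so the extension can be disintegrated over them; for almost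
every value k the invariance with frozen conductances applies. -/
theorem IsExtension.lintegral_gaussAverage (hd : 0 < d) (h : IsExtension ρ μ μ')
    (hμ : IsGradientGibbs (potential ρ) μ) {K : Set ℝ} (hKpos : K ⊆ Set.Ioi 0) (hK : ρ Kᶜ = 0)
    {Λ : Finset (Site d)} {S : Finset (Edge d)} (hS : edgesTouching Λ ⊆ S)
    {A : Set (EdgeConfig d)} {B : Set (S → ℝ)} (hA : MeasurableSet A) (hB : MeasurableSet B) :
    ∫⁻ p, B.indicator 1 (S.restrict p.2) * gaussAverage p.2 Λ (A.indicator 1) p.1 ∂μ' =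
      μ' {p | p.1 ∈ A ∧ S.restrict p.2 ∈ B} := by
  have hA1 : Measurable (A.indicator (1 : EdgeConfig d → ℝ≥0∞)) := measurable_one.indicator hA
  have hB1 : Measurable (B.indicator (1 : (S → ℝ) → ℝ≥0∞)) := measurable_one.indicator hB
  have h1 : ∀ p : EdgeConfig d × EdgeConfig d,
      B.indicator 1 (S.restrict p.2) * gaussAverage p.2 Λ (A.indicator 1) p.1 =
      B.indicator 1 (S.restrict p.2) *
        gaussAverage (fill S (S.restrict p.2)) Λ (A.indicator 1) p.1 := fun p => by
    rw [gaussAverage_congr fun e he => (fill_of_mem (S.restrict p.2) (hS he)).symm]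
  have hpos : ∀ᵐ k ∂(Measure.pi fun _ : S => ρ), ∀ e, 0 < fill S k e := by
    filter_upwards [ae_pi_mem hK] with k hk e
    by_cases he : e ∈ S
    · rw [fill_of_mem k he]; exact hKpos (hk _)
    · simp [fill, he]
  have hG : Measurable (Function.uncurry fun (η : EdgeConfig d) (k : S → ℝ) =>
      gaussAverage (fill S k) Λ (A.indicator 1) η) :=
    measurable_gaussAverage Λ (κ := fun q : EdgeConfig d × (S → ℝ) => fill S q.2)
      ((measurable_fill S).comp measurable_snd) measurable_fst (F := fun _ => A.indicator 1)
      (hA1.comp measurable_snd)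
  have h2 : μ' {p | p.1 ∈ A ∧ S.restrict p.2 ∈ B} =
      ∫⁻ p, B.indicator 1 (S.restrict p.2) * A.indicator 1 p.1 ∂μ' := by
    rw [← lintegral_indicator_one (measurableSet_restrict_mem hA hB)]
    refine lintegral_congr fun p => ?_
    by_cases hp : p.1 ∈ A <;> by_cases hq : S.restrict p.2 ∈ B <;> simp [Set.indicator, hp, hq]
  rw [h2, lintegral_congr h1,
    h.lintegral_restrict S (Φ := fun η k => B.indicator 1 k *
      gaussAverage (fill S k) Λ (A.indicator 1) η) ((hB1.comp measurable_snd).mul hG),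
    h.lintegral_restrict S (Φ := fun η k => B.indicator 1 k * A.indicator 1 η)
      ((hB1.comp measurable_snd).mul (hA1.comp measurable_fst))]
  refine lintegral_congr_ae ?_
  filter_upwards [hpos] with k hk
  simp only [mul_assoc]
  have hm1 : Measurable (conductanceDensity ρ S (fill S k)) :=
    measurable_conductanceDensity S measurable_const measurable_id
  have hm2 : Measurable (gaussAverage (fill S k) Λ (A.indicator 1)) :=
    measurable_gaussAverage Λ measurable_const measurable_id (F := fun _ => A.indicator 1)
      (hA1.comp measurable_snd)
  have e1 := lintegral_const_mul (μ := μ) (B.indicator 1 k) (hm2.mul hm1)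
  have e2 := lintegral_const_mul (μ := μ) (B.indicator 1 k) (hA1.mul hm1)
  refine e1.trans (Eq.trans ?_ e2.symm)
  congr 1
  exact hμ.lintegral_gaussAverage hS _ (fun η => (fiberIntegral_gaussWeight_ne hd hk Λ η).1)
    (fun η => (fiberIntegral_gaussWeight_ne hd hk Λ η).2) hA1

/-- Resampling the heights in `Λ` according to the Gaussian field with the given conductances
leaves the extension invariant. -/
theorem IsExtension.map_resample (hd : 0 < d) (h : IsExtension ρ μ μ')
    (hμ : IsGradientGibbs (potential ρ) μ) {K : Set ℝ} (hKm : MeasurableSet K)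
    (hKpos : K ⊆ Set.Ioi 0) (hK : ρ Kᶜ = 0) (Λ : Finset (Site d)) :
    (resampleMeasure μ' Λ).map (fun q => (resample Λ q, q.1.2)) = μ' := by
  have hpos : ∀ᵐ p ∂μ', ∀ b, 0 < p.2 b := by
    filter_upwards [h.ae_mem hKm hK] with p hp b using hKpos (hp b)
  have hT : Measurable fun q : (EdgeConfig d × EdgeConfig d) × (Λ → ℝ) => (resample Λ q, q.1.2) :=
    (measurable_resample Λ).prodMk (measurable_snd.comp measurable_fst)
  have := isProbabilityMeasure_resampleMeasure (μ' := μ') hd hpos Λ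
  have := Measure.isProbabilityMeasure_map (μ := resampleMeasure μ' Λ) hT.aemeasurable
  refine MeasureTheory.ext_of_generate_finite _ (generateFrom_eq_prod (C := {A | MeasurableSet A})
    (D := measurableCylinders fun _ : Edge d => ℝ) MeasurableSpace.generateFrom_measurableSet
    generateFrom_measurableCylinders (isCountablySpanning_measurableSet) ⟨fun _ => Set.univ,
      fun _ => (mem_measurableCylinders _).2 ⟨∅, Set.univ, .univ, by simp⟩, Set.iUnion_const _⟩).symm
    (IsPiSystem.prod MeasurableSpace.isPiSystem_measurableSet isPiSystem_measurableCylinders) ?_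
    (by simp)
  rintro _ ⟨A, hA, B, hB, rfl⟩
  replace hA : MeasurableSet A := hA
  obtain ⟨S₀, B₀, hB₀, rfl⟩ := (mem_measurableCylinders _).1 hB
  -- The base of the cylinder is enlarged by the edges touching Λ, since the Gaussian weight depends
  -- on the conductances there.
  obtain ⟨S, hS₀, hS⟩ : ∃ S, S₀ ⊆ S ∧ edgesTouching Λ ⊆ S :=
    ⟨S₀ ∪ edgesTouching Λ, Finset.subset_union_left, Finset.subset_union_right⟩
  let B' : Set (S → ℝ) := (fun k (b : S₀) => k ⟨b, hS₀ b.2⟩) ⁻¹' B₀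
  have hB' : MeasurableSet B' := (by fun_prop : Measurable fun (k : S → ℝ) (b : S₀) =>
    k ⟨b, hS₀ b.2⟩) hB₀
  have key := h.lintegral_gaussAverage hd hμ hKpos hK hS hA hB'
  have hset : A ×ˢ cylinder S₀ B₀ = {p : EdgeConfig d × EdgeConfig d |
      p.1 ∈ A ∧ S.restrict p.2 ∈ B'} := rfl
  have hsm : MeasurableSet {p : EdgeConfig d × EdgeConfig d | p.1 ∈ A ∧ S.restrict p.2 ∈ B'} :=
    measurableSet_restrict_mem hA hB'
  have hA1 : Measurable (A.indicator (1 : EdgeConfig d → ℝ≥0∞)) := measurable_one.indicator hA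
  simp only [hset]
  rw [← key, ← lintegral_indicator_one hsm, lintegral_map (measurable_one.indicator hsm) hT,
    lintegral_resampleMeasure μ' Λ (F := fun q => {p : EdgeConfig d × EdgeConfig d |
      p.1 ∈ A ∧ S.restrict p.2 ∈ B'}.indicator 1 (resample Λ q, q.1.2))
      ((measurable_one.indicator hsm).comp hT)]
  refine lintegral_congr_ae ?_
  filter_upwards [hpos] with p hp
  rw [gaussAverage_eq hd hp Λ hA1, ← lintegral_const_mul]
  · refine lintegral_congr fun ψ => ?_
    rw [mul_left_comm]
    congr 1
    by_cases h1 : resample Λ (p, ψ) ∈ A <;> by_cases h2 : S.restrict p.2 ∈ B' <;>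
      simp only [resample] at h1 <;> simp [resample, Set.indicator, h1, h2]
  · have hr : Measurable fun ψ : Λ → ℝ => resample Λ (p, ψ) :=
      (measurable_resample Λ).comp measurable_prodMk_left
    have hD : Measurable (fieldDensity p.2 Λ) :=
      measurable_fieldDensity Λ measurable_const measurable_id
    exact hD.mul (hA1.comp hr)

end

/-! ### The mean ergodic theorem in `L¹` -/

section MeanErgodic

variable {Ω : Type*} [MeasurableSpace Ω] {μ : Measure Ω} [IsProbabilityMeasure μ]

theorem norm_inclusion_Lp_le (f : Lp ℝ 2 μ) :
    ‖AddSubgroup.inclusion (Lp.antitone (E := ℝ) (μ := μ) one_le_two) f‖ ≤ ‖f‖ := by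
  rw [Lp.norm_def, Lp.norm_def]
  refine ENNReal.toReal_mono (Lp.eLpNorm_ne_top f) ?_
  exact eLpNorm_le_eLpNorm_of_exponent_le one_le_two (Lp.aestronglyMeasurable f)

theorem denseRange_inclusion_Lp :
    DenseRange (AddSubgroup.inclusion (Lp.antitone (E := ℝ) (μ := μ) one_le_two)) := by
  refine (Lp.simpleFunc.denseRange (E := ℝ) (μ := μ) (p := 1) ENNReal.one_ne_top).mono ?_
  rintro _ ⟨s, rfl⟩
  have h2 : MemLp (Lp.simpleFunc.toSimpleFunc s) 2 μ :=
    SimpleFunc.memLp_of_isFiniteMeasure _ _ _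
  refine ⟨h2.toLp _, Subtype.ext ?_⟩
  exact AEEqFun.ext ((AEEqFun.coeFn_mk _ _).trans (Lp.simpleFunc.toSimpleFunc_eq_toFun s))

/-- The averages along a measure preserving map converge in `L¹`. -/
theorem exists_tendsto_birkhoffAverage {T : Ω → Ω} (hT : MeasurePreserving T μ μ)
    (f : Lp ℝ 1 μ) : ∃ g, Tendsto (fun n =>
      birkhoffAverage ℝ (Lp.compMeasurePreserving T hT) id n f) atTop (𝓝 g) := by
  set U : Lp ℝ 1 μ →+ Lp ℝ 1 μ := Lp.compMeasurePreserving T hT with hU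
  set J := AddSubgroup.inclusion (Lp.antitone (E := ℝ) (μ := μ) one_le_two) with hJ
  let V : Lp ℝ 2 μ →ₗᵢ[ℝ] Lp ℝ 2 μ := Lp.compMeasurePreservingₗᵢ ℝ T hT
  have hUV : ∀ n (h : Lp ℝ 2 μ), J (V^[n] h) = U^[n] (J h) := by
    intro n h
    refine Function.Semiconj.iterate_right (f := J) (ga := V) (gb := U) (fun h => ?_) n h
    rfl
  have hJA : ∀ n (h : Lp ℝ 2 μ),
      J (birkhoffAverage ℝ V id n h) = birkhoffAverage ℝ U id n (J h) := by
    intro n h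
    rw [map_birkhoffAverage ℝ ℝ J]
    simp only [birkhoffAverage, birkhoffSum, Function.comp, id, hUV]
  -- Averages do not increase L¹ distances, uniformly in n. Hence the Cauchy property, known in L²
  -- by von Neumann's theorem, passes from the dense subspace L² to all of L¹.
  have hlip : ∀ n (h h' : Lp ℝ 1 μ), dist (birkhoffAverage ℝ U id n h)
      (birkhoffAverage ℝ U id n h') ≤ dist h h' := fun n h h' => by
    have h1 := dist_birkhoffAverage_birkhoffAverage_le ℝ U id n h h'
    refine h1.trans ?_
    have h2 : ∀ k ∈ Finset.range n, dist (id (U^[k] h)) (id (U^[k] h')) = dist h h' := fun k _ =>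
      by simpa only [hU, id, Lp.compMeasurePreserving_iterate hT k] using
        (Lp.isometry_compMeasurePreserving (hT.iterate k)).dist_eq h h'
    rw [Finset.sum_congr rfl h2, Finset.sum_const, Finset.card_range, nsmul_eq_mul]
    rcases eq_or_ne n 0 with rfl | hn
    · simp
    · rw [mul_div_cancel_left₀ _ (by exact_mod_cast hn)]
  refine cauchySeq_tendsto_of_complete (Metric.cauchySeq_iff.2 fun ε hε => ?_)
  obtain ⟨h, hh⟩ := Metric.denseRange_iff.1 (denseRange_inclusion_Lp (μ := μ)) f (ε / 3)
    (by positivity)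
  have hcau : CauchySeq fun n => birkhoffAverage ℝ V id n h :=
    (ContinuousLinearMap.tendsto_birkhoffAverage_orthogonalProjection
      V.toContinuousLinearMap V.norm_toContinuousLinearMap_le h).cauchySeq
  obtain ⟨N, hN⟩ := Metric.cauchySeq_iff.1 hcau (ε / 3) (by positivity)
  refine ⟨N, fun m hm n hn => ?_⟩
  have h1 := hlip m f (J h)
  have h2 := hlip n f (J h)
  have h3 : dist (birkhoffAverage ℝ U id m (J h)) (birkhoffAverage ℝ U id n (J h)) < ε / 3 := by
    rw [← hJA, ← hJA, dist_eq_norm, ← map_sub]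
    exact (norm_inclusion_Lp_le _).trans_lt (by simpa [dist_eq_norm] using hN m hm n hn)
  calc dist (birkhoffAverage ℝ U id m f) (birkhoffAverage ℝ U id n f)
      ≤ dist (birkhoffAverage ℝ U id m f) (birkhoffAverage ℝ U id m (J h)) +
        dist (birkhoffAverage ℝ U id m (J h)) (birkhoffAverage ℝ U id n (J h)) +
        dist (birkhoffAverage ℝ U id n (J h)) (birkhoffAverage ℝ U id n f) := dist_triangle4 _ _ _ _
    _ < ε := by rw [dist_comm _ (birkhoffAverage ℝ U id n f)]; linarith

end MeanErgodic

/-! ### Sublinear growth of the heights -/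

theorem shift_shift (x y : Site d) (η : EdgeConfig d) : shift x (shift y η) = shift (x + y) η := by
  ext e; simp [shift, add_assoc]

theorem sum_zsmul_unit (x : Site d) : ∑ i, x i • (unit i : Site d) = x := by
  ext j
  simp [unit, Finset.sum_apply, Pi.single_apply]

/-- Under an ergodic measure almost surely invariant functions are almost surely constant. -/
theorem IsErgodic.ae_eq_const {μ : Measure (EdgeConfig d)} [IsProbabilityMeasure μ]
    (herg : IsErgodic μ) (hinv : IsTranslationInvariant μ) {g : EdgeConfig d → ℝ}
    (hg : Measurable g) (h : ∀ j : Fin d, g ∘ shift (unit j) =ᵐ[μ] g) :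
    ∃ c, g =ᵐ[μ] Function.const _ c := by
  have hmp : ∀ x : Site d, MeasurePreserving (shift x) μ μ := fun x => ⟨by
    exact measurable_pi_lambda _ fun _ => measurable_pi_apply _, hinv x⟩
  -- The translations that preserve g almost surely form a group, so the generators suffice.
  let H : AddSubgroup (Site d) :=
    { carrier := {x | g ∘ shift x =ᵐ[μ] g}
      zero_mem' := by
        have h0 : g ∘ shift 0 =ᵐ[μ] g :=
          Eq.eventuallyEq (funext fun η => congrArg g (by ext e; simp [shift]))
        exact h0
      add_mem' := fun {x y} hx hy => by
        have h1 : (g ∘ shift x) ∘ shift y =ᵐ[μ] g ∘ shift y :=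
          (hmp y).quasiMeasurePreserving.ae_eq_comp hx
        refine (Eq.eventuallyEq ?_).trans (h1.trans hy)
        ext η
        simp [shift_shift]
      neg_mem' := fun {x} hx => by
        have h1 : (g ∘ shift x) ∘ shift (-x) =ᵐ[μ] g ∘ shift (-x) :=
          (hmp (-x)).quasiMeasurePreserving.ae_eq_comp hx
        refine h1.symm.trans (Eq.eventuallyEq ?_)
        ext η
        simp only [Function.comp, shift_shift]
        congr 1
        ext e; simp [shift] }
  have hall : ∀ x : Site d, g ∘ shift x =ᵐ[μ] g := fun x => by
    have : x ∈ H := by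
      rw [← sum_zsmul_unit x]
      exact H.sum_mem fun i _ => H.zsmul_mem (h i) _
    exact this
  refine exists_eventuallyEq_const_of_forall_separating MeasurableSet fun U hU => ?_
  -- A strictly invariant version of the event g ∈ U, as ergodicity speaks of exactly invariant
  -- events only.
  let A : Set (EdgeConfig d) := ⋂ x : Site d, shift x ⁻¹' (g ⁻¹' U)
  have hA : MeasurableSet A := MeasurableSet.iInter fun x => (hmp x).measurable (hg hU)
  have hAinv : ∀ x : Site d, shift x ⁻¹' A = A := fun x => by
    ext η
    simp only [A, Set.mem_preimage, Set.mem_iInter, shift_shift]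
    exact ⟨fun h y => by simpa using h (y - x), fun h y => h _⟩
  have hAae : ∀ᵐ η ∂μ, η ∈ A ↔ g η ∈ U := by
    filter_upwards [ae_all_iff.2 hall] with η hη
    simp only [A, Set.mem_iInter, Set.mem_preimage]
    exact ⟨fun h => by have := h 0; rwa [show g (shift 0 η) = g η from hη 0] at this,
      fun h y => by rwa [show g (shift y η) = g η from hη y]⟩
  rcases herg A hA hAinv with h0 | h1
  · right
    filter_upwards [hAae, measure_eq_zero_iff_ae_notMem.1 h0] with η h1 h2
    exact fun h => h2 (h1.2 h)
  · left
    filter_upwards [hAae, (mem_ae_iff_prob_eq_one hA).2 h1] with η h1 h2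
    exact h1.1 h2

/-- A single direction need not act ergodically, so the L¹ limit of the averages along e_i must be
shown invariant under every shift. By the loop condition, moving the segment by e_j changes its sum
only by two end terms, which are O(1/n) in L¹ after averaging. The limit is then constant, and the
tilt gives its value. -/
theorem integral_abs_sum_le {μ : Measure (EdgeConfig d)} [IsProbabilityMeasure μ]
    (hloop : ∀ᵐ η ∂μ, LoopCondition η) (hinv : IsTranslationInvariant μ) (herg : IsErgodic μ)
    {t : Vec d} (ht : HasTilt μ t) (i : Fin d) :
    Tendsto (fun n : ℕ => (n : ℝ)⁻¹ * ∫ η, |∑ k ∈ Finset.range n,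
      (η (Pi.single i (k : ℤ), i) - ⟪t, toVec (unit i)⟫)| ∂μ) atTop (𝓝 0) := by
  have hmp : ∀ x : Site d, MeasurePreserving (shift x) μ μ := fun x => ⟨by
    exact measurable_pi_lambda _ fun _ => measurable_pi_apply _, hinv x⟩
  set c := ⟪t, toVec (unit i)⟫
  let X : Edge d → Lp ℝ 1 μ := fun e => (memLp_one_iff_integrable.2 (ht e).1).toLp _
  have hX : ∀ e, X e =ᵐ[μ] fun η => η e := fun e => MemLp.coeFn_toLp _
  let U : Site d → Lp ℝ 1 μ →+ Lp ℝ 1 μ := fun x => Lp.compMeasurePreserving (shift x) (hmp x)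
  have hUX : ∀ x e, U x (X e) = X (e.1 + x, e.2) := fun x e => rfl
  have hit : ∀ n e, (U (unit i))^[n] (X e) = X (e.1 + Pi.single i (n : ℤ), e.2) := by
    intro n e
    induction n with
    | zero => simp
    | succ n ih =>
      rw [Function.iterate_succ_apply', ih, hUX]
      simp only [unit, add_assoc, ← Pi.single_add]
      push_cast
      rfl
  obtain ⟨g, hg⟩ := exists_tendsto_birkhoffAverage (hmp (unit i)) (X (0, i))
  have hA : ∀ n, birkhoffAverage ℝ (U (unit i)) id n (X (0, i)) =
      (n : ℝ)⁻¹ • ∑ k ∈ Finset.range n, X (Pi.single i (k : ℤ), i) := fun n => by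
    simp only [birkhoffAverage, birkhoffSum, id, hit, zero_add]
  replace hg : Tendsto (fun n : ℕ => (n : ℝ)⁻¹ • ∑ k ∈ Finset.range n, X (Pi.single i (k : ℤ), i))
      atTop (𝓝 g) := hg.congr hA
  have hXloop : ∀ x j, X (x + unit j, i) - X (x, i) = X (x + unit i, j) - X (x, j) := by
    intro x j
    refine Lp.ext ?_
    filter_upwards [Lp.coeFn_sub (X (x + unit j, i)) (X (x, i)),
      Lp.coeFn_sub (X (x + unit i, j)) (X (x, j)), hX (x + unit j, i), hX (x, i),
      hX (x + unit i, j), hX (x, j), hloop] with η h1 h2 h3 h4 h5 h6 hl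
    rw [h1, h2, Pi.sub_apply, Pi.sub_apply, h3, h4, h5, h6]
    linarith [hl x i j]
  have hginv : ∀ j, U (unit j) g = g := by
    intro j
    have h1 : Tendsto (fun n : ℕ => U (unit j)
        ((n : ℝ)⁻¹ • ∑ k ∈ Finset.range n, X (Pi.single i (k : ℤ), i))) atTop (𝓝 (U (unit j) g)) :=
      ((Lp.isometry_compMeasurePreserving (hmp (unit j))).continuous.tendsto g).comp hg
    have h2 : ∀ n : ℕ, U (unit j) ((n : ℝ)⁻¹ • ∑ k ∈ Finset.range n, X (Pi.single i (k : ℤ), i)) -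
        (n : ℝ)⁻¹ • ∑ k ∈ Finset.range n, X (Pi.single i (k : ℤ), i) =
        (n : ℝ)⁻¹ • (X (Pi.single i (n : ℤ), j) - X (0, j)) := by
      intro n
      have hs : U (unit j) ((n : ℝ)⁻¹ • ∑ k ∈ Finset.range n, X (Pi.single i (k : ℤ), i)) =
          (n : ℝ)⁻¹ • ∑ k ∈ Finset.range n, X (Pi.single i (k : ℤ) + unit j, i) := by
        rw [show U (unit j) ((n : ℝ)⁻¹ • ∑ k ∈ Finset.range n, X (Pi.single i (k : ℤ), i)) =
          (n : ℝ)⁻¹ • U (unit j) (∑ k ∈ Finset.range n, X (Pi.single i (k : ℤ), i)) from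
          (Lp.compMeasurePreservingₗ ℝ (shift (unit j)) (hmp (unit j))).map_smul _ _, map_sum]
        simp only [hUX]
      rw [hs, ← smul_sub, ← Finset.sum_sub_distrib]
      congr 1
      simp only [hXloop]
      have : ∀ k : ℕ, (Pi.single i (k : ℤ) + unit i : Site d) = Pi.single i ((k + 1 : ℕ) : ℤ) :=
        fun k => by rw [unit, ← Pi.single_add]; push_cast; rfl
      simp only [this]
      rw [Finset.sum_range_sub (fun k : ℕ => X (Pi.single i (k : ℤ), j))]
      simp
    have h3 : Tendsto (fun n : ℕ => (n : ℝ)⁻¹ • (X (Pi.single i (n : ℤ), j) - X (0, j))) atTop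
        (𝓝 0) := by
      refine squeeze_zero_norm (a := fun n : ℕ => (n : ℝ)⁻¹ * (2 * ‖X (0, j)‖)) (fun n => ?_) ?_
      · rw [norm_smul, Real.norm_eq_abs, abs_of_nonneg (by positivity)]
        gcongr
        refine (norm_sub_le _ _).trans ?_
        have : ‖X (Pi.single i (n : ℤ), j)‖ = ‖X (0, j)‖ := by
          have := Lp.norm_compMeasurePreserving (X (0, j)) (hmp (Pi.single i (n : ℤ)))
          rw [← this]
          congr 1
          have h := hUX (Pi.single i (n : ℤ)) (0, j)
          simp only [zero_add] at h
          exact h.symm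
        rw [this]; linarith
      · simpa using (tendsto_inv_atTop_nhds_zero_nat (𝕜 := ℝ)).mul_const (2 * ‖X (0, j)‖)
    have h4 := h1.sub hg
    simp only [h2] at h4
    exact sub_eq_zero.1 (tendsto_nhds_unique h4 h3)
  obtain ⟨c', hc'⟩ := herg.ae_eq_const hinv (Lp.stronglyMeasurable g).measurable fun j => by
    have := Lp.coeFn_compMeasurePreserving g (hmp (unit j))
    rw [show Lp.compMeasurePreserving (shift (unit j)) (hmp (unit j)) g = g from hginv j] at this
    exact this.symm
  have hAae : ∀ n : ℕ, ⇑((n : ℝ)⁻¹ • ∑ k ∈ Finset.range n, X (Pi.single i (k : ℤ), i)) =ᵐ[μ]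
      fun η => (n : ℝ)⁻¹ * ∑ k ∈ Finset.range n, η (Pi.single i (k : ℤ), i) := by
    intro n
    filter_upwards [Lp.coeFn_smul (n : ℝ)⁻¹ (∑ k ∈ Finset.range n, X (Pi.single i (k : ℤ), i)),
      Lp.coeFn_finsetSum (Finset.range n) (fun k : ℕ => X (Pi.single i (k : ℤ), i)),
      ae_all_iff.2 fun k : ℕ => hX (Pi.single i (k : ℤ), i)] with η h1 h2 h3
    rw [h1, Pi.smul_apply, h2, Finset.sum_apply, smul_eq_mul]
    simp only [h3]
  -- Expectations pass to the L¹ limit, and those of the averages all equal t·e_i for n ≠ 0.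
  have hcc : c' = c := by
    have h1 : Tendsto (fun n : ℕ => ∫ η, (((n : ℝ)⁻¹ • ∑ k ∈ Finset.range n,
        X (Pi.single i (k : ℤ), i) : Lp ℝ 1 μ) : EdgeConfig d → ℝ) η ∂μ) atTop
        (𝓝 (∫ η, g η ∂μ)) := (continuous_integral.tendsto g).comp hg
    rw [integral_congr_ae hc'] at h1
    simp only [Function.const, integral_const, probReal_univ, one_smul] at h1
    refine tendsto_nhds_unique h1 (tendsto_const_nhds.congr' ?_)
    filter_upwards [eventually_ne_atTop 0] with n hn
    rw [integral_congr_ae (hAae n), integral_const_mul, integral_finsetSum _ fun k _ => (ht _).1]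
    simp only [(ht _).2, Finset.sum_const, Finset.card_range, nsmul_eq_mul]
    rw [inv_mul_cancel_left₀ (by exact_mod_cast hn)]
  have h5 : Tendsto (fun n : ℕ => ‖(n : ℝ)⁻¹ • ∑ k ∈ Finset.range n, X (Pi.single i (k : ℤ), i)
      - g‖) atTop (𝓝 0) := tendsto_iff_norm_sub_tendsto_zero.1 hg
  refine h5.congr' ?_
  filter_upwards [eventually_ne_atTop 0] with n hn
  rw [L1.norm_eq_integral_norm, ← integral_const_mul]
  refine integral_congr_ae ?_
  filter_upwards [Lp.coeFn_sub ((n : ℝ)⁻¹ • ∑ k ∈ Finset.range n, X (Pi.single i (k : ℤ), i)) g,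
    hAae n, hc'] with η h1 h2 h3
  rw [h1, Pi.sub_apply, h2, h3, hcc, Real.norm_eq_abs]
  have hn' : (n : ℝ) ≠ 0 := by exact_mod_cast hn
  rw [Finset.sum_sub_distrib, Finset.sum_const, Finset.card_range, nsmul_eq_mul,
    ← abs_of_nonneg (show (0 : ℝ) ≤ (n : ℝ)⁻¹ by positivity), ← abs_mul, mul_sub,
    abs_of_nonneg (show (0 : ℝ) ≤ (n : ℝ)⁻¹ by positivity), inv_mul_cancel_left₀ hn']
  rfl

theorem exists_le_add_mul {a : ℕ → ℝ} (ha : ∀ n, 0 ≤ a n)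
    (h : Tendsto (fun n : ℕ => (n : ℝ)⁻¹ * a n) atTop (𝓝 0)) {δ : ℝ} (hδ : 0 < δ) :
    ∃ C, 0 ≤ C ∧ ∀ n, a n ≤ C + δ * n := by
  obtain ⟨N, hN⟩ := eventually_atTop.1 (h.eventually (gt_mem_nhds hδ))
  refine ⟨∑ m ∈ Finset.range (N + 1), a m, Finset.sum_nonneg fun m _ => ha m, fun n => ?_⟩
  have hs : 0 ≤ ∑ m ∈ Finset.range (N + 1), a m := Finset.sum_nonneg fun m _ => ha m
  rcases le_or_gt n N with hn | hn
  · have := Finset.single_le_sum (fun m _ => ha m) (Finset.mem_range.2 (Nat.lt_succ_of_le hn))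
    have : 0 ≤ δ * n := by positivity
    linarith
  · have h1 := hN n hn.le
    have hn' : (0 : ℝ) < n := by exact_mod_cast (Nat.zero_le N).trans_lt hn
    rw [inv_mul_lt_iff₀ hn'] at h1
    linarith

theorem pathSum_sub (u v : EdgeConfig d) (x : Site d) :
    pathSum (u - v) x = pathSum u x - pathSum v x := by
  simp only [pathSum, ← Finset.sum_sub_distrib, Pi.sub_apply]
  exact Finset.sum_congr rfl fun i _ => by simp only [Finset.sum_sub_distrib]; ring

theorem pathSum_add (u v : EdgeConfig d) (x : Site d) :
    pathSum (u + v) x = pathSum u x + pathSum v x := by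
  simp only [pathSum, ← Finset.sum_add_distrib, Pi.add_apply]
  exact Finset.sum_congr rfl fun i _ => by simp only [Finset.sum_add_distrib]; ring

theorem pathSum_inner (t : Vec d) (u : Edge d → Vec d) (x : Site d) :
    pathSum (fun e => ⟪t, u e⟫) x = ⟪t, pathSum u x⟫ := by
  simp only [pathSum, inner_sum, inner_sub_right]

theorem toVec_add (x y : Site d) : toVec (x + y) = toVec x + toVec y := by
  ext i; simp [toVec]

theorem pathSum_tilt (t : Vec d) (x : Site d) :
    pathSum (fun e : Edge d => ⟪t, toVec (unit e.2)⟫) x = ⟪t, toVec x⟫ := by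
  have h1 : (fun e : Edge d => ⟪t, toVec (unit e.2)⟫) = grad fun x : Site d => ⟪t, toVec x⟫ := by
    ext e
    simp [grad, toVec_add, inner_add_right]
  have h2 : toVec (0 : Site d) = 0 := by ext i; simp [toVec]
  have h3 := height_grad (fun x : Site d => ⟪t, toVec x⟫) x
  rw [h2, inner_zero_right, sub_zero] at h3
  rw [h1]
  exact h3

/-- Each leg of the lattice path is, up to sign, a translate of a straight segment from the origin.
The translation does not depend on u, so stationarity reduces path sums to sums along axes. -/
theorem exists_pathSum_eq_sum_range (x : Site d) (i : Fin d) :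
    ∃ y : Site d, ∀ u : EdgeConfig d,
      |∑ k ∈ Finset.Ico 0 (x i), u (corner x i.val + Pi.single i k, i)
      - ∑ k ∈ Finset.Ico (x i) 0, u (corner x i.val + Pi.single i k, i)| =
      |∑ k ∈ Finset.range (x i).natAbs, shift y u (Pi.single i (k : ℤ), i)| := by
  have key : ∀ (u : EdgeConfig d) (c : ℤ) (n : ℕ),
      ∑ k ∈ Finset.Ico c (c + n), u (corner x i.val + Pi.single i k, i) =
      ∑ k ∈ Finset.range n, shift (corner x i.val + Pi.single i c) u (Pi.single i (k : ℤ), i) := by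
    intro u c n
    symm
    refine Finset.sum_bij (fun (k : ℕ) _ => c + (k : ℤ)) ?_ ?_ ?_ ?_
    · intro k hk; simp at hk ⊢; omega
    · intro k _ l _ h; simpa using h
    · intro k hk
      rw [Finset.mem_Ico] at hk
      exact ⟨(k - c).toNat, Finset.mem_range.2 (by omega), by omega⟩
    · intro k _
      simp only [shift, Pi.single_add]
      congr 2
      abel
  rcases le_total 0 (x i) with hx | hx
  · refine ⟨corner x i.val + Pi.single i 0, fun u => ?_⟩
    rw [Finset.Ico_eq_empty (a := x i) (by omega), Finset.sum_empty, sub_zero, ← key,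
      show (0 : ℤ) + (x i).natAbs = x i by omega]
  · refine ⟨corner x i.val + Pi.single i (x i), fun u => ?_⟩
    rw [Finset.Ico_eq_empty (b := x i) (by omega), Finset.sum_empty, zero_sub, abs_neg, ← key,
      show x i + (x i).natAbs = 0 by omega]

theorem sum_mul_natAbs_le {δ : ℝ} (hδ : 0 ≤ δ) (x : Site d) :
    ∑ i, δ / (d + 1) * ((x i).natAbs : ℝ) ≤ δ * ‖x‖ := by
  calc ∑ i, δ / (d + 1) * ((x i).natAbs : ℝ) ≤ ∑ _i : Fin d, δ / (d + 1) * ‖x‖ := by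
        refine Finset.sum_le_sum fun i _ => ?_
        gcongr
        have := norm_le_pi_norm x i
        rwa [Int.norm_eq_abs, ← Int.cast_abs, ← Nat.cast_natAbs] at this
    _ = d / (d + 1) * (δ * ‖x‖) := by simp; ring
    _ ≤ 1 * (δ * ‖x‖) := by
        gcongr
        rw [div_le_one (by positivity)]; linarith
    _ = δ * ‖x‖ := one_mul _

/-- Under an ergodic measure with tilt `t`, the heights differ from `t · x` by sublinear terms. -/
theorem lintegral_height_sub_le {μ : Measure (EdgeConfig d)} [IsProbabilityMeasure μ]
    (hloop : ∀ᵐ η ∂μ, LoopCondition η) (hinv : IsTranslationInvariant μ) (herg : IsErgodic μ)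
    {t : Vec d} (ht : HasTilt μ t) {δ : ℝ} (hδ : 0 < δ) :
    ∃ C, 0 ≤ C ∧ ∀ x : Site d, ∫⁻ η, ‖height (η - fun e => ⟪t, toVec (unit e.2)⟫) x‖ₑ ∂μ ≤
      ENNReal.ofReal (C + δ * ‖x‖) := by
  have hmp : ∀ x : Site d, MeasurePreserving (shift x) μ μ := fun x => ⟨measurable_shift x, hinv x⟩
  let Y : Fin d → ℕ → EdgeConfig d → ℝ := fun i n η => ∑ k ∈ Finset.range n,
    (η (Pi.single i (k : ℤ), i) - ⟪t, toVec (unit i)⟫)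
  have hYi : ∀ i n, Integrable (Y i n) μ := fun i n =>
    integrable_finsetSum _ fun k _ => (ht _).1.sub (integrable_const _)
  -- The slope is distributed over the d legs of the path; d + 1 avoids division by zero.
  have hδ' : 0 < δ / (d + 1) := by positivity
  choose C hC0 hC using fun i => exists_le_add_mul (a := fun n => ∫ η, |Y i n η| ∂μ)
    (fun n => integral_nonneg fun _ => abs_nonneg _) (integral_abs_sum_le hloop hinv herg ht i) hδ'
  refine ⟨∑ i, C i, Finset.sum_nonneg fun i _ => hC0 i, fun x => ?_⟩
  choose z hz using exists_pathSum_eq_sum_range x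
  calc ∫⁻ η, ‖height (η - fun e => ⟪t, toVec (unit e.2)⟫) x‖ₑ ∂μ
      ≤ ∫⁻ η, ∑ i, ‖Y i (x i).natAbs (shift (z i) η)‖ₑ ∂μ := by
        refine lintegral_mono fun η => ?_
        simp only [height, pathSum]
        refine (enorm_sum_le _ _).trans (Finset.sum_le_sum fun i _ => le_of_eq ?_)
        rw [← ofReal_norm, ← ofReal_norm, Real.norm_eq_abs, Real.norm_eq_abs, hz i]
        rfl
    _ = ∑ i, ∫⁻ η, ‖Y i (x i).natAbs η‖ₑ ∂μ := by
        have hm : ∀ i, Measurable fun η => ‖Y i (x i).natAbs η‖ₑ := fun i => by fun_prop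
        have hm' : ∀ i, Measurable fun η => ‖Y i (x i).natAbs (shift (z i) η)‖ₑ :=
          fun i => (hm i).comp (measurable_shift _)
        rw [lintegral_finsetSum _ fun i _ => hm' i]
        exact Finset.sum_congr rfl fun i _ => (hmp (z i)).lintegral_comp (hm i)
    _ ≤ ∑ i, ENNReal.ofReal (C i + δ / (d + 1) * (x i).natAbs) := by
        refine Finset.sum_le_sum fun i _ => ?_
        rw [← ofReal_integral_norm_eq_lintegral_enorm (hYi i _)]
        exact ENNReal.ofReal_le_ofReal (hC i _)
    _ ≤ ENNReal.ofReal (∑ i, C i + δ * ‖x‖) := by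
        rw [← ENNReal.ofReal_sum_of_nonneg fun i _ => add_nonneg (hC0 i) (by positivity)]
        refine ENNReal.ofReal_le_ofReal ?_
        rw [Finset.sum_add_distrib]
        gcongr
        exact sum_mul_natAbs_le hδ.le x

/-! ### Vector fields over the conductances -/

theorem fieldMeasure_eq_sum (ν : Measure (EdgeConfig d)) [SFinite ν] :
    fieldMeasure ν = ∑ j, (ν.withDensity fun κ => ENNReal.ofReal (κ (0, j))).map fun κ => (κ, j) := by
  have hm : Measurable fun p : EdgeConfig d × Fin d => ENNReal.ofReal (p.1 (0, p.2)) :=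
    measurable_from_prod_countable_left fun j => (measurable_pi_apply (0, j)).ennreal_ofReal
  have hp : ∀ j : Fin d, Measurable fun κ : EdgeConfig d => (κ, j) := fun j => by fun_prop
  ext A hA
  rw [fieldMeasure, withDensity_apply _ hA, ← lintegral_indicator hA,
    lintegral_prod_symm' _ (hm.indicator hA), lintegral_count, tsum_fintype, Measure.finsetSum_apply]
  refine Finset.sum_congr rfl fun j _ => ?_
  rw [Measure.map_apply (hp j) hA, withDensity_apply _ (hp j hA), ← lintegral_indicator (hp j hA)]
  rfl

theorem lintegral_fieldMeasure (ν : Measure (EdgeConfig d)) [SFinite ν]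
    {F : EdgeConfig d × Fin d → ℝ≥0∞} (hF : Measurable F) :
    ∫⁻ p, F p ∂fieldMeasure ν = ∑ j, ∫⁻ κ, ENNReal.ofReal (κ (0, j)) * F (κ, j) ∂ν := by
  have hp : ∀ j : Fin d, Measurable fun κ : EdgeConfig d => (κ, j) := fun j => by fun_prop
  rw [fieldMeasure_eq_sum, lintegral_finsetSum_measure]
  refine Finset.sum_congr rfl fun j _ => ?_
  have hFj : Measurable fun κ : EdgeConfig d => F (κ, j) := hF.comp (hp j)
  rw [lintegral_map hF (hp j), lintegral_withDensity_eq_lintegral_mul _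
    (measurable_pi_apply (0, j)).ennreal_ofReal hFj]
  rfl

theorem integral_fieldMeasure {ν : Measure (EdgeConfig d)} [SFinite ν]
    (hκ : ∀ᵐ κ ∂ν, ∀ e, 0 ≤ κ e) {F : EdgeConfig d × Fin d → ℝ} (hFm : Measurable F)
    (hF : Integrable F (fieldMeasure ν)) :
    ∫ p, F p ∂fieldMeasure ν = ∑ j, ∫ κ, κ (0, j) * F (κ, j) ∂ν := by
  have hp : ∀ j : Fin d, Measurable fun κ : EdgeConfig d => (κ, j) := fun j => by fun_prop
  rw [fieldMeasure_eq_sum] at hF ⊢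
  rw [integral_finsetSum_measure fun j hj => integrable_finsetSum_measure.1 hF j hj]
  refine Finset.sum_congr rfl fun j _ => ?_
  rw [integral_map (hp j).aemeasurable hFm.aestronglyMeasurable,
    integral_withDensity_eq_integral_toReal_smul (measurable_pi_apply (0, j)).ennreal_ofReal
      (.of_forall fun _ => ENNReal.ofReal_lt_top)]
  refine integral_congr_ae ?_
  filter_upwards [hκ] with κ h
  rw [ENNReal.toReal_ofReal (h _), smul_eq_mul]

section

variable {ν : Measure (EdgeConfig d)} {a b : ℝ}

theorem isFiniteMeasure_fieldMeasure [IsFiniteMeasure ν]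
    (hκ : ∀ᵐ κ ∂ν, ∀ e, κ e ∈ Set.Icc a b) : IsFiniteMeasure (fieldMeasure ν) := by
  refine ⟨?_⟩
  rw [← lintegral_one, lintegral_fieldMeasure ν (F := fun _ => 1) measurable_const]
  refine ENNReal.sum_lt_top.2 fun j _ => ?_
  calc _ ≤ ∫⁻ _, ENNReal.ofReal b ∂ν := by
        refine lintegral_mono_ae ?_
        filter_upwards [hκ] with κ h
        simpa using ENNReal.ofReal_le_ofReal (h (0, j)).2
    _ < ∞ := by
        rw [lintegral_const]
        exact ENNReal.mul_lt_top ENNReal.ofReal_lt_top (measure_lt_top _ _)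

/-- The lower bound on the conductances transfers estimates and null sets from the weighted measure
on fields to ν, one direction at a time. -/
theorem mul_lintegral_le_lintegral_fieldMeasure [SFinite ν]
    (hκ : ∀ᵐ κ ∂ν, ∀ e, κ e ∈ Set.Icc a b) {F : EdgeConfig d × Fin d → ℝ≥0∞} (hF : Measurable F)
    (j : Fin d) :
    ENNReal.ofReal a * ∫⁻ κ, F (κ, j) ∂ν ≤ ∫⁻ p, F p ∂fieldMeasure ν := by
  have hp : ∀ j : Fin d, Measurable fun κ : EdgeConfig d => (κ, j) := fun j => by fun_prop
  have hFj : Measurable fun κ : EdgeConfig d => F (κ, j) := hF.comp (hp j)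
  rw [lintegral_fieldMeasure ν hF, ← lintegral_const_mul _ hFj]
  refine le_trans ?_ (Finset.single_le_sum
    (f := fun j => ∫⁻ κ, ENNReal.ofReal (κ (0, j)) * F (κ, j) ∂ν) (fun _ _ => zero_le)
    (Finset.mem_univ j))
  refine lintegral_mono_ae ?_
  filter_upwards [hκ] with κ h
  gcongr
  exact (h _).1

theorem ae_of_ae_fieldMeasure [SFinite ν] (ha : 0 < a)
    (hκ : ∀ᵐ κ ∂ν, ∀ e, κ e ∈ Set.Icc a b) {P : EdgeConfig d × Fin d → Prop}
    (h : ∀ᵐ p ∂fieldMeasure ν, P p) (j : Fin d) : ∀ᵐ κ ∂ν, P (κ, j) := by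
  obtain ⟨A, hA, hAm, hA0⟩ := exists_measurable_superset_of_null (ae_iff.1 h)
  have h1 := mul_lintegral_le_lintegral_fieldMeasure hκ
    (measurable_one.indicator hAm :
      Measurable (A.indicator (1 : EdgeConfig d × Fin d → ℝ≥0∞))) j
  rw [lintegral_indicator_one hAm, hA0, nonpos_iff_eq_zero, mul_eq_zero,
    or_iff_right (ENNReal.ofReal_pos.2 ha).ne'] at h1
  have hp : Measurable fun κ : EdgeConfig d => (κ, j) := by fun_prop
  have hm : Measurable fun κ : EdgeConfig d =>
      A.indicator (1 : EdgeConfig d × Fin d → ℝ≥0∞) (κ, j) := (measurable_one.indicator hAm).comp hp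
  rw [lintegral_eq_zero_iff hm] at h1
  filter_upwards [h1] with κ hk
  by_contra hP
  have : (κ, j) ∈ A := hA hP
  simp [this] at hk

theorem exists_isLocal_of_mem_span [IsFiniteMeasure ν] {u : VectorFields ν}
    (hu : u ∈ Submodule.span ℝ {u : VectorFields ν | ∃ h, IsLocal ν h ∧
      u =ᵐ[fieldMeasure ν] fun p => h (shift (unit p.2) p.1) - h p.1}) :
    ∃ h, IsLocal ν h ∧ u =ᵐ[fieldMeasure ν] fun p => h (shift (unit p.2) p.1) - h p.1 := by
  classical
  induction hu using Submodule.span_induction with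
  | mem u hu => exact hu
  | zero =>
    refine ⟨0, ⟨measurable_zero, ⟨∅, fun _ _ _ => rfl⟩, MemLp.zero⟩, ?_⟩
    filter_upwards [Lp.coeFn_zero (Vec d) 2 (fieldMeasure ν)] with p hp
    rw [hp]
    simp
  | add u v _ _ hu hv =>
    obtain ⟨h, ⟨hm, ⟨S, hS⟩, hL⟩, hh⟩ := hu
    obtain ⟨k, ⟨km, ⟨T, hT⟩, kL⟩, hk⟩ := hv
    refine ⟨h + k, ⟨hm.add km, ⟨S ∪ T, fun x y hxy => ?_⟩, hL.add kL⟩, ?_⟩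
    · simp only [Pi.add_apply]
      rw [hS fun i hi => hxy i (by simp [Finset.mem_coe.1 hi]),
        hT fun i hi => hxy i (by simp [Finset.mem_coe.1 hi])]
    · filter_upwards [Lp.coeFn_add u v, hh, hk] with p hp h1 h2
      rw [hp, Pi.add_apply, h1, h2, Pi.add_apply, Pi.add_apply]
      abel
  | smul c u _ hu =>
    obtain ⟨h, ⟨hm, ⟨S, hS⟩, hL⟩, hh⟩ := hu
    refine ⟨c • h, ⟨hm.const_smul c, ⟨S, fun x y hxy => ?_⟩, hL.const_smul c⟩, ?_⟩
    · simp only [Pi.smul_apply]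
      rw [hS hxy]
    · filter_upwards [Lp.coeFn_smul c u, hh] with p hp h1
      rw [hp, Pi.smul_apply, h1, Pi.smul_apply, Pi.smul_apply, smul_sub]

/-- Elements of `L²_∇` are `L¹`-limits of gradients of local functions. -/
theorem exists_isLocal_lintegral_sub_le [IsFiniteMeasure ν] (ha : 0 < a)
    (hκ : ∀ᵐ κ ∂ν, ∀ e, κ e ∈ Set.Icc a b) {u : VectorFields ν} (hu : u ∈ gradientFields ν)
    {ε : ℝ≥0∞} (hε : ε ≠ 0) :
    ∃ h, IsLocal ν h ∧ ∀ j, ∫⁻ κ, ‖u (κ, j) - (h (shift (unit j) κ) - h κ)‖ₑ ∂ν ≤ ε := by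
  have := isFiniteMeasure_fieldMeasure hκ
  set M : ℝ≥0∞ := fieldMeasure ν Set.univ ^ ((1 : ℝ) / 2) with hM
  have hMtop : M ≠ ∞ := ENNReal.rpow_ne_top_of_nonneg (by norm_num) (measure_ne_top _ _)
  have ha' : ENNReal.ofReal a ≠ 0 := (ENNReal.ofReal_pos.2 ha).ne'
  -- The L² accuracy is chosen to absorb both the factor 1/a and the constant M from Hölder's
  -- inequality; M + 1 is used because M may vanish.
  obtain ⟨ε', hε', hle⟩ : ∃ ε' : ℝ≥0∞, 0 < ε' ∧ (ENNReal.ofReal a)⁻¹ * (ε' * M) ≤ ε := by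
    refine ⟨ε * ENNReal.ofReal a / (M + 1), ENNReal.div_pos (mul_ne_zero hε ha')
      (ENNReal.add_ne_top.2 ⟨hMtop, ENNReal.one_ne_top⟩), ?_⟩
    calc (ENNReal.ofReal a)⁻¹ * (ε * ENNReal.ofReal a / (M + 1) * M)
        ≤ (ENNReal.ofReal a)⁻¹ * (ε * ENNReal.ofReal a / (M + 1) * (M + 1)) := by
          gcongr; exact le_self_add
      _ = (ENNReal.ofReal a)⁻¹ * ENNReal.ofReal a * ε := by
          rw [ENNReal.div_mul_cancel (by simp) (ENNReal.add_ne_top.2 ⟨hMtop, ENNReal.one_ne_top⟩)]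
          ring
      _ = ε := by rw [ENNReal.inv_mul_cancel ha' ENNReal.ofReal_ne_top, one_mul]
  have hu' : u ∈ closure (Submodule.span ℝ {u : VectorFields ν | ∃ h, IsLocal ν h ∧
      u =ᵐ[fieldMeasure ν] fun p => h (shift (unit p.2) p.1) - h p.1} : Set (VectorFields ν)) := hu
  obtain ⟨v, hv, huv⟩ := EMetric.mem_closure_iff.1 hu' ε' hε'
  obtain ⟨h, hloc, hh⟩ := exists_isLocal_of_mem_span hv
  refine ⟨h, hloc, fun j => ?_⟩
  have hum : Measurable u := (Lp.stronglyMeasurable u).measurable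
  have hvm : Measurable v := (Lp.stronglyMeasurable v).measurable
  calc ∫⁻ κ, ‖u (κ, j) - (h (shift (unit j) κ) - h κ)‖ₑ ∂ν
      = ∫⁻ κ, ‖u (κ, j) - v (κ, j)‖ₑ ∂ν := by
        refine lintegral_congr_ae ?_
        filter_upwards [ae_of_ae_fieldMeasure ha hκ hh j] with κ h1
        rw [h1]
    _ ≤ (ENNReal.ofReal a)⁻¹ * ∫⁻ p, ‖u p - v p‖ₑ ∂fieldMeasure ν := by
        rw [← ENNReal.mul_le_iff_le_inv ha' ENNReal.ofReal_ne_top]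
        exact mul_lintegral_le_lintegral_fieldMeasure hκ (hum.sub hvm).enorm j
    _ ≤ (ENNReal.ofReal a)⁻¹ * (ε' * M) := by
        gcongr
        have h2 := eLpNorm_le_eLpNorm_mul_rpow_measure_univ (p := 1) (q := 2) one_le_two
          (μ := fieldMeasure ν) (hum.sub hvm).aestronglyMeasurable
        rw [eLpNorm_one_eq_lintegral_enorm] at h2
        refine h2.trans ?_
        have h3 : eLpNorm (⇑u - ⇑v) 2 (fieldMeasure ν) ≤ ε' := by
          rw [← Lp.edist_def]
          exact huv.le
        refine mul_le_mul' h3 (le_of_eq ?_)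
        rw [hM]
        norm_num
    _ ≤ ε := hle

end

/-! ### The corrector -/

/-- The component of the corrector in the direction `t`, as a gradient field. -/
def correctorIncrement (ν : Measure (EdgeConfig d)) (t : Vec d) (κ : EdgeConfig d) :
    EdgeConfig d :=
  fun e => ⟪t, correctorField ν (shift e.1 κ, e.2)⟫

/-- The gradient of the height function `t · (x + χ̄(κ, x))`. -/
def meanIncrement (ν : Measure (EdgeConfig d)) (t : Vec d) (κ : EdgeConfig d) : EdgeConfig d :=
  (fun e => ⟪t, toVec (unit e.2)⟫) + correctorIncrement ν t κ

theorem measurable_correctorIncrement (ν : Measure (EdgeConfig d)) (t : Vec d) :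
    Measurable (correctorIncrement ν t) := by
  refine measurable_pi_lambda _ fun e => ?_
  have h1 : Measurable (correctorField ν) := (Lp.stronglyMeasurable _).measurable
  have h2 : Measurable fun κ : EdgeConfig d => (shift e.1 κ, e.2) :=
    (measurable_shift e.1).prodMk measurable_const
  exact (measurable_const (a := t)).inner (h1.comp h2)

theorem measurable_meanIncrement (ν : Measure (EdgeConfig d)) (t : Vec d) :
    Measurable (meanIncrement ν t) :=
  (measurable_const (a := fun e : Edge d => ⟪t, toVec (unit e.2)⟫)).add
    (measurable_correctorIncrement ν t)

theorem correctorIncrement_shift (ν : Measure (EdgeConfig d)) (t : Vec d) (x : Site d)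
    (κ : EdgeConfig d) :
    correctorIncrement ν t (shift x κ) = shift x (correctorIncrement ν t κ) := by
  ext e
  simp only [correctorIncrement, shift_shift]
  rfl

theorem meanIncrement_shift (ν : Measure (EdgeConfig d)) (t : Vec d) (x : Site d)
    (κ : EdgeConfig d) : meanIncrement ν t (shift x κ) = shift x (meanIncrement ν t κ) := by
  rw [meanIncrement, correctorIncrement_shift]
  rfl

theorem height_meanIncrement (ν : Measure (EdgeConfig d)) (t : Vec d) (κ : EdgeConfig d)
    (x : Site d) : height (meanIncrement ν t κ) x = ⟪t, toVec x + corrector ν κ x⟫ := by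
  rw [height, meanIncrement, pathSum_add, pathSum_tilt, inner_add_right, corrector, ← pathSum_inner]
  rfl

section

variable {ν : Measure (EdgeConfig d)} {a b : ℝ}

/-- Approximation of the corrector field by one local gradient at the origin spreads to all edges by
stationarity. The resulting bound is uniform in the edge, which yields sublinearity later. -/
theorem exists_lintegral_correctorIncrement_sub_le [IsProbabilityMeasure ν] (ha : 0 < a)
    (hκ : ∀ᵐ κ ∂ν, ∀ e, κ e ∈ Set.Icc a b) (hν : IsTranslationInvariant ν) (t : Vec d)
    {ε : ℝ≥0∞} (hε : ε ≠ 0) :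
    ∃ H : EdgeConfig d → ℝ, Measurable H ∧ Integrable H ν ∧ ∀ e, ∫⁻ κ, ‖correctorIncrement ν t κ e -
      grad (fun x => H (shift x κ)) e‖ₑ ∂ν ≤ ε := by
  have hmem : correctorField ν ∈ gradientFields ν :=
    Submodule.neg_mem _ (Submodule.starProjection_apply_mem _ _)
  have ht : ‖t‖ₑ + 1 ≠ ∞ := ENNReal.add_ne_top.2 ⟨enorm_ne_top, ENNReal.one_ne_top⟩
  obtain ⟨h, ⟨hm, -, hL⟩, hh⟩ := exists_isLocal_lintegral_sub_le ha hκ hmem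
    (ε := ε / (‖t‖ₑ + 1)) (ENNReal.div_pos hε ht).ne'
  refine ⟨fun κ => ⟪t, h κ⟫, (measurable_const (a := t)).inner hm,
    (hL.integrable one_le_two).const_inner t, fun e => ?_⟩
  have hcm : Measurable (correctorField ν) := (Lp.stronglyMeasurable _).measurable
  have hm1 : Measurable fun κ : EdgeConfig d =>
      ‖correctorField ν (κ, e.2) - (h (shift (unit e.2) κ) - h κ)‖ₑ := by
    have h2 : Measurable fun κ : EdgeConfig d => (κ, e.2) := measurable_id.prodMk measurable_const
    exact ((hcm.comp h2).sub ((hm.comp (measurable_shift _)).sub hm)).enorm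
  have hmp : MeasurePreserving (shift e.1) ν ν := ⟨measurable_shift _, hν _⟩
  calc ∫⁻ κ, ‖correctorIncrement ν t κ e - grad (fun x => ⟪t, h (shift x κ)⟫) e‖ₑ ∂ν
      ≤ ∫⁻ κ, ‖t‖ₑ * ‖correctorField ν (shift e.1 κ, e.2) -
          (h (shift (unit e.2) (shift e.1 κ)) - h (shift e.1 κ))‖ₑ ∂ν := by
        refine lintegral_mono fun κ => ?_
        simp only [correctorIncrement, grad, shift_shift, ← inner_sub_right, add_comm (unit e.2)]
        rw [← ofReal_norm, ← ofReal_norm, ← ofReal_norm, ← ENNReal.ofReal_mul (norm_nonneg _)]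
        exact ENNReal.ofReal_le_ofReal (norm_inner_le_norm _ _)
    _ = ‖t‖ₑ * ∫⁻ κ, ‖correctorField ν (κ, e.2) - (h (shift (unit e.2) κ) - h κ)‖ₑ ∂ν := by
        rw [lintegral_const_mul' _ _ enorm_ne_top, ← hmp.lintegral_comp hm1]
    _ ≤ (‖t‖ₑ + 1) * (ε / (‖t‖ₑ + 1)) := mul_le_mul' le_self_add (hh e.2)
    _ = ε := ENNReal.mul_div_cancel (by simp) ht

/-- Loop sums vanish for genuine gradients, and approximating each of the four edges to within ε/4
in L¹ leaves a mean loop sum of at most ε. -/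
theorem ae_loopCondition_correctorIncrement [IsProbabilityMeasure ν] (ha : 0 < a)
    (hκ : ∀ᵐ κ ∂ν, ∀ e, κ e ∈ Set.Icc a b) (hν : IsTranslationInvariant ν) (t : Vec d) :
    ∀ᵐ κ ∂ν, LoopCondition (correctorIncrement ν t κ) := by
  have hSm : ∀ e, Measurable fun κ => correctorIncrement ν t κ e := fun e =>
    (measurable_pi_apply e).comp (measurable_correctorIncrement ν t)
  simp only [LoopCondition, ae_all_iff]
  intro x i j
  set D : EdgeConfig d → EdgeConfig d := correctorIncrement ν t with hD
  have hDm : Measurable fun κ : EdgeConfig d =>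
      ‖D κ (x, i) + D κ (x + unit i, j) - D κ (x + unit j, i) - D κ (x, j)‖ₑ :=
    ((((hSm _).add (hSm _)).sub (hSm _)).sub (hSm _)).enorm
  suffices h0 : ∫⁻ κ, ‖D κ (x, i) + D κ (x + unit i, j) - D κ (x + unit j, i) - D κ (x, j)‖ₑ ∂ν = 0 by
    rw [lintegral_eq_zero_iff hDm] at h0
    filter_upwards [h0] with κ hk
    simpa using hk
  refine nonpos_iff_eq_zero.1 (ENNReal.le_of_forall_pos_le_add fun ε hε _ => ?_)
  obtain ⟨H, hHm, -, hH⟩ := exists_lintegral_correctorIncrement_sub_le ha hκ hν t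
    (ε := ε / 4) (by simp [hε.ne'])
  set G : EdgeConfig d → EdgeConfig d := fun κ => grad fun x => H (shift x κ) with hG
  have hGm : ∀ e, Measurable fun κ => G κ e := fun e =>
    (hHm.comp (measurable_shift _)).sub (hHm.comp (measurable_shift _))
  have hm : ∀ e, Measurable fun κ => ‖D κ e - G κ e‖ₑ := fun e => ((hSm e).sub (hGm e)).enorm
  calc _ ≤ ∫⁻ κ, (‖D κ (x, i) - G κ (x, i)‖ₑ + ‖D κ (x + unit i, j) - G κ (x + unit i, j)‖ₑ +
        ‖D κ (x + unit j, i) - G κ (x + unit j, i)‖ₑ + ‖D κ (x, j) - G κ (x, j)‖ₑ) ∂ν := by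
        refine lintegral_mono fun κ => ?_
        have h1 : G κ (x, i) + G κ (x + unit i, j) - G κ (x + unit j, i) - G κ (x, j) = 0 :=
          loopCondition_grad _ x i j
        have h2 : D κ (x, i) + D κ (x + unit i, j) - D κ (x + unit j, i) - D κ (x, j) =
            (D κ (x, i) - G κ (x, i)) + (D κ (x + unit i, j) - G κ (x + unit i, j)) -
            (D κ (x + unit j, i) - G κ (x + unit j, i)) - (D κ (x, j) - G κ (x, j)) := by
          linarith
        rw [h2]
        refine (enorm_sub_le).trans (add_le_add_left ((enorm_sub_le).trans
          (add_le_add_left (enorm_add_le _ _) _)) _)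
    _ ≤ ε / 4 + ε / 4 + ε / 4 + ε / 4 := by
        rw [lintegral_add_right _ (hm _), lintegral_add_right _ (hm _), lintegral_add_right _ (hm _)]
        gcongr <;> exact hH _
    _ = 0 + ε := by
        rw [zero_add, show (ε : ℝ≥0∞) / 4 + ε / 4 + ε / 4 + ε / 4 = 4 * (ε / 4) by ring]
        exact ENNReal.mul_div_cancel (by norm_num) (by norm_num)

theorem ae_loopCondition_meanIncrement [IsProbabilityMeasure ν] (ha : 0 < a)
    (hκ : ∀ᵐ κ ∂ν, ∀ e, κ e ∈ Set.Icc a b) (hν : IsTranslationInvariant ν) (t : Vec d) :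
    ∀ᵐ κ ∂ν, LoopCondition (meanIncrement ν t κ) := by
  filter_upwards [ae_loopCondition_correctorIncrement ha hκ hν t] with κ h x i j
  have := h x i j
  simp only [meanIncrement, Pi.add_apply]
  linarith

/-- The corrector is sublinear in mean. -/
theorem lintegral_pathSum_correctorIncrement_le [IsProbabilityMeasure ν] (ha : 0 < a)
    (hκ : ∀ᵐ κ ∂ν, ∀ e, κ e ∈ Set.Icc a b) (hν : IsTranslationInvariant ν) (t : Vec d)
    {δ : ℝ} (hδ : 0 < δ) :
    ∃ C, 0 ≤ C ∧ ∀ x : Site d, ∫⁻ κ, ‖height (correctorIncrement ν t κ) x‖ₑ ∂ν ≤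
      ENNReal.ofReal (C + δ * ‖x‖) := by
  have hSm : ∀ e, Measurable fun κ => correctorIncrement ν t κ e := fun e =>
    (measurable_pi_apply e).comp (measurable_correctorIncrement ν t)
  have hδ' : 0 < δ / (d + 1) := by positivity
  obtain ⟨H, hHm, hHi, hH⟩ := exists_lintegral_correctorIncrement_sub_le ha hκ hν t
    (ENNReal.ofReal_pos.2 hδ').ne'
  have hmp : ∀ x : Site d, MeasurePreserving (shift x) ν ν := fun x => ⟨measurable_shift x, hν x⟩
  set D : EdgeConfig d → EdgeConfig d := fun κ =>
    correctorIncrement ν t κ - grad fun x => H (shift x κ) with hD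
  have hDm : ∀ e, Measurable fun κ => D κ e := fun e => (hSm e).sub
    ((hHm.comp (measurable_shift _)).sub (hHm.comp (measurable_shift _)))
  have hH0 : ∫⁻ κ, ‖H κ‖ₑ ∂ν ≠ ∞ := hHi.2.ne
  refine ⟨2 * (∫⁻ κ, ‖H κ‖ₑ ∂ν).toReal, by positivity, fun x => ?_⟩
  choose z hz using exists_pathSum_eq_sum_range x
  have hm1 : ∀ e, Measurable fun κ => ‖D κ e‖ₑ := fun e => (hDm e).enorm
  calc ∫⁻ κ, ‖height (correctorIncrement ν t κ) x‖ₑ ∂ν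
      ≤ ∫⁻ κ, (∑ i, ∑ k ∈ Finset.range (x i).natAbs, ‖D κ (Pi.single i (k : ℤ) + z i, i)‖ₑ +
          (‖H (shift x κ)‖ₑ + ‖H κ‖ₑ)) ∂ν := by
        refine lintegral_mono fun κ => ?_
        -- The approximating gradient telescopes to two values of H, whose mean is bounded
        -- independently of x; only the small error D accumulates along the path.
        have h1 : height (correctorIncrement ν t κ) x =
            pathSum (D κ) x + (H (shift x κ) - H κ) := by
          have h2 := height_grad (fun x => H (shift x κ)) x
          have h3 : shift 0 κ = κ := by ext e; simp [shift]
          simp only [h3] at h2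
          rw [← h2, height, height, ← pathSum_add, hD]
          simp
        rw [h1]
        refine (enorm_add_le _ _).trans (add_le_add ?_ enorm_sub_le)
        refine (enorm_sum_le _ _).trans (Finset.sum_le_sum fun i _ => ?_)
        refine le_trans (le_of_eq ?_) (enorm_sum_le _ _)
        rw [← ofReal_norm, ← ofReal_norm, Real.norm_eq_abs, Real.norm_eq_abs, hz i]
        rfl
    _ = ∑ i, ∑ k ∈ Finset.range (x i).natAbs, ∫⁻ κ, ‖D κ (Pi.single i (k : ℤ) + z i, i)‖ₑ ∂ν +
          (∫⁻ κ, ‖H κ‖ₑ ∂ν + ∫⁻ κ, ‖H κ‖ₑ ∂ν) := by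
        rw [lintegral_add_left, lintegral_finsetSum, lintegral_add_right _ hHm.enorm,
          (hmp x).lintegral_comp hHm.enorm]
        · congr 1
          exact Finset.sum_congr rfl fun i _ => lintegral_finsetSum _ fun k _ => hm1 _
        · exact fun i _ => Finset.measurable_fun_sum _ fun k _ => hm1 _
        · exact Finset.measurable_fun_sum _ fun i _ => Finset.measurable_fun_sum _ fun k _ => hm1 _
    _ ≤ ∑ i, ∑ k ∈ Finset.range (x i).natAbs, ENNReal.ofReal (δ / (d + 1)) +
          ENNReal.ofReal (2 * (∫⁻ κ, ‖H κ‖ₑ ∂ν).toReal) := by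
        refine add_le_add (Finset.sum_le_sum fun i _ => Finset.sum_le_sum fun k _ => hH _) ?_
        rw [ENNReal.ofReal_mul zero_le_two, ENNReal.ofReal_toReal hH0, ← two_mul]
        simp
    _ ≤ ENNReal.ofReal (2 * (∫⁻ κ, ‖H κ‖ₑ ∂ν).toReal + δ * ‖x‖) := by
        rw [ENNReal.ofReal_add (by positivity) (by positivity), add_comm]
        gcongr
        simp only [Finset.sum_const, Finset.card_range, nsmul_eq_mul]
        calc ∑ i, ((x i).natAbs : ℝ≥0∞) * ENNReal.ofReal (δ / (d + 1))
            = ENNReal.ofReal (∑ i, δ / (d + 1) * ((x i).natAbs : ℝ)) := by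
              rw [ENNReal.ofReal_sum_of_nonneg fun i _ => by positivity]
              refine Finset.sum_congr rfl fun i _ => ?_
              rw [ENNReal.ofReal_mul hδ'.le, ENNReal.ofReal_natCast, mul_comm]
          _ ≤ ENNReal.ofReal (δ * ‖x‖) := ENNReal.ofReal_le_ofReal (sum_mul_natAbs_le hδ.le x)

theorem integrable_correctorIncrement [IsProbabilityMeasure ν] (ha : 0 < a)
    (hκ : ∀ᵐ κ ∂ν, ∀ e, κ e ∈ Set.Icc a b) (hν : IsTranslationInvariant ν) (t : Vec d)
    (e : Edge d) : Integrable (fun κ => correctorIncrement ν t κ e) ν := by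
  obtain ⟨H, hHm, hHi, hH⟩ := exists_lintegral_correctorIncrement_sub_le ha hκ hν t one_ne_zero
  have hmp : ∀ x : Site d, MeasurePreserving (shift x) ν ν := fun x => ⟨measurable_shift x, hν x⟩
  have hSm : Measurable fun κ => correctorIncrement ν t κ e :=
    (measurable_pi_apply e).comp (measurable_correctorIncrement ν t)
  have h1 : Integrable (fun κ => grad (fun x => H (shift x κ)) e) ν :=
    ((hmp _).integrable_comp_of_integrable hHi).sub ((hmp _).integrable_comp_of_integrable hHi)
  have h2 : Integrable (fun κ => correctorIncrement ν t κ e - grad (fun x => H (shift x κ)) e) ν :=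
    ⟨(hSm.aestronglyMeasurable.sub h1.1), (hH e).trans_lt ENNReal.one_lt_top⟩
  exact (h2.add h1).congr (.of_forall fun κ => sub_add_cancel _ _)

/-- An integrable function whose integrals over all cylinders vanish is zero. -/
theorem ae_eq_zero_of_forall_cylinder [IsFiniteMeasure ν] {D : EdgeConfig d → ℝ}
    (hD : Integrable D ν)
    (h : ∀ B ∈ measurableCylinders fun _ : Edge d => ℝ, ∫ κ in B, D κ ∂ν = 0) : D =ᵐ[ν] 0 := by
  refine hD.ae_eq_zero_of_forall_setIntegral_eq_zero fun A hA _ => ?_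
  induction A, hA using MeasurableSpace.induction_on_inter
    (generateFrom_measurableCylinders (α := fun _ : Edge d => ℝ)).symm
    isPiSystem_measurableCylinders with
  | empty => simp
  | basic B hB => exact h B hB
  | compl B hB ih =>
    have h1 := integral_add_compl hB hD
    have h2 := h Set.univ ((mem_measurableCylinders _).2 ⟨∅, Set.univ, .univ, by simp⟩)
    rw [setIntegral_univ] at h2
    rw [ih (measure_lt_top _ _), zero_add] at h1
    exact h1.trans h2
  | iUnion f hdisj hm ih =>
    rw [integral_iUnion hm hdisj hD.integrableOn]
    simp [ih]

theorem memLp_positionField [IsFiniteMeasure (fieldMeasure ν)] :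
    MemLp (fun p : EdgeConfig d × Fin d => toVec (unit p.2)) 2 (fieldMeasure ν) := by
  refine MemLp.of_bound (C := ∑ j : Fin d, ‖toVec (unit j)‖)
    (measurable_from_prod_countable_left fun j =>
      measurable_const (a := toVec (unit j))).aestronglyMeasurable
    (.of_forall fun p => ?_)
  exact Finset.single_le_sum (f := fun j : Fin d => ‖toVec (unit j)‖) (fun _ _ => norm_nonneg _)
    (Finset.mem_univ p.2)

theorem isLocal_indicator [IsFiniteMeasure ν] (t : Vec d) {B : Set (EdgeConfig d)}
    (hB : B ∈ measurableCylinders fun _ : Edge d => ℝ) :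
    IsLocal ν (B.indicator fun _ => t) := by
  have hhm : Measurable (B.indicator fun _ : EdgeConfig d => t) :=
    measurable_const.indicator (MeasurableSet.of_mem_measurableCylinders hB)
  obtain ⟨S, A, hA, hBS⟩ := (mem_measurableCylinders _).1 hB
  refine ⟨hhm, ⟨S, fun x y hxy => ?_⟩, MemLp.of_bound hhm.aestronglyMeasurable ‖t‖
    (.of_forall fun κ => norm_indicator_le_norm_self _ _)⟩
  have h1 : x ∈ B ↔ y ∈ B := by
    rw [hBS, mem_cylinder, mem_cylinder]
    have h2 : S.restrict x = S.restrict y := funext fun i => hxy i i.2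
    rw [h2]
  by_cases hx : x ∈ B
  · rw [Set.indicator_of_mem hx, Set.indicator_of_mem (h1.1 hx)]
  · rw [Set.indicator_of_notMem hx, Set.indicator_of_notMem fun hy => hx (h1.2 hy)]

theorem inner_position_add_corrector {h : EdgeConfig d → Vec d} (hh : IsLocal ν h)
    (w : VectorFields ν)
    (hw : w =ᵐ[fieldMeasure ν] fun p => h (shift (unit p.2) p.1) - h p.1) :
    ⟪w, positionField ν + correctorField ν⟫ = 0 := by
  have hmem : w ∈ gradientFields ν :=
    Submodule.le_topologicalClosure _ (Submodule.subset_span ⟨h, hh, hw⟩)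
  have := Submodule.sub_starProjection_mem_orthogonal (K := gradientFields ν) (positionField ν)
  rw [sub_eq_add_neg] at this
  exact (Submodule.mem_orthogonal _ _).1 this _ hmem

theorem coeFn_position_add_corrector [IsFiniteMeasure (fieldMeasure ν)] (t : Vec d) :
    (fun p => ⟪t, (positionField ν + correctorField ν : VectorFields ν) p⟫) =ᵐ[fieldMeasure ν]
      fun p => meanIncrement ν t p.1 (0, p.2) := by
  have hpos : positionField ν =ᵐ[fieldMeasure ν] fun p => toVec (unit p.2) := by
    rw [positionField, dif_pos memLp_positionField]
    exact MemLp.coeFn_toLp _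
  filter_upwards [Lp.coeFn_add (positionField ν) (correctorField ν), hpos] with p h2 h3
  have h5 : shift 0 p.1 = p.1 := by ext e; simp [shift]
  rw [h2, Pi.add_apply, h3, inner_add_right]
  simp only [meanIncrement, Pi.add_apply, correctorIncrement, h5]

/-- The field `x + χ` is orthogonal to gradients of indicators of cylinders. -/
theorem sum_integral_meanIncrement_eq_zero [IsProbabilityMeasure ν] (ha : 0 < a)
    (hκ : ∀ᵐ κ ∂ν, ∀ e, κ e ∈ Set.Icc a b) (t : Vec d)
    {B : Set (EdgeConfig d)} (hB : B ∈ measurableCylinders fun _ : Edge d => ℝ) :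
    ∑ j, ∫ κ, κ (0, j) * (meanIncrement ν t κ (0, j) *
      (B.indicator 1 (shift (unit j) κ) - B.indicator 1 κ)) ∂ν = 0 := by
  have := isFiniteMeasure_fieldMeasure hκ
  have hBm : MeasurableSet B := MeasurableSet.of_mem_measurableCylinders hB
  -- Taking the constant vector t on B extracts the component along t from the vector-valued
  -- orthogonality relation.
  obtain ⟨h, hh⟩ : ∃ h : EdgeConfig d → Vec d, h = B.indicator fun _ => t := ⟨_, rfl⟩
  have hloc : IsLocal ν h := hh ▸ isLocal_indicator t hB
  have hhb : ∀ κ, ‖h κ‖ ≤ ‖t‖ := fun κ => hh ▸ norm_indicator_le_norm_self _ _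
  have h4 : ∀ κ, h κ = (B.indicator 1 κ : ℝ) • t := fun κ => by
    by_cases hk : κ ∈ B
    · rw [hh, Set.indicator_of_mem hk, Set.indicator_of_mem hk, Pi.one_apply, one_smul]
    · rw [hh, Set.indicator_of_notMem hk, Set.indicator_of_notMem hk, zero_smul]
  have hwm : Measurable fun p : EdgeConfig d × Fin d => h (shift (unit p.2) p.1) - h p.1 :=
    measurable_from_prod_countable_left fun j =>
      (hloc.1.comp (measurable_shift (unit j))).sub hloc.1
  have hwL : MemLp (fun p : EdgeConfig d × Fin d => h (shift (unit p.2) p.1) - h p.1) 2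
      (fieldMeasure ν) := MemLp.of_bound hwm.aestronglyMeasurable (‖t‖ + ‖t‖)
    (.of_forall fun p => (norm_sub_le _ _).trans (add_le_add (hhb _) (hhb _)))
  obtain ⟨w, hw⟩ : ∃ w : VectorFields ν, w =ᵐ[fieldMeasure ν]
      fun p => h (shift (unit p.2) p.1) - h p.1 := ⟨hwL.toLp _, hwL.coeFn_toLp⟩
  have horth := inner_position_add_corrector hloc w hw
  have hFm : Measurable fun p : EdgeConfig d × Fin d => meanIncrement ν t p.1 (0, p.2) *
      (B.indicator 1 (shift (unit p.2) p.1) - B.indicator 1 p.1) :=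
    measurable_from_prod_countable_left fun j => by
      have h1 : Measurable fun κ => meanIncrement ν t κ (0, j) :=
        (measurable_pi_apply _).comp (measurable_meanIncrement ν t)
      have h2 : Measurable (B.indicator (1 : EdgeConfig d → ℝ)) := measurable_one.indicator hBm
      exact h1.mul ((h2.comp (measurable_shift (unit j))).sub h2)
  have hFae : (fun p => ⟪w p, (positionField ν + correctorField ν : VectorFields ν) p⟫)
      =ᵐ[fieldMeasure ν] fun p => meanIncrement ν t p.1 (0, p.2) *
      (B.indicator 1 (shift (unit p.2) p.1) - B.indicator 1 p.1) := by
    filter_upwards [hw, coeFn_position_add_corrector t] with p h1 h2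
    rw [h1, ← h2, h4, h4, ← sub_smul, real_inner_smul_left, mul_comm]
  have hFi := (L2.integrable_inner (𝕜 := ℝ) w (positionField ν + correctorField ν)).congr hFae
  rw [L2.inner_def, integral_congr_ae hFae, integral_fieldMeasure
    (hκ.mono fun κ h e => ha.le.trans (h e).1) hFm hFi] at horth
  exact horth

/-- The height function `t · (x + χ̄(κ, x))` is harmonic. -/
theorem ae_generator_height_meanIncrement [IsProbabilityMeasure ν] (ha : 0 < a)
    (hκ : ∀ᵐ κ ∂ν, ∀ e, κ e ∈ Set.Icc a b) (hν : IsTranslationInvariant ν) (t : Vec d) :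
    ∀ᵐ κ ∂ν, ∀ x, generator κ (height (meanIncrement ν t κ)) x = 0 := by
  have hmp : ∀ x : Site d, MeasurePreserving (shift x) ν ν := fun x => ⟨measurable_shift x, hν x⟩
  set q : Fin d → EdgeConfig d → ℝ := fun j κ => κ (0, j) * meanIncrement ν t κ (0, j) with hq
  have hqi : ∀ j, Integrable (q j) ν := fun j => by
    refine Integrable.bdd_mul (c := b) ?_ (measurable_pi_apply _).aestronglyMeasurable ?_
    · exact (integrable_const _).add (integrable_correctorIncrement ha hκ hν t _)
    · filter_upwards [hκ] with κ h
      rw [Real.norm_eq_abs, abs_of_nonneg (ha.le.trans (h _).1)]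
      exact (h _).2
  -- The divergence at the origin of the flux κ·m, that is, the generator applied to the height
  -- function of m there. Translations carry the statement D = 0 to every site.
  set D : EdgeConfig d → ℝ := fun κ => ∑ j, (q j κ - q j (shift (-unit j) κ)) with hD
  have hqi' : ∀ j, Integrable (fun κ => q j (shift (-unit j) κ)) ν := fun j =>
    (hmp _).integrable_comp_of_integrable (hqi j)
  have hDi : Integrable D ν := integrable_finsetSum _ fun j _ => (hqi j).sub (hqi' j)
  have hD0 : D =ᵐ[ν] 0 := by
    refine ae_eq_zero_of_forall_cylinder hDi fun B hB => ?_
    have hBm : MeasurableSet B := MeasurableSet.of_mem_measurableCylinders hB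
    have h0 := sum_integral_meanIncrement_eq_zero ha hκ t hB
    have hpre : ∀ j, MeasurableSet (shift (unit j) ⁻¹' B) := fun j => measurable_shift _ hBm
    have hind : ∀ (B : Set (EdgeConfig d)) (g : EdgeConfig d → ℝ) (κ : EdgeConfig d),
        B.indicator g κ = B.indicator 1 κ * g κ := fun B g κ => by
      by_cases hk : κ ∈ B <;> simp [hk]
    have hind' : ∀ (x : Site d) (g : EdgeConfig d → ℝ) (κ : EdgeConfig d),
        (shift x ⁻¹' B).indicator g κ = B.indicator 1 (shift x κ) * g κ :=
      fun x g κ => hind (shift x ⁻¹' B) g κ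
    -- Stationary integration by parts: a shift of the integration variable moves the difference
    -- from the indicator to the flux. Summed over j, the orthogonality relation says that D
    -- integrates to zero over B.
    have h1 : ∀ j, ∫ κ, κ (0, j) * (meanIncrement ν t κ (0, j) *
        (B.indicator 1 (shift (unit j) κ) - B.indicator 1 κ)) ∂ν =
        ∫ κ in B, q j (shift (-unit j) κ) ∂ν - ∫ κ in B, q j κ ∂ν := fun j => by
      have h2 : ∫ κ in B, q j (shift (-unit j) κ) ∂ν =
          ∫ κ, (shift (unit j) ⁻¹' B).indicator (q j) κ ∂ν := by
        rw [← integral_indicator hBm]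
        conv_lhs => rw [← hν (unit j)]
        rw [integral_map (measurable_shift _).aemeasurable]
        · refine integral_congr_ae (.of_forall fun κ => ?_)
          have h3 : shift 0 κ = κ := by ext e; simp [shift]
          beta_reduce
          rw [hind B, hind']
          simp only [shift_shift, neg_add_cancel, h3]
        · rw [hν]
          exact ((hqi' j).indicator hBm).1
      rw [h2, ← integral_indicator hBm, ← integral_sub ((hqi j).indicator (hpre j))
        ((hqi j).indicator hBm)]
      refine integral_congr_ae (.of_forall fun κ => ?_)
      beta_reduce
      rw [hind B (q j), hind' (unit j) (q j)]
      simp only [hq]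
      ring
    simp only [h1, Finset.sum_sub_distrib] at h0
    have h5 : ∀ j, Integrable (fun κ => q j κ - q j (shift (-unit j) κ)) (ν.restrict B) := fun j =>
      ((hqi j).sub (hqi' j)).integrableOn
    simp only [hD]
    rw [integral_finsetSum _ fun j _ => h5 j,
      Finset.sum_congr rfl fun j _ => integral_sub (hqi j).integrableOn (hqi' j).integrableOn,
      Finset.sum_sub_distrib]
    linarith
  rw [ae_all_iff]
  intro x
  filter_upwards [(hmp x).quasiMeasurePreserving.ae hD0,
    ae_loopCondition_meanIncrement ha hκ hν t] with κ h1 h2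
  rw [generator_eq_sum, grad_height h2]
  simp only [hD, hq, shift_shift, meanIncrement_shift, Pi.zero_apply] at h1
  rw [← h1]
  refine Finset.sum_congr rfl fun j _ => ?_
  simp only [shift, zero_add, neg_add_eq_sub]

end

/-! ### Flatness of the harmonic extensions of the deviation from the mean -/

/-- If both values lie within the truncation level the truncation does nothing; otherwise |s| + |t|
≥ K and the second term is at least 1. -/
theorem sq_min_one_abs_sub_le {K : ℝ} (hK : 0 < K) (s t : ℝ) :
    min 1 |s - t| ^ 2 ≤ (truncate K s - truncate K t) ^ 2 + K⁻¹ * (|t| + |s|) := by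
  by_cases h : |s| ≤ K ∧ |t| ≤ K
  · rw [truncate_of_abs_le h.1, truncate_of_abs_le h.2, ← sq_abs (s - t)]
    have h1 : min 1 |s - t| ^ 2 ≤ |s - t| ^ 2 :=
      pow_le_pow_left₀ (le_min zero_le_one (abs_nonneg _)) (min_le_right _ _) 2
    have : 0 ≤ K⁻¹ * (|t| + |s|) := by positivity
    linarith
  · have h1 : min 1 |s - t| ^ 2 ≤ 1 :=
      pow_le_one₀ (le_min zero_le_one (abs_nonneg _)) (min_le_left _ _)
    have h2 : K ≤ |t| + |s| := by
      rw [not_and_or, not_le, not_le] at h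
      rcases h with h | h
      · linarith [abs_nonneg t]
      · linarith [abs_nonneg s]
    have h3 : 1 ≤ K⁻¹ * (|t| + |s|) := by
      rw [← inv_mul_cancel₀ hK.ne']
      gcongr
    nlinarith [sq_nonneg (truncate K s - truncate K t)]

/-- The level K is free: the energy term grows with K and the error of truncation decays. The choice
K = εn balances them for sublinear v. -/
theorem sum_sq_min_grad_le {κ : EdgeConfig d} {a b : ℝ} (ha : 0 < a)
    (hκ : ∀ e, κ e ∈ Set.Icc a b) {n : ℕ} (hn : 0 < n) {v : Site d → ℝ}
    (hv : ∀ x ∈ box d (2 * n), generator κ v x = 0) {K : ℝ} (hK : 0 < K) :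
    ∑ e ∈ box d n ×ˢ (Finset.univ : Finset (Fin d)), min 1 |grad v e| ^ 2 ≤
      b * K / (a * n) * ∑ e ∈ edgesTouching (box d (2 * n)), |grad v e| +
      K⁻¹ * ∑ e ∈ box d n ×ˢ (Finset.univ : Finset (Fin d)), (|v e.1| + |v (e.1 + unit e.2)|) := by
  have h1 := sum_sq_grad_truncate_le ha hκ hn hv hK.le
  rw [← le_div_iff₀' ha] at h1
  have h2 : ∑ e ∈ box d n ×ˢ (Finset.univ : Finset (Fin d)), min 1 |grad v e| ^ 2 ≤
      ∑ e ∈ box d n ×ˢ (Finset.univ : Finset (Fin d)), (grad (fun x => truncate K (v x)) e ^ 2 +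
        K⁻¹ * (|v e.1| + |v (e.1 + unit e.2)|)) :=
    Finset.sum_le_sum fun e _ => sq_min_one_abs_sub_le hK _ _
  rw [Finset.sum_add_distrib, ← Finset.mul_sum] at h2
  refine h2.trans (add_le_add_left (h1.trans (le_of_eq ?_)) _)
  field_simp

/-- A joint law of gradients `η` and conductances `κ` under which `η` fluctuates sublinearly around
a stationary `κ`-harmonic gradient field `m κ`, and which is invariant under shifts and under the
resampling of the heights in finite sets. -/
structure IsHarmonicDecomposition (μ' : Measure (EdgeConfig d × EdgeConfig d))
    (m : EdgeConfig d → EdgeConfig d) (a b : ℝ) : Prop where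
  pos : 0 < a
  bounds : ∀ᵐ p ∂μ', ∀ e, p.2 e ∈ Set.Icc a b
  loop : ∀ᵐ p ∂μ', LoopCondition p.1
  mean_loop : ∀ᵐ p ∂μ', LoopCondition (m p.2)
  measurable_mean : Measurable m
  mean_shift : ∀ x κ, m (shift x κ) = shift x (m κ)
  mean_harmonic : ∀ᵐ p ∂μ', ∀ x, generator p.2 (height (m p.2)) x = 0
  map_shift : ∀ x, μ'.map (Prod.map (shift x) (shift x)) = μ'
  map_resample : ∀ Λ, (resampleMeasure μ' Λ).map (fun q => (resample Λ q, q.1.2)) = μ'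
  growth : ∀ δ > 0, ∃ C, 0 ≤ C ∧ ∀ x : Site d,
    ∫⁻ p, ‖height (p.1 - m p.2) x‖ₑ ∂μ' ≤ ENNReal.ofReal (C + δ * ‖x‖)

/-- The harmonic extension to `Λ` of the deviation of the heights from their mean. -/
def deviation (m : EdgeConfig d → EdgeConfig d) (Λ : Finset (Site d))
    (p : EdgeConfig d × EdgeConfig d) : Site d → ℝ :=
  harmonicExt p.2 Λ (height p.1) - height (m p.2)

theorem measurable_deviation {m : EdgeConfig d → EdgeConfig d} (hm : Measurable m)
    (Λ : Finset (Site d)) (x : Site d) : Measurable fun p => deviation m Λ p x := by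
  have h1 : Measurable fun p : EdgeConfig d × EdgeConfig d => harmonicExt p.2 Λ (height p.1) x :=
    measurable_harmonicExt Λ (fun e => (measurable_pi_apply e).comp measurable_snd)
      (fun x => (measurable_pi_apply x).comp (measurable_height.comp measurable_fst)) x
  have h2 : Measurable fun p : EdgeConfig d × EdgeConfig d => height (m p.2) x :=
    (measurable_pi_apply x).comp (measurable_height.comp (hm.comp measurable_snd))
  exact h1.sub h2

theorem height_resample_sub (m : EdgeConfig d → EdgeConfig d) (Λ : Finset (Site d))
    (q : (EdgeConfig d × EdgeConfig d) × (Λ → ℝ)) (x : Site d) :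
    height (resample Λ q - m q.1.2) x =
      deviation m Λ q.1 x + extend Λ q.2 x - (harmonicExt q.1.2 Λ (height q.1.1) 0 +
        extend Λ q.2 0) := by
  have h1 : height (resample Λ q - m q.1.2) x = height (resample Λ q) x - height (m q.1.2) x :=
    pathSum_sub _ _ x
  rw [h1, resample, height_grad, deviation, Pi.add_apply, Pi.add_apply, Pi.sub_apply]
  ring

/-- Jensen's inequality for a symmetric perturbation, obtained from 2A = (A + B) + (A - B) and the
symmetry of the field under ψ ↦ -ψ, without integrability of B. -/
theorem enorm_le_lintegral_fieldDensity (hd : 0 < d) {κ : EdgeConfig d} (hκ : ∀ e, 0 < κ e)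
    (Λ : Finset (Site d)) (A : ℝ) {B : (Λ → ℝ) → ℝ} (hBm : Measurable B)
    (hB : ∀ ψ, B (-ψ) = -B ψ) :
    ‖A‖ₑ ≤ ∫⁻ ψ, fieldDensity κ Λ ψ * ‖A + B ψ‖ₑ := by
  have hm : Measurable (fieldDensity κ Λ) := measurable_fieldDensity Λ measurable_const measurable_id
  have h1 : ∫⁻ ψ, fieldDensity κ Λ ψ * ‖A - B ψ‖ₑ = ∫⁻ ψ, fieldDensity κ Λ ψ * ‖A + B ψ‖ₑ := by
    rw [← lintegral_neg_eq_self (fun ψ => fieldDensity κ Λ ψ * ‖A + B ψ‖ₑ)]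
    simp only [fieldDensity_neg, hB, sub_eq_add_neg]
  have h2 : 2 * ‖A‖ₑ ≤ 2 * ∫⁻ ψ, fieldDensity κ Λ ψ * ‖A + B ψ‖ₑ := by
    calc 2 * ‖A‖ₑ = ∫⁻ ψ, fieldDensity κ Λ ψ * (2 * ‖A‖ₑ) := by
          rw [lintegral_mul_const _ hm, lintegral_fieldDensity hd hκ, one_mul]
      _ ≤ ∫⁻ ψ, (fieldDensity κ Λ ψ * ‖A + B ψ‖ₑ + fieldDensity κ Λ ψ * ‖A - B ψ‖ₑ) := by
          refine lintegral_mono fun ψ => ?_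
          rw [← mul_add]
          gcongr
          calc 2 * ‖A‖ₑ = ‖(A + B ψ) + (A - B ψ)‖ₑ := by
                rw [show (A + B ψ) + (A - B ψ) = 2 * A by ring, enorm_mul]
                simp [Real.enorm_eq_ofReal]
            _ ≤ _ := enorm_add_le _ _
      _ = 2 * ∫⁻ ψ, fieldDensity κ Λ ψ * ‖A + B ψ‖ₑ := by
          rw [lintegral_add_left (by fun_prop), h1, two_mul]
  exact (ENNReal.mul_le_mul_iff_right two_ne_zero ENNReal.ofNat_ne_top).1 h2

namespace IsHarmonicDecomposition

variable {μ' : Measure (EdgeConfig d × EdgeConfig d)} {m : EdgeConfig d → EdgeConfig d} {a b : ℝ}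

theorem measurable_height_sub (h : IsHarmonicDecomposition μ' m a b) (x : Site d) :
    Measurable fun p : EdgeConfig d × EdgeConfig d => height (p.1 - m p.2) x :=
  measurable_pathSum (u := fun p : EdgeConfig d × EdgeConfig d => p.1 - m p.2) (fun e =>
    ((measurable_pi_apply e).comp measurable_fst).sub
      ((measurable_pi_apply e).comp (h.measurable_mean.comp measurable_snd))) x

/-- Resampling leaves μ' invariant and adds a symmetric field to the harmonic extension, so
replacing the heights by their harmonic extension contracts L¹ norms of differences. -/
theorem lintegral_deviation_sub_le [SFinite μ'] (h : IsHarmonicDecomposition μ' m a b) (hd : 0 < d)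
    (Λ : Finset (Site d)) (x y : Site d) :
    ∫⁻ p, ‖deviation m Λ p x - deviation m Λ p y‖ₑ ∂μ' ≤
      ∫⁻ p, ‖height (p.1 - m p.2) x - height (p.1 - m p.2) y‖ₑ ∂μ' := by
  have hwm : Measurable fun p : EdgeConfig d × EdgeConfig d =>
      ‖height (p.1 - m p.2) x - height (p.1 - m p.2) y‖ₑ :=
    ((h.measurable_height_sub x).sub (h.measurable_height_sub y)).enorm
  have hT : Measurable fun q : (EdgeConfig d × EdgeConfig d) × (Λ → ℝ) => (resample Λ q, q.1.2) :=
    (measurable_resample Λ).prodMk (measurable_snd.comp measurable_fst)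
  have hB : Measurable fun ψ : Λ → ℝ => extend Λ ψ x - extend Λ ψ y := by
    have h1 : Measurable fun ψ : Λ → ℝ => extend Λ ψ := measurable_glue measurable_const measurable_id
    have h2 : ∀ x, Measurable fun ψ : Λ → ℝ => extend Λ ψ x := fun x => measurable_pi_iff.1 h1 x
    exact (h2 x).sub (h2 y)
  have hR : ∀ x, Measurable fun q : (EdgeConfig d × EdgeConfig d) × (Λ → ℝ) =>
      height (resample Λ q - m q.1.2) x := fun x =>
    measurable_pathSum (u := fun q : (EdgeConfig d × EdgeConfig d) × (Λ → ℝ) =>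
      resample Λ q - m q.1.2) (fun e => ((measurable_pi_apply e).comp (measurable_resample Λ)).sub
      ((measurable_pi_apply e).comp
        (h.measurable_mean.comp (measurable_snd.comp measurable_fst)))) x
  have hF : Measurable fun q : (EdgeConfig d × EdgeConfig d) × (Λ → ℝ) =>
      ‖height (resample Λ q - m q.1.2) x - height (resample Λ q - m q.1.2) y‖ₑ :=
    ((hR x).sub (hR y)).enorm
  have hmap : ∫⁻ p, ‖height (p.1 - m p.2) x - height (p.1 - m p.2) y‖ₑ ∂μ' =
      ∫⁻ q, ‖height (resample Λ q - m q.1.2) x - height (resample Λ q - m q.1.2) y‖ₑ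
        ∂resampleMeasure μ' Λ := by
    conv_lhs => rw [← h.map_resample Λ]
    exact lintegral_map hwm hT
  rw [hmap, lintegral_resampleMeasure μ' Λ hF]
  refine lintegral_mono_ae ?_
  filter_upwards [h.bounds] with p hp
  refine (enorm_le_lintegral_fieldDensity hd (fun e => h.pos.trans_le (hp e).1) Λ
    (deviation m Λ p x - deviation m Λ p y) hB fun ψ => ?_).trans (le_of_eq ?_)
  · rw [extend_neg, Pi.neg_apply, Pi.neg_apply]; ring
  · refine lintegral_congr fun ψ => ?_
    rw [height_resample_sub m Λ (p, ψ) x, height_resample_sub m Λ (p, ψ) y, sub_sub_sub_cancel_right,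
      add_sub_add_comm]

/-- By contraction it suffices to bound the gradient of the heights minus the mean, and translation
moves the edge to the origin. The bound is uniform in Λ and in the edge. -/
theorem lintegral_grad_deviation_le [SFinite μ'] (h : IsHarmonicDecomposition μ' m a b)
    (hd : 0 < d) : ∃ C, 0 ≤ C ∧ ∀ (Λ : Finset (Site d)) (e : Edge d),
      ∫⁻ p, ‖grad (deviation m Λ p) e‖ₑ ∂μ' ≤ ENNReal.ofReal C := by
  obtain ⟨C, hC, hg⟩ := h.growth 1 one_pos
  have hloop : ∀ᵐ p ∂μ', LoopCondition (p.1 - m p.2) := by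
    filter_upwards [h.loop, h.mean_loop] with p h1 h2 x i j
    have := h1 x i j
    have := h2 x i j
    simp only [Pi.sub_apply]
    linarith
  refine ⟨C + 1, by positivity, fun Λ e => ?_⟩
  refine (h.lintegral_deviation_sub_le hd Λ _ _).trans ?_
  calc ∫⁻ p, ‖height (p.1 - m p.2) (e.1 + unit e.2) - height (p.1 - m p.2) e.1‖ₑ ∂μ'
      = ∫⁻ p, ‖height (shift e.1 p.1 - m (shift e.1 p.2)) (unit e.2)‖ₑ ∂μ' := by
        refine lintegral_congr_ae ?_
        filter_upwards [hloop] with p hp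
        rw [h.mean_shift, add_comm e.1, ← height_shift hp]
        rfl
    _ = ∫⁻ p, ‖height (p.1 - m p.2) (unit e.2)‖ₑ ∂μ' := by
        conv_rhs => rw [← h.map_shift e.1]
        rw [lintegral_map]
        · rfl
        · exact (h.measurable_height_sub _).enorm
        · exact (measurable_shift _).prodMap (measurable_shift _)
    _ ≤ ENNReal.ofReal (C + 1) := by
        refine (hg _).trans (ENNReal.ofReal_le_ofReal ?_)
        have := norm_unit_le e.2
        linarith

theorem measurable_grad_deviation (h : IsHarmonicDecomposition μ' m a b) (Λ : Finset (Site d))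
    (e : Edge d) : Measurable fun p => grad (deviation m Λ p) e :=
  (measurable_deviation h.measurable_mean Λ _).sub (measurable_deviation h.measurable_mean Λ _)

theorem ae_generator_deviation (h : IsHarmonicDecomposition μ' m a b) (hd : 0 < d) :
    ∀ᵐ p ∂μ', ∀ (Λ : Finset (Site d)), ∀ x ∈ Λ, generator p.2 (deviation m Λ p) x = 0 := by
  filter_upwards [h.bounds, h.mean_harmonic] with p h1 h2 Λ x hx
  rw [deviation, generator_sub, generator_harmonicExt hd (fun e => h.pos.trans_le (h1 e).1) _ hx,
    h2 x, sub_zero]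

theorem lintegral_sum_sq_min_grad_le [SFinite μ'] (h : IsHarmonicDecomposition μ' m a b)
    (hd : 0 < d) {C D δ : ℝ} (hC : ∀ (Λ : Finset (Site d)) (e : Edge d),
      ∫⁻ p, ‖grad (deviation m Λ p) e‖ₑ ∂μ' ≤ ENNReal.ofReal C) (hC0 : 0 ≤ C) (hb : 0 ≤ b)
    (hD : ∀ x : Site d, ∫⁻ p, ‖height (p.1 - m p.2) x‖ₑ ∂μ' ≤ ENNReal.ofReal (D + δ * ‖x‖))
    (hD0 : 0 ≤ D) (hδ : 0 ≤ δ) {K : ℝ} (hK : 0 < K) {n : ℕ} (hn : 0 < n) :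
    ∑ e ∈ box d n ×ˢ (Finset.univ : Finset (Fin d)),
      ∫⁻ p, ENNReal.ofReal (min 1 |grad (deviation m (box d (2 * n)) p) e| ^ 2) ∂μ' ≤
    ENNReal.ofReal (b * K / (a * n) * ((edgesTouching (box d (2 * n))).card * C) +
      K⁻¹ * ((box d n ×ˢ (Finset.univ : Finset (Fin d))).card * (2 * (D + δ * (n + 1))))) := by
  have ha := h.pos
  have hn' : (0 : ℝ) < n := by exact_mod_cast hn
  set Λ := box d (2 * n) with hΛ
  -- Normalized at the origin, so that the growth bound for normalized heights applies to v while
  -- its gradient is unchanged.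
  set v : EdgeConfig d × EdgeConfig d → Site d → ℝ := fun p x =>
    deviation m Λ p x - deviation m Λ p 0 with hv
  have hgv : ∀ p, grad (v p) = grad (deviation m Λ p) := fun p => by
    ext e; simp [grad, hv]
  have hgm := h.measurable_grad_deviation Λ
  have hvm : ∀ x, Measurable fun p => ‖v p x‖ₑ := fun x =>
    ((measurable_deviation h.measurable_mean Λ _).sub
      (measurable_deviation h.measurable_mean Λ _)).enorm
  have hvi : ∀ x, ∫⁻ p, ‖v p x‖ₑ ∂μ' ≤ ENNReal.ofReal (D + δ * ‖x‖) := fun x => by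
    refine (h.lintegral_deviation_sub_le hd Λ x 0).trans (le_trans (le_of_eq ?_) (hD x))
    refine lintegral_congr fun p => ?_
    have : height (p.1 - m p.2) 0 = 0 := by simp [height, pathSum]
    rw [this, sub_zero]
  calc _ = ∫⁻ p, ENNReal.ofReal (∑ e ∈ box d n ×ˢ (Finset.univ : Finset (Fin d)),
        min 1 |grad (v p) e| ^ 2) ∂μ' := by
        rw [← lintegral_finsetSum]
        · refine lintegral_congr fun p => ?_
          rw [ENNReal.ofReal_sum_of_nonneg fun e _ => sq_nonneg _, hgv]
        · intro e _
          have := hgm e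
          fun_prop
    _ ≤ ∫⁻ p, (ENNReal.ofReal (b * K / (a * n)) * ∑ e ∈ edgesTouching Λ, ‖grad (v p) e‖ₑ +
          ENNReal.ofReal K⁻¹ * ∑ e ∈ box d n ×ˢ (Finset.univ : Finset (Fin d)),
            (‖v p e.1‖ₑ + ‖v p (e.1 + unit e.2)‖ₑ)) ∂μ' := by
        refine lintegral_mono_ae ?_
        filter_upwards [h.bounds, h.ae_generator_deviation hd] with p hp hgen
        have hvg : ∀ x ∈ box d (2 * n), generator p.2 (v p) x = 0 := fun x hx => by
          have h2 := generator_add_const p.2 (deviation m Λ p) (-deviation m Λ p 0) x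
          simp only [← sub_eq_add_neg] at h2
          rw [← hgen Λ x hx]
          exact h2
        refine (ENNReal.ofReal_le_ofReal (sum_sq_min_grad_le ha hp hn hvg hK)).trans (le_of_eq ?_)
        rw [ENNReal.ofReal_add (by positivity) (by positivity),
          ENNReal.ofReal_mul (by positivity), ENNReal.ofReal_mul (by positivity),
          ENNReal.ofReal_sum_of_nonneg fun _ _ => abs_nonneg _,
          ENNReal.ofReal_sum_of_nonneg fun _ _ => by positivity]
        simp only [ENNReal.ofReal_add (abs_nonneg _) (abs_nonneg _), Real.enorm_eq_ofReal_abs]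
        rfl
    _ = ENNReal.ofReal (b * K / (a * n)) * ∑ e ∈ edgesTouching Λ, ∫⁻ p, ‖grad (v p) e‖ₑ ∂μ' +
          ENNReal.ofReal K⁻¹ * ∑ e ∈ box d n ×ˢ (Finset.univ : Finset (Fin d)),
            (∫⁻ p, ‖v p e.1‖ₑ ∂μ' + ∫⁻ p, ‖v p (e.1 + unit e.2)‖ₑ ∂μ') := by
        have h1 : ∀ e, Measurable fun p => ‖grad (v p) e‖ₑ := fun e => by
          simp only [hgv]; exact (hgm e).enorm
        have h2 : ∀ e : Edge d, Measurable fun p => ‖v p e.1‖ₑ + ‖v p (e.1 + unit e.2)‖ₑ :=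
          fun e => (hvm _).add (hvm _)
        rw [lintegral_add_left, lintegral_const_mul, lintegral_const_mul, lintegral_finsetSum,
          lintegral_finsetSum]
        · simp only [lintegral_add_left (hvm _)]
        · exact fun e _ => h2 e
        · exact fun e _ => h1 e
        · exact Finset.measurable_fun_sum _ fun e _ => h2 e
        · exact Finset.measurable_fun_sum _ fun e _ => h1 e
        · exact (Finset.measurable_fun_sum _ fun e _ => h1 e).const_mul _
    _ ≤ ENNReal.ofReal (b * K / (a * n)) * ∑ _e ∈ edgesTouching Λ, ENNReal.ofReal C +
          ENNReal.ofReal K⁻¹ * ∑ _e ∈ box d n ×ˢ (Finset.univ : Finset (Fin d)),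
            ENNReal.ofReal (2 * (D + δ * (n + 1))) := by
        gcongr with e he e he
        · simp only [hgv]; exact hC Λ e
        · have h1 : ‖e.1‖ ≤ n := mem_box.1 (Finset.mem_product.1 he).1
          have h2 : ‖e.1 + unit e.2‖ ≤ n + 1 :=
            (norm_add_le _ _).trans (add_le_add h1 (norm_unit_le _))
          rw [two_mul, ENNReal.ofReal_add (by positivity) (by positivity)]
          refine add_le_add ((hvi _).trans (ENNReal.ofReal_le_ofReal ?_))
            ((hvi _).trans (ENNReal.ofReal_le_ofReal ?_))
          · gcongr; linarith
          · gcongr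
    _ = _ := by
        simp only [Finset.sum_const, nsmul_eq_mul]
        rw [ENNReal.ofReal_add (by positivity) (by positivity),
          ENNReal.ofReal_mul (p := b * K / (a * n)) (by positivity),
          ENNReal.ofReal_mul (p := K⁻¹) (by positivity),
          ENNReal.ofReal_mul (Nat.cast_nonneg _), ENNReal.ofReal_mul (Nat.cast_nonneg _),
          ENNReal.ofReal_natCast, ENNReal.ofReal_natCast]

end IsHarmonicDecomposition

/-- Heights are normalized at the origin, so translation changes the deviation by a constant and
only its gradient is equivariant. -/
theorem grad_deviation_shift (hd : 0 < d) {m : EdgeConfig d → EdgeConfig d}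
    (hm : ∀ x κ, m (shift x κ) = shift x (m κ)) {η κ : EdgeConfig d} (hκ : ∀ e, 0 < κ e)
    (hη : LoopCondition η) (hmκ : LoopCondition (m κ)) {Λ Λ' : Finset (Site d)} {x : Site d}
    (hΛ : ∀ y, y ∈ Λ' ↔ y + x ∈ Λ) :
    grad (deviation m Λ' (shift x η, shift x κ)) = shift x (grad (deviation m Λ (η, κ))) := by
  have h1 : height (shift x η) = fun y => height η (y + x) + -height η x := by
    ext y; rw [height_shift hη]; ring
  have h2 : height (shift x (m κ)) = fun y => height (m κ) (y + x) + -height (m κ) x := by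
    ext y; rw [height_shift hmκ]; ring
  rw [← grad_shift]
  ext e
  simp only [grad, deviation, hm, h1, h2, Pi.sub_apply]
  rw [harmonicExt_sub_const hd (κ := shift x κ) (fun e => hκ _), harmonicExt_shift hd hκ _ x hΛ]
  ring

namespace IsHarmonicDecomposition

variable {μ' : Measure (EdgeConfig d × EdgeConfig d)} {m : EdgeConfig d → EdgeConfig d} {a b : ℝ}

theorem exists_forall_sum_lintegral_le [IsProbabilityMeasure μ']
    (h : IsHarmonicDecomposition μ' m a b) (hd : 0 < d) {δ : ℝ} (hδ : 0 < δ) :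
    ∃ N : ℕ, ∀ n ≥ N, ∑ e ∈ box d n ×ˢ (Finset.univ : Finset (Fin d)),
      ∫⁻ p, ENNReal.ofReal (min 1 |grad (deviation m (box d (2 * n)) p) e| ^ 2) ∂μ' ≤
        ENNReal.ofReal (δ * (2 * n + 1) ^ d) := by
  have ha := h.pos
  have hd' : (0 : ℝ) < d := by exact_mod_cast hd
  have hb : 0 ≤ b := by
    obtain ⟨p, hp⟩ := h.bounds.exists
    have := hp (0, ⟨0, hd⟩)
    exact ha.le.trans (this.1.trans this.2)
  obtain ⟨C, hC0, hC⟩ := h.lintegral_grad_deviation_le hd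
  set P : ℝ := b / a * (2 * d * 2 ^ d * C) with hP
  have hP0 : 0 ≤ P := by positivity
  -- The truncation level is K = εn. This ε gives the energy term half of the allowed δ; the slope θ
  -- below and a large n give the truncation error the other half.
  set ε : ℝ := δ / (2 * (P + 1)) with hε
  have hε0 : 0 < ε := by positivity
  have hεP : ε * P ≤ δ / 2 := by
    rw [hε, div_mul_eq_mul_div, div_le_iff₀ (by positivity)]
    nlinarith
  set θ : ℝ := δ * ε / (16 * d) with hθ
  have hθ0 : 0 < θ := by positivity
  obtain ⟨D, hD0, hD⟩ := h.growth θ hθ0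
  obtain ⟨N, hN⟩ := exists_nat_ge (8 * d * D / (ε * δ))
  refine ⟨N + 1, fun n hn => ?_⟩
  have hn0 : 0 < n := by omega
  have hn1 : (1 : ℝ) ≤ n := by exact_mod_cast hn0
  have hn' : (0 : ℝ) < n := by linarith
  have hnN : 8 * d * D / (ε * δ) ≤ n := hN.trans (by exact_mod_cast (by omega : N ≤ n))
  refine (h.lintegral_sum_sq_min_grad_le hd hC hC0 hb hD hD0 hθ0.le
    (K := ε * n) (by positivity) hn0).trans (ENNReal.ofReal_le_ofReal ?_)
  set V : ℝ := (2 * n + 1) ^ d with hV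
  have hV0 : 0 < V := by positivity
  have hT : ((edgesTouching (box d (2 * n))).card : ℝ) ≤ 2 * d * (2 ^ d * V) := by
    have h1 : ((edgesTouching (box d (2 * n))).card : ℝ) ≤ 2 * d * (2 * (2 * n) + 1) ^ d := by
      have := card_edgesTouching_le (box d (2 * n))
      rw [card_box] at this
      exact_mod_cast this
    refine h1.trans ?_
    rw [hV, ← mul_pow]
    gcongr
    linarith
  have hB : ((box d n ×ˢ (Finset.univ : Finset (Fin d))).card : ℝ) = V * d := by
    rw [Finset.card_product, card_box, Finset.card_univ, Fintype.card_fin, hV]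
    push_cast
    ring
  have h1 : b * (ε * n) / (a * n) * ((edgesTouching (box d (2 * n))).card * C) ≤ δ / 2 * V := by
    calc b * (ε * n) / (a * n) * ((edgesTouching (box d (2 * n))).card * C)
        ≤ b * (ε * n) / (a * n) * (2 * d * (2 ^ d * V) * C) := by gcongr
      _ = ε * P * V := by rw [hP]; field_simp
      _ ≤ δ / 2 * V := by gcongr
  have h2 : (ε * n)⁻¹ * (V * d * (2 * (D + θ * (n + 1)))) ≤ δ / 2 * V := by
    rw [inv_mul_le_iff₀ (by positivity)]
    have h3 : 8 * d * D ≤ n * (ε * δ) := by rwa [div_le_iff₀ (by positivity)] at hnN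
    have h4 : 16 * d * θ = δ * ε := by rw [hθ]; field_simp
    have h5 : 8 * d * D + 8 * d * (θ * (n + 1)) ≤ 2 * (ε * n * δ) := by
      have h6 : 16 * d * θ * (n + 1) ≤ δ * ε * (2 * n) := by
        rw [h4]; gcongr; linarith
      nlinarith
    calc V * d * (2 * (D + θ * (n + 1))) = V / 4 * (8 * d * D + 8 * d * (θ * (n + 1))) := by ring
      _ ≤ V / 4 * (2 * (ε * n * δ)) := by gcongr
      _ = ε * n * (δ / 2 * V) := by ring
  rw [hB]
  linarith

/-- Smallness on average over a large box implies smallness on F for at least one translate of F,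
and stationarity converts translating F into translating Λ. Since Λ has twice the size of the
averaging box, the shifted set still contains the box of size N. -/
theorem exists_sum_lintegral_le [IsProbabilityMeasure μ']
    (h : IsHarmonicDecomposition μ' m a b) (hd : 0 < d) (F : Finset (Edge d)) (N : ℕ) {δ : ℝ}
    (hδ : 0 < δ) :
    ∃ Λ : Finset (Site d), box d N ⊆ Λ ∧ ∑ e ∈ F,
      ∫⁻ p, ENNReal.ofReal (min 1 |grad (deviation m Λ p) e| ^ 2) ∂μ' ≤ ENNReal.ofReal δ := by
  classical
  obtain ⟨M, hM⟩ := (eventually_subset_box (F.image Prod.fst)).exists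
  -- The factor 2^d pays for enlarging the box from n to n + M with M ≤ n, the factor |F| + 1 for
  -- the sum over the edges of F.
  have hδ' : 0 < δ / (2 ^ d * (F.card + 1)) := by positivity
  obtain ⟨n₀, hn₀⟩ := h.exists_forall_sum_lintegral_le hd hδ'
  set n := max n₀ (max M N) with hn
  have hn1 : n₀ ≤ n := le_max_left _ _
  have hn2 : M ≤ n := (le_max_left _ _).trans (le_max_right _ _)
  have hn3 : N ≤ n := (le_max_right _ _).trans (le_max_right _ _)
  set Λ := box d (2 * (n + M)) with hΛ
  set G : Edge d → ℝ≥0∞ := fun e =>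
    ∫⁻ p, ENNReal.ofReal (min 1 |grad (deviation m Λ p) e| ^ 2) ∂μ' with hG
  have hGm : ∀ Λ e, Measurable fun p =>
      ENNReal.ofReal (min 1 |grad (deviation m Λ p) e| ^ 2) := fun Λ e => by
    have := h.measurable_grad_deviation Λ e
    fun_prop
  have hGsum := hn₀ (n + M) (by omega)
  have hshift : ∀ e ∈ F, ∑ x ∈ box d n, G (e.1 + x, e.2) ≤
      ENNReal.ofReal (δ / (2 ^ d * (F.card + 1)) * (2 * (n + M : ℕ) + 1) ^ d) := fun e he => by
    refine le_trans ?_ hGsum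
    have hinj : Set.InjOn (fun x => ((e.1 + x, e.2) : Edge d)) (box d n) := fun x _ y _ hxy => by
      simpa using hxy
    rw [← Finset.sum_image (f := G) hinj]
    refine Finset.sum_le_sum_of_subset fun e' he' => ?_
    obtain ⟨x, hx, rfl⟩ := Finset.mem_image.1 he'
    refine Finset.mem_product.2 ⟨mem_box.2 ?_, Finset.mem_univ _⟩
    have h1 := mem_box.1 (hM (Finset.mem_image_of_mem _ he))
    have h2 := mem_box.1 hx
    push_cast
    exact (norm_add_le _ _).trans (by linarith)
  -- If every translate exceeded δ, then so would the average over the box.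
  obtain ⟨x, hx, hle⟩ : ∃ x ∈ box d n, ∑ e ∈ F, G (e.1 + x, e.2) ≤ ENNReal.ofReal δ := by
    by_contra! hcon
    refine (ENNReal.sum_lt_sum_of_nonempty ⟨0, mem_box.2 (by simp)⟩ hcon).not_ge ?_
    rw [Finset.sum_comm]
    refine (Finset.sum_le_sum hshift).trans ?_
    rw [Finset.sum_const, Finset.sum_const, nsmul_eq_mul, nsmul_eq_mul, card_box,
      ← ENNReal.ofReal_natCast, ← ENNReal.ofReal_natCast, ← ENNReal.ofReal_mul (by positivity),
      ← ENNReal.ofReal_mul (by positivity)]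
    refine ENNReal.ofReal_le_ofReal ?_
    push_cast
    have h1 : ((2 : ℝ) * (n + M) + 1) ^ d ≤ 2 ^ d * (2 * n + 1) ^ d := by
      rw [← mul_pow]
      gcongr
      have : (M : ℝ) ≤ n := by exact_mod_cast hn2
      linarith
    calc (F.card : ℝ) * (δ / (2 ^ d * (F.card + 1)) * (2 * (n + M) + 1) ^ d)
        ≤ (F.card + 1) * (δ / (2 ^ d * (F.card + 1)) * (2 ^ d * (2 * n + 1) ^ d)) := by
          gcongr; linarith
      _ = (2 * n + 1) ^ d * δ := by field_simp
  have hmem : ∀ y, y ∈ Λ.image (fun z => z - x) ↔ y + x ∈ Λ := fun y => by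
    rw [Finset.mem_image]
    exact ⟨by rintro ⟨z, hz, rfl⟩; simpa using hz, fun hy => ⟨_, hy, by simp⟩⟩
  refine ⟨Λ.image fun z => z - x, fun y hy => (hmem y).2 (mem_box.2 ?_), ?_⟩
  · have h1 := mem_box.1 hy
    have h2 := mem_box.1 hx
    have h3 : (N : ℝ) ≤ n := by exact_mod_cast hn3
    refine (norm_add_le _ _).trans ?_
    push_cast
    linarith [(Nat.cast_nonneg M : (0 : ℝ) ≤ M)]
  · refine le_trans (le_of_eq (Finset.sum_congr rfl fun e _ => ?_)) hle
    conv_lhs => rw [← h.map_shift x]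
    rw [lintegral_map (hGm _ _) ((measurable_shift x).prodMap (measurable_shift x)), hG]
    refine lintegral_congr_ae ?_
    filter_upwards [h.bounds, h.loop, h.mean_loop] with p h1 h2 h3
    have h4 := grad_deviation_shift hd h.mean_shift (fun e => h.pos.trans_le (h1 e).1) h2 h3 hmem
    have h5 : Prod.map (shift x) (shift x) p = (shift x p.1, shift x p.2) := rfl
    rw [h5, h4]
    rfl

/-- Along suitable finite sets the harmonic extensions of the deviations become flat. -/
theorem exists_tendsto_grad_deviation [IsProbabilityMeasure μ']
    (h : IsHarmonicDecomposition μ' m a b) (hd : 0 < d) :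
    ∃ Λ : ℕ → Finset (Site d), (∀ n, box d n ⊆ Λ n) ∧
      ∀ᵐ p ∂μ', ∀ e, Tendsto (fun n => grad (deviation m (Λ n) p) e) atTop (𝓝 0) := by
  -- The bounds 2^(-n) are summable, so on every edge the truncated squares have an almost surely
  -- finite sum and tend to zero.
  choose Λ hΛ hsum using fun n : ℕ => h.exists_sum_lintegral_le hd
    (box d n ×ˢ (Finset.univ : Finset (Fin d))) n (δ := (1 / 2) ^ n) (by positivity)
  refine ⟨Λ, hΛ, ?_⟩
  rw [ae_all_iff]
  intro e
  obtain ⟨N, hN⟩ := eventually_atTop.1 (eventually_subset_box {e.1})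
  set T : ℕ → EdgeConfig d × EdgeConfig d → ℝ≥0∞ := fun n p =>
    ENNReal.ofReal (min 1 |grad (deviation m (Λ (n + N)) p) e| ^ 2) with hT
  have hTm : ∀ n, Measurable (T n) := fun n => by
    have := h.measurable_grad_deviation (Λ (n + N)) e
    simp only [hT]
    fun_prop
  have hTi : ∀ n, ∫⁻ p, T n p ∂μ' ≤ (1 / 2) ^ n := fun n => by
    have he : e ∈ box d (n + N) ×ˢ (Finset.univ : Finset (Fin d)) :=
      Finset.mem_product.2 ⟨hN _ (by omega) (Finset.mem_singleton_self _), Finset.mem_univ _⟩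
    refine (Finset.single_le_sum (f := fun e => ∫⁻ p, ENNReal.ofReal
      (min 1 |grad (deviation m (Λ (n + N)) p) e| ^ 2) ∂μ') (fun _ _ => zero_le) he).trans
      ((hsum (n + N)).trans ?_)
    rw [ENNReal.ofReal_pow (by norm_num), ENNReal.ofReal_div_of_pos two_pos, ENNReal.ofReal_one,
      ENNReal.ofReal_ofNat]
    exact pow_le_pow_of_le_one zero_le (by simp) (by omega)
  have hfin : ∫⁻ p, ∑' n, T n p ∂μ' ≠ ∞ := by
    rw [lintegral_tsum fun n => (hTm n).aemeasurable]
    refine ne_top_of_le_ne_top ?_ (ENNReal.tsum_le_tsum hTi)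
    rw [ENNReal.tsum_geometric]
    simp
  filter_upwards [ae_lt_top (Measurable.tsum hTm) hfin] with p hp
  have h1 := ENNReal.tendsto_atTop_zero_of_tsum_ne_top hp.ne
  rw [← tendsto_add_atTop_iff_nat N]
  have h2 := (ENNReal.tendsto_toReal ENNReal.zero_ne_top).comp h1
  have h3 : Tendsto (fun n => min 1 |grad (deviation m (Λ (n + N)) p) e|) atTop (𝓝 0) := by
    have h4 := h2.sqrt
    rw [ENNReal.toReal_zero, Real.sqrt_zero] at h4
    refine h4.congr fun n => ?_
    rw [Function.comp, hT, ENNReal.toReal_ofReal (sq_nonneg _),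
      Real.sqrt_sq (le_min zero_le_one (abs_nonneg _))]
  refine (tendsto_zero_iff_abs_tendsto_zero _).2 (h3.congr' ?_)
  filter_upwards [h3.eventually (gt_mem_nhds one_pos)] with n hn
  rw [Function.comp]
  rcases min_lt_iff.1 hn with h5 | h5
  · exact absurd h5 (lt_irrefl _)
  · exact min_eq_right h5.le

end IsHarmonicDecomposition

/-! ### The conditional characteristic function -/

/-- The pairing `∑_x f(x) u(x)`. -/
def pairing (f : Site d →₀ ℝ) (u : Site d → ℝ) : ℝ := f.sum fun x a => a * u x

theorem pairing_add (f : Site d →₀ ℝ) (u v : Site d → ℝ) :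
    pairing f (u + v) = pairing f u + pairing f v := by
  simp [pairing, Finsupp.sum, mul_add, Finset.sum_add_distrib]

theorem pairing_sub_const {f : Site d →₀ ℝ} (hf : (f.sum fun _ a => a) = 0) (u : Site d → ℝ)
    (c : ℝ) : pairing f (fun x => u x - c) = pairing f u := by
  rw [Finsupp.sum] at hf
  simp [pairing, Finsupp.sum, mul_sub, Finset.sum_sub_distrib, ← Finset.sum_mul, hf]

theorem measurable_pairing {Ω : Type*} [MeasurableSpace Ω] (f : Site d →₀ ℝ) {u : Ω → Site d → ℝ}
    (hu : ∀ x, Measurable fun ω => u ω x) : Measurable fun ω => pairing f (u ω) :=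
  Finset.measurable_fun_sum _ fun x _ => (hu x).const_mul _

theorem pairing_dirichletSolve_nonneg (hd : 0 < d) {κ : EdgeConfig d} (hκ : ∀ e, 0 < κ e)
    {Λ : Finset (Site d)} {f : Site d →₀ ℝ} (hΛ : f.support ⊆ Λ) :
    0 ≤ pairing f (dirichletSolve κ Λ f) := by
  rw [pairing, finsupp_sum_eq_sum hΛ]
  exact sum_dirichletSolve_mul_nonneg hd hκ Λ f

theorem fieldDensity_lt_top (κ : EdgeConfig d) (Λ : Finset (Site d)) (ψ : Λ → ℝ) :
    fieldDensity κ Λ ψ < ∞ :=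
  ENNReal.mul_lt_top (ENNReal.inv_lt_top.2 (fieldPartition_ne_zero κ Λ).bot_lt)
    ENNReal.ofReal_lt_top

theorem integral_resampleMeasure {μ' : Measure (EdgeConfig d × EdgeConfig d)} [SFinite μ']
    {Λ : Finset (Site d)} {F : (EdgeConfig d × EdgeConfig d) × (Λ → ℝ) → ℂ}
    (hF : Integrable F (resampleMeasure μ' Λ)) :
    ∫ q, F q ∂resampleMeasure μ' Λ = ∫ p, ∫ ψ, F (p, ψ) ∂fieldLaw p.2 Λ ∂μ' := by
  have hD := measurable_uncurry_fieldDensity Λ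
  have hlt : ∀ q : (EdgeConfig d × EdgeConfig d) × (Λ → ℝ), fieldDensity q.1.2 Λ q.2 < ∞ :=
    fun q => fieldDensity_lt_top _ _ _
  have hF' := (integrable_withDensity_iff_integrable_smul' hD (.of_forall hlt)).1 hF
  rw [resampleMeasure, integral_withDensity_eq_integral_toReal_smul hD (.of_forall hlt),
    integral_prod _ hF']
  refine integral_congr_ae (.of_forall fun p => ?_)
  have hm : Measurable fun ψ : Λ → ℝ => fieldDensity p.2 Λ ψ :=
    measurable_fieldDensity Λ measurable_const measurable_id
  simp only [fieldLaw]
  rw [integral_withDensity_eq_integral_toReal_smul hm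
    (.of_forall fun ψ => fieldDensity_lt_top _ _ _)]

theorem integral_exp_pairing_extend (hd : 0 < d) {κ : EdgeConfig d} (hκ : ∀ e, 0 < κ e)
    {Λ : Finset (Site d)} {f : Site d →₀ ℝ} (hΛ : f.support ⊆ Λ) :
    ∫ ψ, Complex.exp (pairing f (extend Λ ψ) * Complex.I) ∂fieldLaw κ Λ =
      Complex.exp (-(pairing f (dirichletSolve κ Λ f) : ℂ) / 2) := by
  have hm : Measurable fun ψ : Λ → ℝ => ∑ x ∈ Λ, extend Λ ψ x * f x := by
    have h1 : Measurable fun ψ : Λ → ℝ => extend Λ ψ := measurable_glue measurable_const measurable_id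
    have h2 : ∀ x, Measurable fun ψ : Λ → ℝ => extend Λ ψ x := fun x => measurable_pi_iff.1 h1 x
    exact Finset.measurable_fun_sum _ fun x _ => (h2 x).mul_const _
  have h1 : charFun ((fieldLaw κ Λ).map fun ψ => ∑ x ∈ Λ, extend Λ ψ x * f x) 1 =
      charFun (gaussianReal 0 (∑ x ∈ Λ, dirichletSolve κ Λ f x * f x).toNNReal) 1 := by
    rw [map_fieldLaw hd hκ Λ f]
  rw [charFun_gaussianReal, charFun_apply_real, integral_map hm.aemeasurable (by fun_prop),
    Real.coe_toNNReal _ (sum_dirichletSolve_mul_nonneg hd hκ Λ f)] at h1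
  simp only [pairing, finsupp_sum_eq_sum hΛ]
  convert h1 using 2
  · ext ψ; simp
  · simp; ring

namespace IsHarmonicDecomposition

variable {μ' : Measure (EdgeConfig d × EdgeConfig d)} {m : EdgeConfig d → EdgeConfig d} {a b : ℝ}

theorem integral_mul_exp_pairing [IsProbabilityMeasure μ']
    (h : IsHarmonicDecomposition μ' m a b) (hd : 0 < d) {f : Site d →₀ ℝ}
    (hf : (f.sum fun _ a => a) = 0) {Λ : Finset (Site d)} (hΛ : f.support ⊆ Λ)
    {G : EdgeConfig d → ℂ} (hG : Measurable G) (hG1 : ∀ κ, ‖G κ‖ ≤ 1) :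
    ∫ p, G p.2 * Complex.exp (pairing f (height p.1) * Complex.I) ∂μ' =
      ∫ p, G p.2 * (Complex.exp (pairing f (harmonicExt p.2 Λ (height p.1)) * Complex.I) *
        Complex.exp (-(pairing f (dirichletSolve p.2 Λ f) : ℂ) / 2)) ∂μ' := by
  have hpos : ∀ᵐ p ∂μ', ∀ b, 0 < p.2 b := h.bounds.mono fun p hp e => h.pos.trans_le (hp e).1
  have := isProbabilityMeasure_resampleMeasure hd hpos Λ
  have hT : Measurable fun q : (EdgeConfig d × EdgeConfig d) × (Λ → ℝ) => (resample Λ q, q.1.2) :=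
    (measurable_resample Λ).prodMk (measurable_snd.comp measurable_fst)
  have hpm : Measurable fun p : EdgeConfig d × EdgeConfig d => pairing f (height p.1) :=
    measurable_pairing f fun x => measurable_pi_iff.1 (measurable_height.comp measurable_fst) x
  have hΦ : Measurable fun p : EdgeConfig d × EdgeConfig d =>
      G p.2 * Complex.exp (pairing f (height p.1) * Complex.I) := by
    have : Measurable fun p : EdgeConfig d × EdgeConfig d => G p.2 := hG.comp measurable_snd
    exact this.mul (by fun_prop)
  have hpr : Measurable fun q : (EdgeConfig d × EdgeConfig d) × (Λ → ℝ) =>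
      pairing f (height (resample Λ q)) :=
    measurable_pairing f fun x => measurable_pi_iff.1 (measurable_height.comp (measurable_resample Λ)) x
  have hF : Integrable (fun q : (EdgeConfig d × EdgeConfig d) × (Λ → ℝ) =>
      G q.1.2 * Complex.exp (pairing f (height (resample Λ q)) * Complex.I))
      (resampleMeasure μ' Λ) := by
    refine Integrable.of_bound (C := 1) ?_ (.of_forall fun q => ?_)
    · have : Measurable fun q : (EdgeConfig d × EdgeConfig d) × (Λ → ℝ) => G q.1.2 :=
        hG.comp (measurable_snd.comp measurable_fst)
      exact (this.mul (by fun_prop)).aestronglyMeasurable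
    · rw [norm_mul, Complex.norm_exp_ofReal_mul_I, mul_one]
      exact hG1 _
  have hmap : ∫ p, G p.2 * Complex.exp (pairing f (height p.1) * Complex.I) ∂μ' =
      ∫ q, G q.1.2 * Complex.exp (pairing f (height (resample Λ q)) * Complex.I)
        ∂resampleMeasure μ' Λ := by
    conv_lhs => rw [← h.map_resample Λ]
    exact integral_map hT.aemeasurable hΦ.aestronglyMeasurable
  rw [hmap, integral_resampleMeasure hF]
  refine integral_congr_ae ?_
  filter_upwards [hpos] with p hp
  have h1 : ∀ ψ : Λ → ℝ, pairing f (height (resample Λ (p, ψ))) =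
      pairing f (harmonicExt p.2 Λ (height p.1)) + pairing f (extend Λ ψ) := fun ψ => by
    rw [← pairing_add]
    refine Eq.trans ?_ (pairing_sub_const hf _ ((harmonicExt p.2 Λ (height p.1) + extend Λ ψ) 0))
    congr 1
    ext x
    rw [resample, height_grad]
  simp only [h1, Complex.ofReal_add, add_mul, Complex.exp_add]
  rw [integral_const_mul, integral_const_mul, integral_exp_pairing_extend hd hp hΛ]

theorem measurable_mul_exp_pairing (Λ : Finset (Site d)) (f : Site d →₀ ℝ)
    {G : EdgeConfig d → ℂ} (hG : Measurable G) :
    Measurable fun p : EdgeConfig d × EdgeConfig d =>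
      G p.2 * (Complex.exp (pairing f (harmonicExt p.2 Λ (height p.1)) * Complex.I) *
        Complex.exp (-(pairing f (dirichletSolve p.2 Λ f) : ℂ) / 2)) := by
  have hκ : ∀ e, Measurable fun p : EdgeConfig d × EdgeConfig d => p.2 e := fun e =>
    (measurable_pi_apply e).comp measurable_snd
  have hη : ∀ x, Measurable fun p : EdgeConfig d × EdgeConfig d => height p.1 x := fun x =>
    (measurable_pi_apply x).comp (measurable_height.comp measurable_fst)
  have h1 : Measurable fun p : EdgeConfig d × EdgeConfig d =>
      pairing f (harmonicExt p.2 Λ (height p.1)) :=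
    measurable_pairing f fun x => measurable_harmonicExt Λ hκ hη x
  have h2 : Measurable fun p : EdgeConfig d × EdgeConfig d => pairing f (dirichletSolve p.2 Λ f) :=
    measurable_pairing f fun x => measurable_dirichletSolve Λ (r := fun _ => f) hκ
      (fun x => measurable_const) x
  have h3 : Measurable fun p : EdgeConfig d × EdgeConfig d => G p.2 := hG.comp measurable_snd
  exact h3.mul (by fun_prop)

/-- The joint characteristic function of heights and conductances. -/
theorem integral_mul_exp_pairing_eq [IsProbabilityMeasure μ']
    (h : IsHarmonicDecomposition μ' m a b) (hd : 0 < d) {f : Site d →₀ ℝ}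
    (hf : (f.sum fun _ a => a) = 0) {Q : EdgeConfig d → ℝ}
    (hQ : ∀ κ, (∀ e, κ e ∈ Set.Icc a b) → ∀ Λ : ℕ → Finset (Site d), (∀ n, box d n ⊆ Λ n) →
      Tendsto (fun n => pairing f (dirichletSolve κ (Λ n) f)) atTop (𝓝 (Q κ)))
    {G : EdgeConfig d → ℂ} (hG : Measurable G) (hG1 : ∀ κ, ‖G κ‖ ≤ 1) :
    ∫ p, G p.2 * Complex.exp (pairing f (height p.1) * Complex.I) ∂μ' =
      ∫ p, G p.2 * (Complex.exp (pairing f (height (m p.2)) * Complex.I) *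
        Complex.exp (-(Q p.2 : ℂ) / 2)) ∂μ' := by
  obtain ⟨Λ, hΛ, hlim⟩ := h.exists_tendsto_grad_deviation hd
  obtain ⟨N, hN⟩ := eventually_atTop.1 (eventually_subset_box f.support)
  have hsub : ∀ n ≥ N, f.support ⊆ Λ n := fun n hn => (hN n hn).trans (hΛ n)
  -- The left-hand side does not depend on Λ, and dominated convergence applies because all factors
  -- have modulus at most 1 once Λ contains the support of f.
  refine tendsto_nhds_unique (tendsto_const_nhds (x := _) (f := atTop (α := ℕ))) ?_
  refine Tendsto.congr' (f₁ := fun n => ∫ p, G p.2 * (Complex.exp (pairing f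
    (harmonicExt p.2 (Λ n) (height p.1)) * Complex.I) *
      Complex.exp (-(pairing f (dirichletSolve p.2 (Λ n) f) : ℂ) / 2)) ∂μ') ?_ ?_
  · filter_upwards [eventually_ge_atTop N] with n hn
    exact (h.integral_mul_exp_pairing hd hf (hsub n hn) hG hG1).symm
  rw [← tendsto_add_atTop_iff_nat N]
  refine tendsto_integral_of_dominated_convergence (fun _ => 1) (fun n => ?_)
    (integrable_const _) (fun n => ?_) ?_
  · exact (measurable_mul_exp_pairing _ f hG).aestronglyMeasurable
  · filter_upwards [h.bounds] with p hp
    rw [norm_mul, norm_mul, Complex.norm_exp_ofReal_mul_I, one_mul]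
    refine mul_le_one₀ (hG1 _) (norm_nonneg _) ?_
    have := pairing_dirichletSolve_nonneg hd (fun e => h.pos.trans_le (hp e).1)
      (hsub (n + N) (by omega))
    rw [Complex.norm_exp, Real.exp_le_one_iff]
    simp
    linarith
  · filter_upwards [h.bounds, hlim] with p hp hp2
    have h1 := (tendsto_add_atTop_iff_nat N).2 (hQ p.2 hp Λ hΛ)
    -- As f has zero sum, the pairing is a finite combination of gradients of the deviation, each of
    -- which tends to zero.
    have h2 : Tendsto (fun n => pairing f (deviation m (Λ n) p)) atTop (𝓝 0) := by
      have h3 : ∀ n, pairing f (deviation m (Λ n) p) =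
          f.sum fun x a => a * height (grad (deviation m (Λ n) p)) x := fun n =>
        sum_mul_eq_sum_height hf _
      simp only [h3]
      have h4 : (0 : ℝ) = f.sum fun x a => a * height (0 : EdgeConfig d) x := by
        simp [height, pathSum]
      rw [h4]
      refine tendsto_finsetSum _ fun x _ => Tendsto.const_mul _ ?_
      simp only [height, pathSum]
      exact tendsto_finsetSum _ fun i _ => (tendsto_finsetSum _ fun k _ => hp2 _).sub
        (tendsto_finsetSum _ fun k _ => hp2 _)
    have h5 : Tendsto (fun n => pairing f (harmonicExt p.2 (Λ n) (height p.1))) atTop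
        (𝓝 (pairing f (height (m p.2)))) := by
      have h6 := h2.add_const (pairing f (height (m p.2)))
      rw [zero_add] at h6
      refine h6.congr fun n => ?_
      rw [← pairing_add, deviation, sub_add_cancel]
    have h7 := (tendsto_add_atTop_iff_nat N).2 h5
    have c1 := (Complex.continuous_ofReal.tendsto _).comp h7
    have c2 := (Complex.continuous_ofReal.tendsto _).comp h1
    exact Tendsto.const_mul _ (((c1.mul_const _).cexp).mul ((c2.neg.div_const _).cexp))

end IsHarmonicDecomposition

/-! ### The covariance form -/

/-- The function `δ_x - δ_0`. -/
def dipole (x : Site d) : Site d →₀ ℝ := Finsupp.single x 1 - Finsupp.single 0 1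

/-- The function `∑_{x ∈ S} c_x (δ_x - δ_0)`. -/
def dipoleSum (S : Finset (Site d)) (c : S → ℝ) : Site d →₀ ℝ := ∑ x : S, c x • dipole (x : Site d)

theorem pairing_dipole (x : Site d) (u : Site d → ℝ) : pairing (dipole x) u = u x - u 0 := by
  rw [pairing, dipole, Finsupp.sum_sub_index fun _ _ _ => sub_mul _ _ _]
  simp

theorem sum_dipole (x : Site d) : ((dipole x).sum fun _ a => a) = 0 := by
  rw [dipole, Finsupp.sum_sub_index fun _ _ _ => rfl]
  simp

theorem pairing_dipoleSum (S : Finset (Site d)) (c : S → ℝ) (u : Site d → ℝ) :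
    pairing (dipoleSum S c) u = ∑ x : S, c x * pairing (dipole x) u := by
  rw [pairing, dipoleSum, ← Finsupp.sum_finsetSum_index (fun _ => zero_mul _)
    (fun _ _ _ => add_mul _ _ _)]
  refine Finset.sum_congr rfl fun x _ => ?_
  rw [Finsupp.sum_smul_index fun _ => zero_mul _, pairing, Finsupp.mul_sum]
  simp only [mul_assoc]

theorem sum_dipoleSum (S : Finset (Site d)) (c : S → ℝ) :
    ((dipoleSum S c).sum fun _ a => a) = 0 := by
  have := pairing_dipoleSum S c fun _ => 1
  simp only [pairing_dipole, sub_self, mul_zero, Finset.sum_const_zero] at this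
  simpa [pairing] using this

theorem pairing_dipoleSum_height (S : Finset (Site d)) (c : S → ℝ) (η : EdgeConfig d) :
    pairing (dipoleSum S c) (height η) = ∑ x : S, c x * height η x := by
  have : height η 0 = 0 := by simp [height, pathSum]
  simp [pairing_dipoleSum, pairing_dipole, this]

theorem dipoleSum_eq {f : Site d →₀ ℝ} (hf : (f.sum fun _ a => a) = 0) :
    dipoleSum f.support (fun x => f x) = f := by
  rw [dipoleSum, Finset.sum_coe_sort f.support fun x => f x • dipole x]
  simp only [dipole, smul_sub, Finset.sum_sub_distrib]
  rw [Finsupp.sum] at hf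
  rw [← Finset.sum_smul, hf, zero_smul, sub_zero]
  simp only [Finsupp.smul_single, smul_eq_mul, mul_one]
  exact f.sum_single

theorem dirichletSolve_dipoleSum (κ : EdgeConfig d) (Λ : Finset (Site d)) (S : Finset (Site d))
    (c : S → ℝ) :
    dirichletSolve κ Λ (dipoleSum S c) = ∑ y : S, c y • dirichletSolve κ Λ (dipole y) := by
  have hadd : ∀ r s : Site d → ℝ, dirichletSolve κ Λ (r + s) =
      dirichletSolve κ Λ r + dirichletSolve κ Λ s := fun r s => by
    rw [dirichletSolve, dirichletSolve, dirichletSolve, ← extend_add, ← Matrix.mulVec_add]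
    rfl
  have hsmul : ∀ (t : ℝ) (r : Site d → ℝ), dirichletSolve κ Λ (t • r) =
      t • dirichletSolve κ Λ r := fun t r => by
    rw [dirichletSolve, dirichletSolve, ← extend_smul, ← Matrix.mulVec_smul]
    rfl
  let L : (Site d → ℝ) →ₗ[ℝ] (Site d → ℝ) := ⟨⟨dirichletSolve κ Λ, hadd⟩, hsmul⟩
  have h1 : (⇑(dipoleSum S c) : Site d → ℝ) = ∑ y : S, c y • ⇑(dipole (y : Site d)) := by
    simp [dipoleSum]
  rw [h1]
  exact (map_sum L _ _).trans (Finset.sum_congr rfl fun y _ => map_smul L _ _)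

/-- The potential `(-L_κ)⁻¹ (δ_x - δ_0)`. -/
def greenFunction (κ : EdgeConfig d) (x : Site d) : Site d → ℝ :=
  Classical.epsilon fun g => IsNegGeneratorInverse κ (dipole x) g

/-- The quadratic form of `(-L_κ)⁻¹` on `∑_{x ∈ S} c_x (δ_x - δ_0)`. -/
def greenForm (κ : EdgeConfig d) (S : Finset (Site d)) (c : S → ℝ) : ℝ :=
  ∑ x : S, ∑ y : S, c x * c y * pairing (dipole (x : Site d)) (greenFunction κ y)

theorem greenForm_smul (κ : EdgeConfig d) (S : Finset (Site d)) (t : ℝ) (c : S → ℝ) :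
    greenForm κ S (t • c) = t ^ 2 * greenForm κ S c := by
  simp only [greenForm, Finset.mul_sum, Pi.smul_apply, smul_eq_mul]
  exact Finset.sum_congr rfl fun x _ => Finset.sum_congr rfl fun y _ => by ring

/-- Continuity in the coefficients allows the exceptional null set to be fixed on rational
coefficients only. -/
theorem continuous_greenForm (κ : EdgeConfig d) (S : Finset (Site d)) :
    Continuous (greenForm κ S) := by
  unfold greenForm
  fun_prop

section

variable {κ : EdgeConfig d} {a : ℝ}

/-- All exhausting sequences give the same limit, which covers the shifted boxes found above. The
limit also supplies measurability in κ, which is not visible from Green functions obtained by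
choice. -/
theorem tendsto_pairing_greenForm (hd : 0 < d) (ha : 0 < a) (hκ : ∀ e, a ≤ κ e)
    (S : Finset (Site d)) (c : S → ℝ) {Λ : ℕ → Finset (Site d)} (hΛ : ∀ n, box d n ⊆ Λ n) :
    Tendsto (fun n => pairing (dipoleSum S c) (dirichletSolve κ (Λ n) (dipoleSum S c))) atTop
      (𝓝 (greenForm κ S c)) := by
  have hΛ' : ∀ T : Finset (Site d), ∀ᶠ n in atTop, T ⊆ Λ n := fun T =>
    (eventually_subset_box T).mono fun n hn => hn.trans (hΛ n)
  have hg : ∀ y, IsNegGeneratorInverse κ (dipole y) (greenFunction κ y) := fun y =>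
    Classical.epsilon_spec (exists_isNegGeneratorInverse hd ha hκ (sum_dipole y))
  have h1 : ∀ n, pairing (dipoleSum S c) (dirichletSolve κ (Λ n) (dipoleSum S c)) =
      ∑ x : S, ∑ y : S, c x * c y *
        pairing (dipole (x : Site d)) (dirichletSolve κ (Λ n) (dipole (y : Site d))) := fun n => by
    rw [dirichletSolve_dipoleSum, pairing_dipoleSum]
    refine Finset.sum_congr rfl fun x _ => ?_
    simp only [pairing_dipole, Finset.sum_apply, Pi.smul_apply, smul_eq_mul,
      ← Finset.sum_sub_distrib, Finset.mul_sum]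
    exact Finset.sum_congr rfl fun y _ => by ring
  simp only [h1, greenForm]
  exact tendsto_finsetSum _ fun x _ => tendsto_finsetSum _ fun y _ => Tendsto.const_mul _
    (tendsto_sum_dirichletSolve hd (fun e => ha.trans_le (hκ e)) (sum_dipole _) (hg y) hΛ')

theorem greenForm_nonneg (hd : 0 < d) (ha : 0 < a) (hκ : ∀ e, a ≤ κ e) (S : Finset (Site d))
    (c : S → ℝ) : 0 ≤ greenForm κ S c := by
  refine ge_of_tendsto (tendsto_pairing_greenForm hd ha hκ S c fun n => subset_rfl) ?_
  filter_upwards [eventually_subset_box (dipoleSum S c).support] with n hn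
  exact pairing_dirichletSolve_nonneg hd (fun e => ha.trans_le (hκ e)) hn

theorem greenForm_eq (hd : 0 < d) (ha : 0 < a) (hκ : ∀ e, a ≤ κ e) {f : Site d →₀ ℝ}
    (hf : (f.sum fun _ a => a) = 0) {g : Site d → ℝ} (hg : IsNegGeneratorInverse κ f g) :
    greenForm κ f.support (fun x => f x) = pairing f g := by
  have h1 := tendsto_pairing_greenForm hd ha hκ f.support (fun x => f x)
    (Λ := box d) fun n => subset_rfl
  rw [dipoleSum_eq hf] at h1
  exact tendsto_nhds_unique h1 (tendsto_sum_dirichletSolve hd (fun e => ha.trans_le (hκ e)) hf hg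
    eventually_subset_box)

end

namespace IsHarmonicDecomposition

variable {μ' : Measure (EdgeConfig d × EdgeConfig d)} {m : EdgeConfig d → EdgeConfig d} {a b : ℝ}

theorem ae_bounds (h : IsHarmonicDecomposition μ' m a b) :
    ∀ᵐ κ ∂μ'.map Prod.snd, ∀ e, κ e ∈ Set.Icc a b := by
  have hm : MeasurableSet {κ : EdgeConfig d | ∀ e, κ e ∈ Set.Icc a b} := by
    have : {κ : EdgeConfig d | ∀ e, κ e ∈ Set.Icc a b} = ⋂ e, (fun κ => κ e) ⁻¹' Set.Icc a b := by
      ext; simp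
    rw [this]
    exact MeasurableSet.iInter fun e => measurable_pi_apply e measurableSet_Icc
  exact (ae_map_iff measurable_snd.aemeasurable hm).2 h.bounds

theorem ae_condDistrib [IsFiniteMeasure μ'] {P : EdgeConfig d → Prop}
    (hP : MeasurableSet {η | P η}) (h : ∀ᵐ p ∂μ', P p.1) :
    ∀ᵐ κ ∂μ'.map Prod.snd, ∀ᵐ η ∂condDistrib Prod.fst Prod.snd μ' κ, P η := by
  have hm : Measurable fun p : EdgeConfig d × EdgeConfig d => (p.2, p.1) :=
    measurable_snd.prodMk measurable_fst
  have h1 : ∀ᵐ q ∂(μ'.map Prod.snd) ⊗ₘ condDistrib Prod.fst Prod.snd μ', P q.2 := by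
    rw [compProd_map_condDistrib measurable_fst.aemeasurable]
    exact (ae_map_iff hm.aemeasurable (measurable_snd hP)).2 h
  exact Measure.ae_ae_of_ae_compProd h1

theorem ae_integral_exp_pairing [IsProbabilityMeasure μ']
    (h : IsHarmonicDecomposition μ' m a b) (hd : 0 < d) (S : Finset (Site d)) (c : S → ℝ) :
    ∀ᵐ κ ∂μ'.map Prod.snd,
      ∫ η, Complex.exp (pairing (dipoleSum S c) (height η) * Complex.I)
        ∂condDistrib Prod.fst Prod.snd μ' κ =
      Complex.exp (pairing (dipoleSum S c) (height (m κ)) * Complex.I) *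
        Complex.exp (-(greenForm κ S c : ℂ) / 2) := by
  have : IsProbabilityMeasure (μ'.map Prod.snd) :=
    Measure.isProbabilityMeasure_map measurable_snd.aemeasurable
  have hκm : ∀ e, Measurable fun κ : EdgeConfig d => κ e := fun e => measurable_pi_apply e
  have hpm : Measurable fun η : EdgeConfig d => pairing (dipoleSum S c) (height η) :=
    measurable_pairing _ fun x => measurable_pi_iff.1 measurable_height x
  have hmm : Measurable fun κ : EdgeConfig d => pairing (dipoleSum S c) (height (m κ)) :=
    hpm.comp h.measurable_mean
  have hQ : AEMeasurable (fun κ => greenForm κ S c) (μ'.map Prod.snd) := by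
    refine aemeasurable_of_tendsto_metrizable_ae atTop (f := fun (n : ℕ) κ =>
      pairing (dipoleSum S c) (dirichletSolve κ (box d n) (dipoleSum S c))) (fun n => ?_) ?_
    · exact (measurable_pairing _ fun x => measurable_dirichletSolve (box d n)
        (r := fun _ => dipoleSum S c) hκm (fun x => measurable_const) x).aemeasurable
    · filter_upwards [h.ae_bounds] with κ hκ
      exact tendsto_pairing_greenForm hd h.pos (fun e => (hκ e).1) S c fun n => subset_rfl
  have hR : AEStronglyMeasurable (fun κ => Complex.exp (pairing (dipoleSum S c) (height (m κ)) *
      Complex.I) * Complex.exp (-(greenForm κ S c : ℂ) / 2)) (μ'.map Prod.snd) := by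
    have h1 : AEMeasurable (fun κ => (greenForm κ S c : ℂ)) (μ'.map Prod.snd) :=
      Complex.measurable_ofReal.comp_aemeasurable hQ
    have h2 : AEMeasurable (fun κ => Complex.exp (-(greenForm κ S c : ℂ) / 2))
        (μ'.map Prod.snd) := Complex.measurable_exp.comp_aemeasurable (h1.neg.div_const 2)
    have h3 : Measurable fun κ => Complex.exp (pairing (dipoleSum S c) (height (m κ)) *
      Complex.I) := by fun_prop
    exact (h3.aemeasurable.mul h2).aestronglyMeasurable
  have hem : Measurable fun η : EdgeConfig d =>
      Complex.exp (pairing (dipoleSum S c) (height η) * Complex.I) := by fun_prop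
  refine Integrable.ae_eq_of_forall_setIntegral_eq _ _ ?_ ?_ fun A hA _ => ?_
  · refine Integrable.of_bound (C := 1) ?_ (.of_forall fun κ => ?_)
    · exact (StronglyMeasurable.integral_condDistrib (f := fun q : EdgeConfig d × EdgeConfig d =>
        Complex.exp (pairing (dipoleSum S c) (height q.2) * Complex.I))
        (hem.comp measurable_snd).stronglyMeasurable).aestronglyMeasurable
    · refine (norm_integral_le_of_norm_le_const (C := 1) (.of_forall fun η => ?_)).trans (by simp)
      rw [Complex.norm_exp_ofReal_mul_I]
  · refine Integrable.of_bound (C := 1) hR ?_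
    filter_upwards [h.ae_bounds] with κ hκ
    rw [norm_mul, Complex.norm_exp_ofReal_mul_I, one_mul, Complex.norm_exp, Real.exp_le_one_iff]
    have := greenForm_nonneg hd h.pos (fun e => (hκ e).1) S c
    simp
    linarith
  · obtain ⟨G, hGdef⟩ : ∃ G : EdgeConfig d → ℂ, G = A.indicator 1 := ⟨_, rfl⟩
    have hG : Measurable G := hGdef ▸ measurable_one.indicator hA
    have hG1 : ∀ κ, ‖G κ‖ ≤ 1 := fun κ => by
      rw [hGdef]
      exact (norm_indicator_le_norm_self _ _).trans (by simp)
    have hGmul : ∀ F : EdgeConfig d → ℂ, A.indicator F = fun κ => G κ * F κ := fun F => by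
      ext κ
      by_cases hk : κ ∈ A
      · rw [hGdef, Set.indicator_of_mem hk, Set.indicator_of_mem hk, Pi.one_apply, one_mul]
      · rw [hGdef, Set.indicator_of_notMem hk, Set.indicator_of_notMem hk, zero_mul]
    have hm : Measurable fun p : EdgeConfig d × EdgeConfig d => (p.2, p.1) :=
      measurable_snd.prodMk measurable_fst
    have hFm : Measurable fun q : EdgeConfig d × EdgeConfig d =>
        G q.1 * Complex.exp (pairing (dipoleSum S c) (height q.2) * Complex.I) :=
      (hG.comp measurable_fst).mul (hem.comp measurable_snd)
    have key := h.integral_mul_exp_pairing_eq hd (sum_dipoleSum S c)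
      (Q := fun κ => greenForm κ S c) (fun κ hκ Λ hΛ => tendsto_pairing_greenForm hd h.pos
        (fun e => (hκ e).1) S c hΛ) hG hG1
    rw [← integral_indicator hA, ← integral_indicator hA, hGmul, hGmul]
    have hL : ∫ κ, G κ * ∫ η, Complex.exp (pairing (dipoleSum S c) (height η) * Complex.I)
        ∂condDistrib Prod.fst Prod.snd μ' κ ∂μ'.map Prod.snd =
        ∫ p, G p.2 * Complex.exp (pairing (dipoleSum S c) (height p.1) * Complex.I) ∂μ' := by
      have hintg : Integrable (fun q : EdgeConfig d × EdgeConfig d =>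
          G q.1 * Complex.exp (pairing (dipoleSum S c) (height q.2) * Complex.I))
          ((μ'.map Prod.snd) ⊗ₘ condDistrib Prod.fst Prod.snd μ') := by
        refine Integrable.of_bound (C := 1) hFm.aestronglyMeasurable (.of_forall fun q => ?_)
        rw [norm_mul, Complex.norm_exp_ofReal_mul_I, mul_one]
        exact hG1 _
      have h1 := Measure.integral_compProd hintg
      simp only [integral_const_mul] at h1
      rw [← h1, compProd_map_condDistrib measurable_fst.aemeasurable,
        integral_map hm.aemeasurable hFm.aestronglyMeasurable]
    have hGR : AEStronglyMeasurable (fun κ => G κ *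
        (Complex.exp (pairing (dipoleSum S c) (height (m κ)) * Complex.I) *
          Complex.exp (-(greenForm κ S c : ℂ) / 2))) (μ'.map Prod.snd) :=
      hG.aestronglyMeasurable.mul hR
    exact hL.trans (key.trans (integral_map measurable_snd.aemeasurable hGR).symm)

theorem ae_map_condDistrib [IsProbabilityMeasure μ']
    (h : IsHarmonicDecomposition μ' m a b) (hd : 0 < d) :
    ∀ᵐ κ ∂μ'.map Prod.snd, ∀ (S : Finset (Site d)) (c : S → ℝ),
      (condDistrib Prod.fst Prod.snd μ' κ).map (fun η => ∑ x : S, c x * height η x) =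
        gaussianReal (∑ x : S, c x * height (m κ) x) (greenForm κ S c).toNNReal := by
  -- There are countably many finite sets S with rational coefficients, so one null set suffices;
  -- the density of the rationals then covers real coefficients.
  have hae : ∀ᵐ κ ∂μ'.map Prod.snd, ∀ (S : Finset (Site d)) (q : S → ℚ),
      ∫ η, Complex.exp (pairing (dipoleSum S fun x => (q x : ℝ)) (height η) * Complex.I)
        ∂condDistrib Prod.fst Prod.snd μ' κ =
      Complex.exp (pairing (dipoleSum S fun x => (q x : ℝ)) (height (m κ)) * Complex.I) *
        Complex.exp (-(greenForm κ S fun x => (q x : ℝ) : ℂ) / 2) := by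
    simp only [ae_all_iff]
    exact fun S q => h.ae_integral_exp_pairing hd S _
  filter_upwards [hae, h.ae_bounds] with κ hκ hb S c
  have hhm : ∀ x, Measurable fun η : EdgeConfig d => height η x := fun x =>
    measurable_pi_iff.1 measurable_height x
  simp only [pairing_dipoleSum_height] at hκ
  have hall : ∀ c : S → ℝ,
      ∫ η, Complex.exp ((∑ x : S, c x * height η x : ℝ) * Complex.I)
        ∂condDistrib Prod.fst Prod.snd μ' κ =
      Complex.exp ((∑ x : S, c x * height (m κ) x : ℝ) * Complex.I) *
        Complex.exp (-(greenForm κ S c : ℂ) / 2) := by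
    have hdense : DenseRange (Pi.map fun (_ : S) (q : ℚ) => (q : ℝ)) :=
      DenseRange.piMap fun _ => Rat.denseRange_cast
    have hl : Continuous fun c : S → ℝ =>
        ∫ η, Complex.exp ((∑ x : S, c x * height η x : ℝ) * Complex.I)
          ∂condDistrib Prod.fst Prod.snd μ' κ := by
      refine continuous_of_dominated (bound := fun _ => 1) (fun c => ?_) (fun c => ?_)
        (integrable_const _) (.of_forall fun η => by fun_prop)
      · have : Measurable fun η : EdgeConfig d => ∑ x : S, c x * height η x :=
          Finset.measurable_fun_sum _ fun x _ => (hhm x).const_mul _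
        exact Measurable.aestronglyMeasurable (by fun_prop)
      · exact .of_forall fun η => by rw [Complex.norm_exp_ofReal_mul_I]
    have hr : Continuous fun c : S → ℝ =>
        Complex.exp ((∑ x : S, c x * height (m κ) x : ℝ) * Complex.I) *
          Complex.exp (-(greenForm κ S c : ℂ) / 2) := by
      have := continuous_greenForm κ S
      fun_prop
    exact fun c => congrFun (hdense.equalizer hl hr (funext fun q => hκ S q)) c
  have hXm : Measurable fun η : EdgeConfig d => ∑ x : S, c x * height η x :=
    Finset.measurable_fun_sum _ fun x _ => (hhm x).const_mul _
  have := Measure.isProbabilityMeasure_map (μ := condDistrib Prod.fst Prod.snd μ' κ)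
    hXm.aemeasurable
  refine Measure.ext_of_charFun (funext fun s => ?_)
  rw [charFun_gaussianReal, charFun_apply_real, integral_map hXm.aemeasurable (by fun_prop),
    Real.coe_toNNReal _ (greenForm_nonneg hd h.pos (fun e => (hb e).1) S c)]
  have h1 := hall (s • c)
  have h2 : ∀ u : Site d → ℝ, ∑ x : S, (s • c) x * u x = s * ∑ x : S, c x * u x := fun u => by
    simp only [Pi.smul_apply, smul_eq_mul, mul_assoc, Finset.mul_sum]
  simp only [h2, greenForm_smul, Complex.ofReal_mul] at h1
  rw [h1, ← Complex.exp_add]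
  congr 1
  push_cast
  ring

end IsHarmonicDecomposition

theorem measurableSet_loopCondition : MeasurableSet {η : EdgeConfig d | LoopCondition η} := by
  have h : {η : EdgeConfig d | LoopCondition η} = ⋂ (x : Site d) (i : Fin d) (j : Fin d),
      {η | η (x, i) + η (x + unit i, j) - η (x + unit j, i) - η (x, j) = 0} := by
    ext η
    simp only [Set.mem_iInter]
    rfl
  rw [h]
  exact .iInter fun x => .iInter fun i => .iInter fun j =>
    measurableSet_eq_fun (by fun_prop) measurable_const

/-! ### From one-dimensional Gaussian laws to Gaussian processes -/

theorem isGaussian_map_pi {Ω ι : Type*} [MeasurableSpace Ω] [Fintype ι] {P : Measure Ω}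
    {X : Ω → ι → ℝ} (hX : Measurable X)
    (h : ∀ c : ι → ℝ, ∃ m v, P.map (fun ω => ∑ x, c x * X ω x) = gaussianReal m v) :
    IsGaussian (P.map X) := by
  classical
  refine isGaussian_of_map_eq_gaussianReal fun L => ?_
  obtain ⟨m, v, hmv⟩ := h fun x => L (Pi.single x 1)
  refine ⟨m, v, ?_⟩
  rw [Measure.map_map L.measurable hX, ← hmv]
  congr 1
  ext ω
  rw [Function.comp_apply]
  conv_lhs => rw [← Finset.univ_sum_single (X ω), map_sum]
  refine Finset.sum_congr rfl fun x _ => ?_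
  rw [show Pi.single x (X ω x) = X ω x • Pi.single x (1 : ℝ) by
    rw [← Pi.single_smul, smul_eq_mul, mul_one], map_smul, smul_eq_mul, mul_comm]

theorem isGaussianProcess_of_map_sum {Ω T : Type*} [MeasurableSpace Ω] {P : Measure Ω}
    {X : T → Ω → ℝ} (hX : ∀ x, Measurable (X x))
    (h : ∀ (S : Finset T) (c : S → ℝ),
      ∃ m v, P.map (fun ω => ∑ x : S, c x * X x ω) = gaussianReal m v) :
    IsGaussianProcess X P :=
  ⟨fun S => ⟨isGaussian_map_pi (measurable_pi_lambda _ fun x => hX x) (h S)⟩⟩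

/-! ### The extension as a harmonic decomposition -/

theorem isTranslationInvariant_map_snd {μ' : Measure (EdgeConfig d × EdgeConfig d)}
    (h : ∀ x, μ'.map (Prod.map (shift x) (shift x)) = μ') :
    IsTranslationInvariant (μ'.map Prod.snd) := fun x => by
  have hs := measurable_shift (d := d) x
  conv_rhs => rw [← h x, Measure.map_map measurable_snd (hs.prodMap hs)]
  rw [Measure.map_map hs measurable_snd]
  rfl

/-- The deviation splits into heights minus t·x, governed by μ, and the corrector, governed by the
law of κ. Each grows sublinearly under its own marginal, so no joint ergodicity is needed. -/
theorem lintegral_height_sub_meanIncrement_le {μ : Measure (EdgeConfig d)}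
    [IsProbabilityMeasure μ] {μ' : Measure (EdgeConfig d × EdgeConfig d)}
    [IsProbabilityMeasure μ'] (hloop : ∀ᵐ η ∂μ, LoopCondition η)
    (hinv : IsTranslationInvariant μ) (herg : IsErgodic μ) {t : Vec d} (ht : HasTilt μ t)
    (hfst : μ'.map Prod.fst = μ) (hsnd : IsTranslationInvariant (μ'.map Prod.snd)) {a b : ℝ}
    (ha : 0 < a) (hκ : ∀ᵐ κ ∂μ'.map Prod.snd, ∀ e, κ e ∈ Set.Icc a b) {δ : ℝ} (hδ : 0 < δ) :
    ∃ C, 0 ≤ C ∧ ∀ x : Site d,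
      ∫⁻ p, ‖height (p.1 - meanIncrement (μ'.map Prod.snd) t p.2) x‖ₑ ∂μ' ≤
        ENNReal.ofReal (C + δ * ‖x‖) := by
  have : IsProbabilityMeasure (μ'.map Prod.snd) :=
    Measure.isProbabilityMeasure_map measurable_snd.aemeasurable
  obtain ⟨C₁, hC₁, h₁⟩ := lintegral_height_sub_le hloop hinv herg ht (half_pos hδ)
  obtain ⟨C₂, hC₂, h₂⟩ := lintegral_pathSum_correctorIncrement_le ha hκ hsnd t (half_pos hδ)
  refine ⟨C₁ + C₂, add_nonneg hC₁ hC₂, fun x => ?_⟩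
  have hhm : Measurable fun η : EdgeConfig d => height η x :=
    measurable_pi_iff.1 measurable_height x
  have hm₁ : Measurable fun η : EdgeConfig d =>
      ‖height (η - fun e => ⟪t, toVec (unit e.2)⟫) x‖ₑ :=
    (hhm.comp (measurable_id.sub_const _)).enorm
  have hm₂ : Measurable fun κ : EdgeConfig d =>
      ‖height (correctorIncrement (μ'.map Prod.snd) t κ) x‖ₑ :=
    (hhm.comp (measurable_correctorIncrement _ t)).enorm
  have hx := norm_nonneg x
  calc ∫⁻ p, ‖height (p.1 - meanIncrement (μ'.map Prod.snd) t p.2) x‖ₑ ∂μ'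
      ≤ ∫⁻ p, (‖height (p.1 - fun e => ⟪t, toVec (unit e.2)⟫) x‖ₑ +
          ‖height (correctorIncrement (μ'.map Prod.snd) t p.2) x‖ₑ) ∂μ' := by
        refine lintegral_mono fun p => ?_
        have : height (p.1 - meanIncrement (μ'.map Prod.snd) t p.2) x =
            height (p.1 - fun e => ⟪t, toVec (unit e.2)⟫) x -
              height (correctorIncrement (μ'.map Prod.snd) t p.2) x := by
          simp only [height, meanIncrement, pathSum_sub, pathSum_add]
          ring
        rw [this]
        exact enorm_sub_le
    _ = ∫⁻ η, ‖height (η - fun e => ⟪t, toVec (unit e.2)⟫) x‖ₑ ∂μ +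
          ∫⁻ κ, ‖height (correctorIncrement (μ'.map Prod.snd) t κ) x‖ₑ ∂μ'.map Prod.snd := by
        have hm : Measurable fun p : EdgeConfig d × EdgeConfig d =>
            ‖height (p.1 - fun e => ⟪t, toVec (unit e.2)⟫) x‖ₑ := hm₁.comp measurable_fst
        rw [lintegral_add_left hm, lintegral_map hm₂ measurable_snd, ← hfst,
          lintegral_map hm₁ measurable_fst]
    _ ≤ ENNReal.ofReal (C₁ + δ / 2 * ‖x‖) + ENNReal.ofReal (C₂ + δ / 2 * ‖x‖) :=
        add_le_add (h₁ x) (h₂ x)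
    _ = ENNReal.ofReal (C₁ + C₂ + δ * ‖x‖) := by
        rw [← ENNReal.ofReal_add (by positivity) (by positivity)]
        congr 1
        ring

theorem IsExtension.exists_isHarmonicDecomposition (hd : 0 < d)
    {ρ : Measure ℝ} [IsFiniteMeasure ρ] (hρ0 : ρ ≠ 0)
    (hρ : ∃ K : Set ℝ, IsCompact K ∧ K ⊆ Set.Ioi 0 ∧ ρ Kᶜ = 0)
    {μ : Measure (EdgeConfig d)} [IsProbabilityMeasure μ] (hμ : IsGradientGibbs (potential ρ) μ)
    (hinv : IsTranslationInvariant μ) (herg : IsErgodic μ) {t : Vec d} (ht : HasTilt μ t)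
    {μ' : Measure (EdgeConfig d × EdgeConfig d)} [IsProbabilityMeasure μ']
    (hμ' : IsExtension ρ μ μ') :
    ∃ a b, IsHarmonicDecomposition μ' (meanIncrement (μ'.map Prod.snd) t) a b := by
  obtain ⟨K, hKc, hKpos, hK⟩ := hρ
  have hne : K.Nonempty := by
    rw [Set.nonempty_iff_ne_empty]
    rintro rfl
    exact hρ0 (Measure.measure_univ_eq_zero.1 (by rwa [Set.compl_empty] at hK))
  -- The ellipticity constants are the extreme points of the compact set carrying ϱ; the smaller one
  -- is positive since that set lies in (0,∞).
  obtain ⟨a, ha⟩ := hKc.exists_isLeast hne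
  obtain ⟨b, hb⟩ := hKc.exists_isGreatest hne
  have ha0 : 0 < a := hKpos ha.1
  have hprob : IsProbabilityMeasure (μ'.map Prod.snd) :=
    Measure.isProbabilityMeasure_map measurable_snd.aemeasurable
  have hbd : ∀ᵐ p ∂μ', ∀ e, p.2 e ∈ Set.Icc a b := by
    filter_upwards [hμ'.ae_mem hKc.measurableSet hK] with p hp e
    exact ⟨ha.2 (hp e), hb.2 (hp e)⟩
  have hbd' : ∀ᵐ κ ∂μ'.map Prod.snd, ∀ e, κ e ∈ Set.Icc a b := by
    have hs : MeasurableSet {κ : EdgeConfig d | ∀ e, κ e ∈ Set.Icc a b} := by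
      rw [Set.ofPred_forall]
      exact .iInter fun e => measurable_pi_apply e measurableSet_Icc
    exact (ae_map_iff measurable_snd.aemeasurable hs).2 hbd
  have hsnd := isTranslationInvariant_map_snd (hμ'.map_shift hinv)
  have hfst := hμ'.map_fst
  refine ⟨a, b, ha0, hbd, ?_, ?_, measurable_meanIncrement _ t, meanIncrement_shift _ t, ?_,
    hμ'.map_shift hinv, hμ'.map_resample hd hμ hKc.measurableSet hKpos hK, fun δ hδ =>
      lintegral_height_sub_meanIncrement_le hμ.loop hinv herg ht hfst hsnd ha0 hbd' hδ⟩
  · have hl := hμ.loop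
    rw [← hfst] at hl
    exact ae_of_ae_map measurable_fst.aemeasurable hl
  · exact ae_of_ae_map measurable_snd.aemeasurable
      (ae_loopCondition_meanIncrement ha0 hbd' hsnd t)
  · exact ae_of_ae_map measurable_snd.aemeasurable
      (ae_generator_height_meanIncrement ha0 hbd' hsnd t)

end GradientGibbs

end

open GradientGibbs in
theorem corollary5p6 (d : ℕ) (hd : 0 < d)
    (ρ : Measure ℝ) [IsFiniteMeasure ρ] (hρ0 : ρ ≠ 0)
    (hρ : ∃ K : Set ℝ, IsCompact K ∧ K ⊆ Set.Ioi 0 ∧ ρ Kᶜ = 0)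
    (μ : Measure (EdgeConfig d)) [IsProbabilityMeasure μ]
    (hμ : IsGradientGibbs (potential ρ) μ)
    (hinv : IsTranslationInvariant μ) (herg : IsErgodic μ)
    (t : Vec d) (ht : HasTilt μ t)
    (μ' : Measure (EdgeConfig d × EdgeConfig d)) [IsProbabilityMeasure μ']
    (hμ' : IsExtension ρ μ μ') :
    ∀ᵐ κ ∂μ'.map Prod.snd,
      (∀ᵐ η ∂condDistrib Prod.fst Prod.snd μ' κ, LoopCondition η) ∧
      IsGaussianProcess (fun (x : Site d) (η : EdgeConfig d) => height η x)
        (condDistrib Prod.fst Prod.snd μ' κ) ∧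
      (∀ x : Site d, ∫ η, height η x ∂condDistrib Prod.fst Prod.snd μ' κ =
        ⟪t, toVec x + corrector (μ'.map Prod.snd) κ x⟫) ∧
      ∀ f : Site d →₀ ℝ, (f.sum fun _ a => a) = 0 →
        (∃ g, IsNegGeneratorInverse κ f g) ∧
        ∀ g, IsNegGeneratorInverse κ f g →
          Var[fun η => f.sum fun x a => a * height η x; condDistrib Prod.fst Prod.snd μ' κ] =
            f.sum fun x a => a * g x := by
  obtain ⟨a, b, h⟩ := hμ'.exists_isHarmonicDecomposition hd hρ0 hρ hμ hinv herg ht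
  have hhm : ∀ x, Measurable fun η : EdgeConfig d => height η x := fun x =>
    measurable_pi_iff.1 measurable_height x
  filter_upwards [IsHarmonicDecomposition.ae_condDistrib measurableSet_loopCondition h.loop,
    h.ae_map_condDistrib hd, h.ae_bounds] with κ hloop hκ hb
  have hlaw : ∀ (S : Finset (Site d)) (c : S → ℝ),
      HasLaw (fun η : EdgeConfig d => ∑ x : S, c x * height η x)
        (gaussianReal (∑ x : S, c x * height (meanIncrement (μ'.map Prod.snd) t κ) x)
          (greenForm κ S c).toNNReal) (condDistrib Prod.fst Prod.snd μ' κ) := fun S c => by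
    have hm : Measurable fun η : EdgeConfig d => ∑ x : S, c x * height η x :=
      Finset.measurable_fun_sum _ fun x _ => (hhm x).const_mul _
    exact ⟨hm.aemeasurable, hκ S c⟩
  have hba : ∀ e, a ≤ κ e := fun e => (hb e).1
  refine ⟨hloop, isGaussianProcess_of_map_sum hhm fun S c => ⟨_, _, hκ S c⟩, fun x => ?_, fun f hf =>
    ⟨exists_isNegGeneratorInverse hd h.pos hba hf, fun g hg => ?_⟩⟩
  · have h1 := (hlaw {x} fun _ => 1).integral_eq
    rw [integral_id_gaussianReal] at h1
    simpa only [one_mul, Finset.univ_unique, Finset.sum_singleton, Finset.default_singleton,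
      height_meanIncrement] using h1
  · have h1 := (hlaw f.support fun x => f x).variance_eq
    rw [variance_id_gaussianReal, Real.coe_toNNReal _ (greenForm_nonneg hd h.pos hba _ _),
      greenForm_eq hd h.pos hba hf hg] at h1
    rw [pairing] at h1
    rw [← h1]
    congr 1
    ext η
    exact (Finset.sum_coe_sort f.support fun x => f x * height η x).symm
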